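/- Let $M$ be a smooth 4-manifold and $K$ a smooth $k$-manifold. Let $g_M$ be a Lorentzian metric on $M$ (signature $-+++$), $g_K=g_K(x)$ a smooth family of Riemannian metrics on $K$ parametrized by $x\in M$, and $A$ a smooth one-form on $M$ with values in the vector fields on $K$. Equip $P=M\times K$ with the Lorentzian metric given, for $X,Y\in TM$ and $U,V\in TK$, by $$g_P(U,V)=g_K(U,V),\qquad g_P(X,V)=-g_K(A(X),V),\qquad g_P(X,Y)=g_M(X,Y)+g_K(A(X),A(Y)).$$ The horizontal lift of a vector field $X$ on $M$ is $X^{\mathcal H}=X+A(X)$, and the curvature of $A$ is $F_A(X,Y)=(\mathrm d_MA)(X,Y)+[A(X),A(Y)]$, a vector field on $K$ for each $x$. Gamma matrices satisfy $\{\gamma_\mu,\gamma_\nu\}=-2\eta_{\mu\nu}$ on $\mathbb C^4$ with $\eta=\mathrm{diag}(-1,1,1,1)$, and $\{\rho_i,\rho_j\}=-2\delta_{ij}$ on $\mathbb C^{2^{\lfloor k/2\rfloor}}$; $\gamma_5=i\gamma_0\gamma_1\gamma_2\gamma_3$; on the tensor product put $\Gamma_\mu=\gamma_\mu\otimes 1$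 and $\Gamma_{3+j}=\gamma_5\otimes\rho_j$. Fix spin structures on $(M,g_M)$ and on the vertical bundle $TK\to P$ (with the fibre metrics $g_K$). They determine a spin structure on $(P,g_P)$ whose spinors take values in $\mathbb C^4\otimes\mathbb C^{2^{\lfloor k/2\rfloor}}$. Let $\varphi$ be a smooth spinor on $M$, $\psi=\psi(x,y)$ a smooth vertical spinor on $P$, and $\Psi=\varphi^{\mathcal H}\otimes\psi$, where $\varphi^{\mathcal H}$ is the pull-back of $\varphi$. Let $\{X_\mu\}$ be a local $g_M$-orthonormal frame of $TM$ and $\{v_j\}$ a local $g_K$-orthonormal frame of the vertical bundle belonging to these spin structures; spinors are represented by functions in the trivializations that these frames and the frame $u=\{X_\mu^{\mathcal H},v_j\}$ of $TP$ induce, and $\partial$ denotes directional derivatives of these functions. For an orthonormal frame $\{u_r\}$ with $g(u_r,u_s)=\eta_r\delta_{rs}$ and Levi-Civita connection $\nabla$, write $$\nabla_X\Psi=\partial_X\Psi+\tfrac14\sum_{r,s}\eta_r\eta_s\,g(\nabla_Xu_r,u_s)\,u_r\cdot u_s\cdot\Psi,\qquad \slashed D\Psi=\sum_r\eta_r\,u_r\cdot\nabla_{u_r}\Psi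 .$$ For a vector field $e$ on $K$ and fixed $x$, computed on the fibre $(K,g_K(x))$, let $$\mathscr L_e\psi=\nabla_e\psi-\tfrac18\sum_{i,j}\big[g_K(\nabla_{v_i}e,v_j)-g_K(\nabla_{v_j}e,v_i)\big]v_i\cdot v_j\cdot\psi,\qquad \operatorname{div}(e)=\sum_i g_K(\nabla_{v_i}e,v_i),$$ let $\slashed D^K$ be the Dirac operator of that fibre, and let $|g_K|$ be the modulus of the determinant of the matrix of $g_K$ in a fixed coordinate system on $K$. (a) Where these frames and coordinates are defined, $$\begin{aligned}\slashed D^P\Psi={}&g_M^{\mu\nu}(X_\mu\cdot\nabla^M_{X_\nu}\varphi)^{\mathcal H}\otimes\psi+g_M^{\mu\nu}(X_\mu\cdot\varphi)^{\mathcal H}\otimes\big[\mathscr L_{A(X_\nu)}+\tfrac12\operatorname{div}(A(X_\nu))\big]\psi\\&+(\gamma_5\cdot\varphi)^{\mathcal H}\otimes\slashed D^K\psi+\tfrac18\,g_M^{\mu\sigma}g_M^{\nu\tau}(X_\mu\cdot X_\nu\cdot\gamma_5\cdot\varphi)^{\mathcal H}\otimes\big(F_A(X_\sigma,X_\tau)\cdot\psi\big)\\&+g_M^{\mu\nu}(X_\mu\cdot\varphi)^{\mathcal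 H}\otimes\big[\partial_{X_\nu}+\tfrac12\big(\partial_{X_\nu}\log\sqrt{|g_K|}\big)\big]\psi\\&+g_M^{\mu\nu}(X_\mu\cdot\varphi)^{\mathcal H}\otimes\Big(\tfrac18\sum_{i,j}\{g_P([X_\nu,v_i],v_j)-g_P([X_\nu,v_j],v_i)\}\,v_i\cdot v_j\cdot\psi\Big).\end{aligned}$$ (b) If $A=\sum_aA^ae_a$ is a finite sum with smooth one-forms $A^a$ on $M$ and smooth vector fields $e_a$ on $K$, then in (a) the second term may be written $g_M^{\mu\nu}A^a_\nu\,(X_\mu\cdot\varphi)^{\mathcal H}\otimes[\mathscr L_{e_a}+\tfrac12\operatorname{div}(e_a)]\psi$ with $A^a_\nu=A^a(X_\nu)$, and $F_A(X,Y)=(\mathrm dA^a)(X,Y)\,e_a+A^a(X)A^b(Y)[e_a,e_b]$ in the fourth term. (c) Over any open subset of $M$ on which $g_K$ is constant, and $v_j$ and $\psi$ do not depend on the point of $M$, the formulas of (a) and (b) hold with the last two lines of (a) omitted. -/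

import Mathlib

open scoped Manifold ContDiff Matrix Kronecker

set_option linter.unusedSectionVars false

noncomputable section

namespace KaluzaKlein

section Algebra

variable {ι : Type*} [Fintype ι] [DecidableEq ι]
variable {κ : Type*} [Fintype κ] [DecidableEq κ]
variable {s : Type*} [Fintype s] [DecidableEq s]
variable {t : Type*} [Fintype t] [DecidableEq t]

/-- The quadratic form `v ↦ - ∑ i, η i * v i ^ 2`. In its Clifford algebra the generator `e i` has
square `- η i`, so spatial gamma matrices are square roots of `-1`. -/
def cliffordForm (η : ι → ℝ) : QuadraticForm ℝ (ι → ℝ) :=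
  QuadraticMap.weightedSumSquares ℝ (fun i => -η i)

lemma cliffordForm_apply (η : ι → ℝ) (v : ι → ℝ) :
    cliffordForm η v = ∑ i, -(η i) * (v i * v i) := by
  simp [cliffordForm, QuadraticMap.weightedSumSquares_apply]

/-- Gamma matrices for the metric `diag η`: `{γ i, γ j} = - 2 η i δ_ij`. -/
structure GammaMatrices (η : ι → ℝ) (s : Type*) [Fintype s] [DecidableEq s] where
  mat : ι → Matrix s s ℂ
  rel : ∀ i j, mat i * mat j + mat j * mat i =
    if i = j then ((-2 * η i : ℝ) : ℂ) • (1 : Matrix s s ℂ) else 0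

instance {η : ι → ℝ} : CoeFun (GammaMatrices η s) (fun _ => ι → Matrix s s ℂ) :=
  ⟨GammaMatrices.mat⟩

/-- Clifford multiplication by the vector with components `c` in an orthonormal basis. -/
def GammaMatrices.vec {η : ι → ℝ} (γ : GammaMatrices η s) : (ι → ℝ) →ₗ[ℝ] Matrix s s ℂ :=
  ∑ i, (LinearMap.proj i : (ι → ℝ) →ₗ[ℝ] ℝ).smulRight (γ i)

lemma GammaMatrices.vec_apply {η : ι → ℝ} (γ : GammaMatrices η s) (c : ι → ℝ) :
    γ.vec c = ∑ i, c i • γ i := by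
  simp [GammaMatrices.vec]

lemma GammaMatrices.vec_sq {η : ι → ℝ} (γ : GammaMatrices η s) (c : ι → ℝ) :
    γ.vec c * γ.vec c = algebraMap ℝ (Matrix s s ℂ) (cliffordForm η c) := by
  have h2 : (2 : ℝ) • (γ.vec c * γ.vec c)
      = (2 : ℝ) • algebraMap ℝ (Matrix s s ℂ) (cliffordForm η c) := by
    have e1 : γ.vec c * γ.vec c = ∑ i, ∑ j, (c i * c j) • (γ i * γ j) := by
      rw [γ.vec_apply, Finset.sum_mul_sum]
      simp [smul_smul, mul_comm]
    have e2 : γ.vec c * γ.vec c = ∑ i, ∑ j, (c i * c j) • (γ j * γ i) := by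
      rw [e1, Finset.sum_comm]
      simp [mul_comm]
    have e3 : (2 : ℝ) • (γ.vec c * γ.vec c)
        = ∑ i, ∑ j, (c i * c j) • (γ i * γ j + γ j * γ i) := by
      rw [two_smul]
      nth_rewrite 1 [e1]
      rw [e2]
      simp [Finset.sum_add_distrib]
    rw [e3, cliffordForm_apply, Algebra.algebraMap_eq_smul_one, Finset.sum_smul, Finset.smul_sum]
    refine Finset.sum_congr rfl fun i _ => ?_
    simp only [γ.rel, smul_ite, smul_zero, Finset.sum_ite_eq, Finset.mem_univ, if_true]
    ext a b
    simp only [Matrix.smul_apply, Complex.real_smul, smul_eq_mul]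
    push_cast
    ring
  exact smul_right_injective _ (two_ne_zero) h2

/-- The representation of the Clifford algebra determined by gamma matrices. -/
def GammaMatrices.rep {η : ι → ℝ} (γ : GammaMatrices η s) :
    CliffordAlgebra (cliffordForm η) →ₐ[ℝ] Matrix s s ℂ :=
  CliffordAlgebra.lift (cliffordForm η) ⟨γ.vec, γ.vec_sq⟩

/-- The signature `(-1, 1, 1, 1)`. -/
def etaM : Fin 4 → ℝ := ![-1, 1, 1, 1]

/-- The positive definite signature in dimension `k`. -/
def etaK (k : ℕ) : Fin k → ℝ := fun _ => 1

/-- The signature `(-1, 1, …, 1)` in dimension `4 + k`. -/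
def etaP (k : ℕ) : Fin 4 ⊕ Fin k → ℝ := Sum.elim etaM (etaK k)

/-- The chirality operator `γ₅ = i γ₀ γ₁ γ₂ γ₃`. -/
def gamma5 (γ : GammaMatrices etaM s) : Matrix s s ℂ :=
  Complex.I • (γ 0 * γ 1 * γ 2 * γ 3)

lemma GammaMatrices.sq {η : ι → ℝ} (γ : GammaMatrices η s) (i : ι) :
    γ i * γ i = ((-η i : ℝ) : ℂ) • (1 : Matrix s s ℂ) := by
  have h := γ.rel i i
  rw [if_pos rfl, ← two_smul ℂ] at h
  have : (2 : ℂ) • (γ i * γ i) = (2 : ℂ) • (((-η i : ℝ) : ℂ) • (1 : Matrix s s ℂ)) := by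
    rw [h, smul_smul]; push_cast; ring_nf
  exact smul_right_injective _ (two_ne_zero) this

lemma GammaMatrices.anti {η : ι → ℝ} (γ : GammaMatrices η s) {i j : ι} (h : i ≠ j) :
    γ i * γ j = -(γ j * γ i) := by
  have := γ.rel i j
  rw [if_neg h] at this
  exact eq_neg_of_add_eq_zero_left this

lemma GammaMatrices.anti_assoc {η : ι → ℝ} (γ : GammaMatrices η s) {i j : ι} (h : i ≠ j)
    (x : Matrix s s ℂ) : γ i * (γ j * x) = -(γ j * (γ i * x)) := by
  rw [← mul_assoc, γ.anti h, neg_mul, mul_assoc]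

lemma gamma5_anti (γ : GammaMatrices etaM s) (μ : Fin 4) :
    γ μ * gamma5 γ = -(gamma5 γ * γ μ) := by
  have key : γ μ * (γ 0 * γ 1 * γ 2 * γ 3) = -(γ 0 * γ 1 * γ 2 * γ 3 * γ μ) := by
    have d : ∀ i j : Fin 4, i < j → j ≠ i := fun i j h => h.ne'
    fin_cases μ <;>
      simp [mul_assoc, γ.anti_assoc (d 0 1 (by decide)), γ.anti_assoc (d 0 2 (by decide)),
        γ.anti_assoc (d 0 3 (by decide)), γ.anti_assoc (d 1 2 (by decide)),
        γ.anti_assoc (d 1 3 (by decide)), γ.anti_assoc (d 2 3 (by decide)),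
        γ.anti (d 0 3 (by decide)), γ.anti (d 1 3 (by decide)), γ.anti (d 2 3 (by decide))]
  simp [gamma5, key]

lemma gamma5_sq (γ : GammaMatrices etaM s) : gamma5 γ * gamma5 γ = 1 := by
  have h0 : γ 0 * γ 0 = 1 := by simpa [etaM] using γ.sq 0
  have h1 : γ 1 * γ 1 = -1 := by simpa [etaM] using γ.sq 1
  have h2 : γ 2 * γ 2 = -1 := by simpa [etaM] using γ.sq 2
  have h3 : γ 3 * γ 3 = -1 := by simpa [etaM] using γ.sq 3
  have m : ∀ i, gamma5 γ * γ i = -(γ i * gamma5 γ) := fun i => by rw [gamma5_anti, neg_neg]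
  have e : gamma5 γ * gamma5 γ = Complex.I • (γ 0 * γ 1 * γ 2 * γ 3 * gamma5 γ) := by
    conv_lhs => arg 1; rw [gamma5]
    rw [smul_mul_assoc]
  have e3 : γ 3 * gamma5 γ = Complex.I • (γ 0 * γ 1 * γ 2) := by
    rw [gamma5_anti, gamma5, smul_mul_assoc, mul_assoc _ (γ 3), h3]; simp
  rw [e, mul_assoc, e3, mul_smul_comm, smul_smul, Complex.I_mul_I]
  have a10 := γ.anti (i := 1) (j := 0) (by decide)
  have a20 := γ.anti (i := 2) (j := 0) (by decide)
  have a21 := γ.anti (i := 2) (j := 1) (by decide)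
  have q : γ 0 * γ 1 * γ 2 * (γ 0 * γ 1 * γ 2) = -1 := by
    calc γ 0 * γ 1 * γ 2 * (γ 0 * γ 1 * γ 2)
        = γ 0 * γ 1 * (γ 2 * γ 0) * γ 1 * γ 2 := by noncomm_ring
      _ = -(γ 0 * (γ 1 * γ 0) * (γ 2 * γ 1) * γ 2) := by rw [a20]; noncomm_ring
      _ = -((γ 0 * γ 0) * (γ 1 * γ 1) * (γ 2 * γ 2)) := by rw [a10, a21]; noncomm_ring
      _ = -1 := by rw [h0, h1, h2]; simp
  rw [q]; simp

/-- Higher-dimensional gamma matrices `Γ_μ = γ_μ ⊗ 1`, `Γ_{3+j} = γ₅ ⊗ ρ_j`. -/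
def gammaP {k : ℕ} (γ : GammaMatrices etaM s) (ρ : GammaMatrices (etaK k) t) :
    GammaMatrices (etaP k) (s × t) where
  mat := Sum.elim (fun μ => γ μ ⊗ₖ (1 : Matrix t t ℂ)) (fun j => gamma5 γ ⊗ₖ ρ j)
  rel := by
    rintro (i | i) (j | j)
    · simp only [Sum.elim_inl, ← Matrix.mul_kronecker_mul, mul_one, ← Matrix.add_kronecker, γ.rel,
        Sum.inl.injEq, etaP]
      split_ifs with h
      · rw [Matrix.smul_kronecker, Matrix.one_kronecker_one]
      · simp
    · simp only [Sum.elim_inl, Sum.elim_inr, ← Matrix.mul_kronecker_mul, mul_one, one_mul,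
        reduceCtorEq, if_false, ← Matrix.add_kronecker, gamma5_anti, neg_add_cancel,
        Matrix.zero_kronecker]
    · simp only [Sum.elim_inl, Sum.elim_inr, ← Matrix.mul_kronecker_mul, mul_one, one_mul,
        reduceCtorEq, if_false, ← Matrix.add_kronecker, gamma5_anti, add_neg_cancel,
        Matrix.zero_kronecker]
    · simp only [Sum.elim_inr, ← Matrix.mul_kronecker_mul, gamma5_sq, ← Matrix.kronecker_add, ρ.rel,
        Sum.inr.injEq, etaP]
      split_ifs with h
      · rw [Matrix.kronecker_smul, Matrix.one_kronecker_one]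
      · simp

/-- The tensor product of two spinors. -/
def tensor (φ : s → ℂ) (ψ : t → ℂ) : s × t → ℂ := fun i => φ i.1 * ψ i.2

lemma kronecker_mulVec_tensor (A : Matrix s s ℂ) (B : Matrix t t ℂ) (φ : s → ℂ) (ψ : t → ℂ) :
    (A ⊗ₖ B) *ᵥ tensor φ ψ = tensor (A *ᵥ φ) (B *ᵥ ψ) := by
  ext ⟨i, j⟩
  simp only [Matrix.mulVec, dotProduct, tensor, Matrix.kroneckerMap_apply, Fintype.sum_prod_type,
    Finset.sum_mul_sum]
  refine Finset.sum_congr rfl fun a _ => Finset.sum_congr rfl fun b _ => by ring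

/-- The inclusions of the two factors in the orthogonal sum. -/
def isoL (k : ℕ) : cliffordForm etaM →qᵢ cliffordForm (etaP k) where
  toLinearMap := LinearMap.pi (Sum.elim (fun i => LinearMap.proj i) (fun _ => 0))
  map_app' v := by
    simp [cliffordForm_apply, Fintype.sum_sum_type, etaP]

def isoR (k : ℕ) : cliffordForm (etaK k) →qᵢ cliffordForm (etaP k) where
  toLinearMap := LinearMap.pi (Sum.elim (fun _ => 0) (fun i => LinearMap.proj i))
  map_app' v := by
    simp [cliffordForm_apply, Fintype.sum_sum_type, etaP]

lemma isoL_inl {k : ℕ} (v : Fin 4 → ℝ) (i : Fin 4) : isoL k v (Sum.inl i) = v i := rfl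
lemma isoL_inr {k : ℕ} (v : Fin 4 → ℝ) (j : Fin k) : isoL k v (Sum.inr j) = 0 := rfl
lemma isoR_inl {k : ℕ} (v : Fin k → ℝ) (i : Fin 4) : isoR k v (Sum.inl i) = 0 := rfl
lemma isoR_inr {k : ℕ} (v : Fin k → ℝ) (j : Fin k) : isoR k v (Sum.inr j) = v j := rfl

lemma iso_ortho (k : ℕ) (v : Fin 4 → ℝ) (w : Fin k → ℝ) :
    (cliffordForm (etaP k)).IsOrtho (isoL k v) (isoR k w) := by
  rw [QuadraticMap.isOrtho_def]
  simp [cliffordForm_apply, Fintype.sum_sum_type, isoL_inl, isoL_inr, isoR_inl, isoR_inr]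
  simp only [etaP, Sum.elim_inl, Sum.elim_inr]
  ring

/-- The product `Spin(3,1) × Spin(k) → Spin(3+k,1)`. -/
def spinMul (k : ℕ) (x : CliffordAlgebra (cliffordForm etaM))
    (y : CliffordAlgebra (cliffordForm (etaK k))) : CliffordAlgebra (cliffordForm (etaP k)) :=
  CliffordAlgebra.map (isoL k) x * CliffordAlgebra.map (isoR k) y

lemma star_map {V W : Type*} [AddCommGroup V] [Module ℝ V] [AddCommGroup W] [Module ℝ W]
    {Q : QuadraticForm ℝ V} {Q' : QuadraticForm ℝ W} (f : Q →qᵢ Q') (x : CliffordAlgebra Q) :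
    star (CliffordAlgebra.map f x) = CliffordAlgebra.map f (star x) := by
  induction x using CliffordAlgebra.induction with
  | algebraMap r => simp [CliffordAlgebra.star_algebraMap]
  | ι v => simp
  | mul a b ha hb => simp [ha, hb]
  | add a b ha hb => simp [ha, hb]

lemma map_mem_spinGroup {V W : Type*} [AddCommGroup V] [Module ℝ V] [AddCommGroup W] [Module ℝ W]
    {Q : QuadraticForm ℝ V} {Q' : QuadraticForm ℝ W} (f : Q →qᵢ Q') {x : CliffordAlgebra Q}
    (hx : x ∈ spinGroup Q) : CliffordAlgebra.map f x ∈ spinGroup Q' := by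
  rw [spinGroup.mem_iff, pinGroup.mem_iff] at hx ⊢
  obtain ⟨⟨⟨u, hu, rfl⟩, h1⟩, h2⟩ := hx
  refine ⟨⟨⟨Units.map (CliffordAlgebra.map f).toRingHom.toMonoidHom u, ?_, rfl⟩, ?_⟩, ?_⟩
  · have : lipschitzGroup Q ≤ (lipschitzGroup Q').comap
        (Units.map (CliffordAlgebra.map f).toRingHom.toMonoidHom) := by
      rw [lipschitzGroup, Subgroup.closure_le]
      rintro w ⟨v, hv⟩
      refine Subgroup.subset_closure ⟨f v, ?_⟩
      simp [← hv]
    exact this hu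
  · rw [Unitary.mem_iff] at h1 ⊢
    simp only [star_map, ← map_mul, h1.1, h1.2, map_one, and_self]
  · have h2' : (u : CliffordAlgebra Q) ∈ CliffordAlgebra.evenOdd Q 0 := h2
    change CliffordAlgebra.map f u ∈ CliffordAlgebra.evenOdd Q' 0
    clear h1 hu h2
    generalize (u : CliffordAlgebra Q) = z at h2'
    induction z, h2' using CliffordAlgebra.even_induction with
    | algebraMap r => simpa using SetLike.algebraMap_mem_graded (CliffordAlgebra.evenOdd Q') r
    | add x y hx hy h h' => simpa using Submodule.add_mem _ h h'
    | ι_mul_ι_mul m₁ m₂ x hx h =>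
      simp only [map_mul, CliffordAlgebra.map_apply_ι]
      exact zero_add (0 : ZMod 2) ▸
        SetLike.mul_mem_graded (CliffordAlgebra.ι_mul_ι_mem_evenOdd_zero Q' _ _) h

lemma spinMul_mem {k : ℕ} {x : CliffordAlgebra (cliffordForm etaM)}
    {y : CliffordAlgebra (cliffordForm (etaK k))} (hx : x ∈ spinGroup (cliffordForm etaM))
    (hy : y ∈ spinGroup (cliffordForm (etaK k))) :
    spinMul k x y ∈ spinGroup (cliffordForm (etaP k)) :=
  mul_mem (map_mem_spinGroup _ hx) (map_mem_spinGroup _ hy)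

lemma spinMul_mul {k : ℕ} {x x' : CliffordAlgebra (cliffordForm etaM)}
    {y y' : CliffordAlgebra (cliffordForm (etaK k))}
    (hx : x' ∈ spinGroup (cliffordForm etaM)) (hy : y ∈ spinGroup (cliffordForm (etaK k))) :
    spinMul k x y * spinMul k x' y' = spinMul k (x * x') (y * y') := by
  have h := CliffordAlgebra.commute_map_mul_map_of_isOrtho_of_mem_evenOdd_zero_left
    (isoL k) (isoR k) (iso_ortho k) x' y (i₂ := 0) (spinGroup.mem_even hx) (spinGroup.mem_even hy)
  simp only [spinMul, map_mul]
  rw [mul_assoc, ← mul_assoc (CliffordAlgebra.map (isoR k) y), ← h.eq]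
  simp only [mul_assoc]

lemma iso_decomp {k : ℕ} (c : Fin 4 ⊕ Fin k → ℝ) :
    c = isoL k (fun i => c (Sum.inl i)) + isoR k (fun j => c (Sum.inr j)) := by
  ext (i | j)
  · simp [isoL_inl, isoR_inl]
  · simp [isoL_inr, isoR_inr]

lemma spinMul_ι {k : ℕ} {x : CliffordAlgebra (cliffordForm etaM)}
    {y : CliffordAlgebra (cliffordForm (etaK k))} (hx : x ∈ spinGroup (cliffordForm etaM))
    (hy : y ∈ spinGroup (cliffordForm (etaK k))) {c d : Fin 4 ⊕ Fin k → ℝ}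
    (h1 : x * CliffordAlgebra.ι _ (fun i => c (Sum.inl i)) =
      CliffordAlgebra.ι _ (fun i => d (Sum.inl i)) * x)
    (h2 : y * CliffordAlgebra.ι _ (fun i => c (Sum.inr i)) =
      CliffordAlgebra.ι _ (fun i => d (Sum.inr i)) * y) :
    spinMul k x y * CliffordAlgebra.ι _ c = CliffordAlgebra.ι _ d * spinMul k x y := by
  have h := fun v => CliffordAlgebra.commute_map_mul_map_of_isOrtho_of_mem_evenOdd_zero_left
    (isoL k) (isoR k) (iso_ortho k) x (CliffordAlgebra.ι _ v) (i₂ := 1) (spinGroup.mem_even hx)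
    (CliffordAlgebra.ι_mem_evenOdd_one _ v)
  have h' := fun v => CliffordAlgebra.commute_map_mul_map_of_isOrtho_of_mem_evenOdd_zero_right
    (isoL k) (isoR k) (iso_ortho k) (CliffordAlgebra.ι _ v) y (i₁ := 1)
    (CliffordAlgebra.ι_mem_evenOdd_one _ v) (spinGroup.mem_even hy)
  rw [iso_decomp c, iso_decomp d, map_add, map_add, mul_add, add_mul]
  simp only [← CliffordAlgebra.map_apply_ι, spinMul]
  congr 1
  · rw [mul_assoc, ← (h' _).eq, ← mul_assoc, ← map_mul, h1, map_mul, mul_assoc]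
  · rw [mul_assoc, ← map_mul, h2, map_mul, ← mul_assoc, (h _).eq, mul_assoc]

lemma rep_ι {η : ι → ℝ} (γ : GammaMatrices η s) (v : ι → ℝ) :
    γ.rep (CliffordAlgebra.ι _ v) = ∑ i, v i • γ i := by
  rw [GammaMatrices.rep, CliffordAlgebra.lift_ι_apply, γ.vec_apply]

lemma rep_spinMul {k : ℕ} (γ : GammaMatrices etaM s) (ρ : GammaMatrices (etaK k) t)
    {x : CliffordAlgebra (cliffordForm etaM)} {y : CliffordAlgebra (cliffordForm (etaK k))}
    (hy : y ∈ spinGroup (cliffordForm (etaK k))) :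
    (gammaP γ ρ).rep (spinMul k x y) = γ.rep x ⊗ₖ ρ.rep y := by
  have hL : ∀ v, (gammaP γ ρ).rep (CliffordAlgebra.ι _ (isoL k v)) =
      γ.rep (CliffordAlgebra.ι _ v) ⊗ₖ (1 : Matrix t t ℂ) := by
    intro v
    simp only [rep_ι, Fintype.sum_sum_type, isoL_inl, isoL_inr, zero_smul, Finset.sum_const_zero,
      add_zero, gammaP, Sum.elim_inl]
    ext ⟨a, b⟩ ⟨a', b'⟩
    simp [Matrix.sum_apply, Finset.sum_mul, mul_assoc]
  have hR : ∀ v, (gammaP γ ρ).rep (CliffordAlgebra.ι _ (isoR k v)) =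
      gamma5 γ ⊗ₖ ρ.rep (CliffordAlgebra.ι _ v) := by
    intro v
    simp only [rep_ι, Fintype.sum_sum_type, isoR_inl, isoR_inr, zero_smul, Finset.sum_const_zero,
      zero_add, gammaP, Sum.elim_inr]
    ext ⟨a, b⟩ ⟨a', b'⟩
    simp [Matrix.sum_apply, Finset.mul_sum, mul_left_comm]
  have h1 : (gammaP γ ρ).rep (CliffordAlgebra.map (isoL k) x) =
      γ.rep x ⊗ₖ (1 : Matrix t t ℂ) := by
    induction x using CliffordAlgebra.induction with
    | algebraMap r =>
      simp only [AlgHom.commutes]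
      simp only [Algebra.algebraMap_eq_smul_one, Matrix.smul_kronecker, Matrix.one_kronecker_one]
    | ι v => rw [CliffordAlgebra.map_apply_ι, hL]
    | mul a b ha hb => simp only [map_mul, ha, hb, ← Matrix.mul_kronecker_mul, mul_one]
    | add a b ha hb => simp only [map_add, ha, hb, Matrix.add_kronecker]
  have h2 : (gammaP γ ρ).rep (CliffordAlgebra.map (isoR k) y) =
      (1 : Matrix s s ℂ) ⊗ₖ ρ.rep y := by
    have hy' : y ∈ CliffordAlgebra.evenOdd _ 0 := spinGroup.mem_even hy
    clear hy
    induction y, hy' using CliffordAlgebra.even_induction with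
    | algebraMap r =>
      simp only [AlgHom.commutes]
      simp only [Algebra.algebraMap_eq_smul_one, Matrix.kronecker_smul, Matrix.one_kronecker_one]
    | add a b _ _ ha hb => simp only [map_add, ha, hb, Matrix.kronecker_add]
    | ι_mul_ι_mul m₁ m₂ z _ hz =>
      simp only [map_mul, CliffordAlgebra.map_apply_ι, hR, hz, ← Matrix.mul_kronecker_mul,
        gamma5_sq, mul_one]
  rw [spinMul, map_mul, h1, h2, ← Matrix.mul_kronecker_mul, mul_one, one_mul]

end Algebra

section Geometry

open VectorField

variable {E : Type*} [NormedAddCommGroup E] [NormedSpace ℝ E]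
variable {H : Type*} [TopologicalSpace H] (I : ModelWithCorners ℝ E H)
variable {N : Type*} [TopologicalSpace N] [ChartedSpace H N]

/-- `g (∇_X Y, Z)` for the Levi-Civita connection `∇` of the pseudo-Riemannian metric `g`
(Koszul's formula). -/
def leviCivita (g : Π p : N, TangentSpace I p → TangentSpace I p → ℝ)
    (X Y Z : Π p : N, TangentSpace I p) (p : N) : ℝ :=
  (1 / 2) * (mvfderiv I (fun q => g q (Y q) (Z q)) p (X p)
    + mvfderiv I (fun q => g q (Z q) (X q)) p (Y p)
    - mvfderiv I (fun q => g q (X q) (Y q)) p (Z p)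
    + g p (mlieBracket I X Y p) (Z p)
    - g p (mlieBracket I Y Z p) (X p)
    + g p (mlieBracket I Z X p) (Y p))

/-- Any torsion-free metric connection on the tangent bundle is given by `leviCivita`. -/
lemma leviCivita_eq [FiniteDimensional ℝ E] [IsManifold I 2 N]
    (g : Π p : N, TangentSpace I p →L[ℝ] TangentSpace I p →L[ℝ] ℝ)
    (hg : ∀ p v w, g p v w = g p w v)
    (cov : CovariantDerivative I E (TangentSpace I : N → Type _)) (htor : cov.torsion = 0)
    (hmet : ∀ (Y Z : Π p : N, TangentSpace I p) (p : N),
      MDifferentiableAt I I.tangent (fun q => (⟨q, Y q⟩ : TangentBundle I N)) p →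
      MDifferentiableAt I I.tangent (fun q => (⟨q, Z q⟩ : TangentBundle I N)) p →
      ∀ w, mvfderiv I (fun q => g q (Y q) (Z q)) p w = g p (cov Y p w) (Z p) + g p (Y p) (cov Z p w))
    (X Y Z : Π p : N, TangentSpace I p) (p : N)
    (hX : MDifferentiableAt I I.tangent (fun q => (⟨q, X q⟩ : TangentBundle I N)) p)
    (hY : MDifferentiableAt I I.tangent (fun q => (⟨q, Y q⟩ : TangentBundle I N)) p)
    (hZ : MDifferentiableAt I I.tangent (fun q => (⟨q, Z q⟩ : TangentBundle I N)) p) :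
    g p (cov Y p (X p)) (Z p) = leviCivita I (fun q v w => g q v w) X Y Z p := by
  have T : ∀ {X Y : Π p : N, TangentSpace I p},
      MDifferentiableAt I I.tangent (fun q => (⟨q, X q⟩ : TangentBundle I N)) p →
      MDifferentiableAt I I.tangent (fun q => (⟨q, Y q⟩ : TangentBundle I N)) p →
      cov Y p (X p) - cov X p (Y p) = mlieBracket I X Y p :=
    fun hX hY => cov.torsion_eq_zero_iff.1 htor hX hY
  simp only [leviCivita]
  rw [hmet Y Z p hY hZ, hmet Z X p hZ hX, hmet X Y p hX hY, ← T hX hY, ← T hY hZ, ← T hZ hX]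
  simp only [map_sub, sub_apply]
  rw [hg p (Z p) (cov X p (Y p)), hg p (Y p) (cov Z p (X p)), hg p (X p) (cov Y p (Z p))]
  ring

variable {ι : Type*} [Fintype ι] [DecidableEq ι]
variable {s : Type*} [Fintype s] [DecidableEq s]
variable {η : ι → ℝ}

/-- The Levi-Civita covariant derivative `∇_X Ψ` of a spinor, represented by a function `Ψ` in the
trivialization induced by the orthonormal frame `u`. -/
def spinDeriv (g : Π p : N, TangentSpace I p → TangentSpace I p → ℝ)
    (u : ι → Π p : N, TangentSpace I p) (γ : GammaMatrices η s) (X : Π p : N, TangentSpace I p)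
    (Ψ : N → s → ℂ) (p : N) : s → ℂ :=
  mvfderiv I Ψ p (X p) +
    (1 / 4 : ℝ) • ∑ i, ∑ j, (η i * η j * leviCivita I g X (u i) (u j) p) • ((γ i * γ j) *ᵥ Ψ p)

/-- The Dirac operator `∑ r, η r • u r · ∇_{u r} Ψ`. -/
def diracOp (g : Π p : N, TangentSpace I p → TangentSpace I p → ℝ)
    (u : ι → Π p : N, TangentSpace I p) (γ : GammaMatrices η s) (Ψ : N → s → ℂ) (p : N) : s → ℂ :=
  ∑ r, η r • (γ r *ᵥ spinDeriv I g u γ (u r) Ψ p)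

/-- The Kosmann-Lichnerowicz derivative of the spinor `Ψ` along the vector field `X`. -/
def kosmann (g : Π p : N, TangentSpace I p → TangentSpace I p → ℝ)
    (u : ι → Π p : N, TangentSpace I p) (γ : GammaMatrices η s) (X : Π p : N, TangentSpace I p)
    (Ψ : N → s → ℂ) (p : N) : s → ℂ :=
  spinDeriv I g u γ X Ψ p -
    (1 / 8 : ℝ) • ∑ i, ∑ j,
      (η i * η j * (leviCivita I g (u i) X (u j) p - leviCivita I g (u j) X (u i) p)) •
        ((γ i * γ j) *ᵥ Ψ p)

/-- The divergence `∑ r, η r * g (∇_{u r} X, u r)` of the vector field `X`. -/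
def divergence (η : ι → ℝ) (g : Π p : N, TangentSpace I p → TangentSpace I p → ℝ)
    (u : ι → Π p : N, TangentSpace I p) (X : Π p : N, TangentSpace I p) (p : N) : ℝ :=
  ∑ r, η r * leviCivita I g (u r) X (u r) p

variable {EB : Type*} [NormedAddCommGroup EB] [NormedSpace ℝ EB]
variable {HB : Type*} [TopologicalSpace HB]
variable {B : Type*} [TopologicalSpace B] [ChartedSpace HB B]

/-- A spin structure on the pullback by `f : N → B` of the tangent bundle of `B`, with respect to a
fibre metric `g` of signature `η`: an open cover by domains of smooth orthonormal frames together
with a smooth lift to the spin group of the transition functions between the frames which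
satisfies the cocycle condition. With `f` the identity this is a spin structure on a
pseudo-Riemannian manifold. -/
structure SpinStructure (J : ModelWithCorners ℝ E H) (I : ModelWithCorners ℝ EB HB)
    [IsManifold I 1 B] (f : N → B)
    (g : Π p : N, TangentSpace I (f p) → TangentSpace I (f p) → ℝ) (η : ι → ℝ) (α : Type*) where
  dom : α → Set N
  isOpen_dom : ∀ a, IsOpen (dom a)
  cover : ∀ p, ∃ a, p ∈ dom a
  frame : α → ι → Π p : N, TangentSpace I (f p)
  smooth_frame : ∀ a i, ContMDiffOn J I.tangent ∞
    (fun p => (⟨f p, frame a i p⟩ : TangentBundle I B)) (dom a)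
  orthonormal : ∀ a, ∀ p ∈ dom a, ∀ i j,
    g p (frame a i p) (frame a j p) = if i = j then η i else 0
  spans : ∀ a, ∀ p ∈ dom a, ∀ w : TangentSpace I (f p),
    ∃ c : ι → ℝ, w = ∑ i, c i • frame a i p
  lift : α → α → N → CliffordAlgebra (cliffordForm η)
  /-- Smoothness, as a function with values in the finite-dimensional Clifford algebra. -/
  smooth_lift : ∀ a b, ∃ (n : ℕ) (c : Fin n → N → ℝ) (x : Fin n → CliffordAlgebra (cliffordForm η)),
    (∀ i, ContMDiffOn J 𝓘(ℝ, ℝ) ∞ (c i) (dom a ∩ dom b)) ∧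
    ∀ p ∈ dom a ∩ dom b, lift a b p = ∑ i, c i p • x i
  lift_mem : ∀ a b, ∀ p ∈ dom a ∩ dom b, lift a b p ∈ spinGroup (cliffordForm η)
  /-- The lift covers the transition function: it conjugates the components `c` of a vector in
  the frame `b` to its components `d` in the frame `a`. -/
  lift_covers : ∀ a b, ∀ p ∈ dom a ∩ dom b, ∀ c d : ι → ℝ,
    ∑ i, c i • frame b i p = ∑ i, d i • frame a i p →
    lift a b p * CliffordAlgebra.ι _ c = CliffordAlgebra.ι _ d * lift a b p
  cocycle : ∀ a b c, ∀ p ∈ dom a ∩ dom b ∩ dom c, lift a b p * lift b c p = lift a c p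

/-- A smooth section of the spinor bundle: its local representatives in the trivializations induced
by the frames of the spin structure are related by the spin representation. -/
structure Spinor {J : ModelWithCorners ℝ E H} {I : ModelWithCorners ℝ EB HB}
    [IsManifold I 1 B] {f : N → B}
    {g : Π p : N, TangentSpace I (f p) → TangentSpace I (f p) → ℝ} {α : Type*}
    (S : SpinStructure J I f g η α) (γ : GammaMatrices η s) where
  rep : α → N → s → ℂ
  smooth : ∀ a, ContMDiffOn J 𝓘(ℝ, s → ℂ) ∞ (rep a) (S.dom a)
  compat : ∀ a b, ∀ p ∈ S.dom a ∩ S.dom b, rep a p = γ.rep (S.lift a b p) *ᵥ rep b p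

end Geometry

section Submersion

open VectorField

variable (k : ℕ)
variable (M : Type*) [TopologicalSpace M] [ChartedSpace (EuclideanSpace ℝ (Fin 4)) M]
  [IsManifold (𝓡 4) ∞ M]
variable (K : Type*) [TopologicalSpace K] [ChartedSpace (EuclideanSpace ℝ (Fin k)) K]
  [IsManifold (𝓡 k) ∞ K]

/-- The data `(g_M, A, g_K)` of a Lorentzian submersion metric on `M × K`: a Lorentzian metric on
`M`, a smooth family of Riemannian metrics on the fibres `{x} × K`, and a one-form on `M` with
values in the vector fields on `K`; `A (x, y) X` is the value at `y` of the vector field `A_x(X)`. -/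
structure SubmersionMetric where
  gM : Π x : M, TangentSpace (𝓡 4) x →L[ℝ] TangentSpace (𝓡 4) x →L[ℝ] ℝ
  gK : Π p : M × K, TangentSpace (𝓡 k) p.2 →L[ℝ] TangentSpace (𝓡 k) p.2 →L[ℝ] ℝ
  A : Π p : M × K, TangentSpace (𝓡 4) p.1 →L[ℝ] TangentSpace (𝓡 k) p.2
  gM_symm : ∀ x v w, gM x v w = gM x w v
  gM_lorentzian : ∀ x, ∃ b : Module.Basis (Fin 4) ℝ (TangentSpace (𝓡 4) x),
    ∀ i j, gM x (b i) (b j) = if i = j then etaM i else 0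
  gK_symm : ∀ p v w, gK p v w = gK p w v
  gK_pos : ∀ p v, v ≠ 0 → 0 < gK p v v
  smooth_gM : ContMDiff (𝓡 4) ((𝓡 4).prod
      𝓘(ℝ, EuclideanSpace ℝ (Fin 4) →L[ℝ] EuclideanSpace ℝ (Fin 4) →L[ℝ] ℝ)) ∞
    (fun x => Bundle.TotalSpace.mk'
      (EuclideanSpace ℝ (Fin 4) →L[ℝ] EuclideanSpace ℝ (Fin 4) →L[ℝ] ℝ)
      (E := fun x : M => TangentSpace (𝓡 4) x →L[ℝ] TangentSpace (𝓡 4) x →L[ℝ] ℝ) x (gM x))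
  smooth_gK : ContMDiff ((𝓡 4).prod (𝓡 k)) ((𝓡 k).prod
      𝓘(ℝ, EuclideanSpace ℝ (Fin k) →L[ℝ] EuclideanSpace ℝ (Fin k) →L[ℝ] ℝ)) ∞
    (fun p : M × K => Bundle.TotalSpace.mk'
      (EuclideanSpace ℝ (Fin k) →L[ℝ] EuclideanSpace ℝ (Fin k) →L[ℝ] ℝ)
      (E := fun y : K => TangentSpace (𝓡 k) y →L[ℝ] TangentSpace (𝓡 k) y →L[ℝ] ℝ) p.2 (gK p))
  smooth_A : ContMDiff ((𝓡 4).tangent.prod (𝓡 k)) (𝓡 k).tangent ∞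
    (fun q : TangentBundle (𝓡 4) M × K =>
      (⟨q.2, A (q.1.proj, q.2) q.1.snd⟩ : TangentBundle (𝓡 k) K))

variable {k M K}

/-- The vector of `T(M × K)` with components `X` and `V`. -/
def mkP {p : M × K} (X : TangentSpace (𝓡 4) p.1) (V : TangentSpace (𝓡 k) p.2) :
    TangentSpace ((𝓡 4).prod (𝓡 k)) p := (X, V)

/-- The component of a vector along `TM`. -/
def compM {p : M × K} (w : TangentSpace ((𝓡 4).prod (𝓡 k)) p) : TangentSpace (𝓡 4) p.1 := w.1

/-- The component of a vector along `TK`. -/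
def compK {p : M × K} (w : TangentSpace ((𝓡 4).prod (𝓡 k)) p) : TangentSpace (𝓡 k) p.2 := w.2

namespace SubmersionMetric

variable (G : SubmersionMetric k M K)

/-- The metric on `M × K` determined by `(g_M, A, g_K)`. -/
def gP (p : M × K) (w w' : TangentSpace ((𝓡 4).prod (𝓡 k)) p) : ℝ :=
  G.gK p (compK w) (compK w')
    - G.gK p (G.A p (compM w)) (compK w') - G.gK p (compK w) (G.A p (compM w'))
    + G.gM p.1 (compM w) (compM w') + G.gK p (G.A p (compM w)) (G.A p (compM w'))

/-- The horizontal (basic) lift `X + A(X)` of a vector field on `M`. -/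
def hlift (X : Π x : M, TangentSpace (𝓡 4) x) (p : M × K) :
    TangentSpace ((𝓡 4).prod (𝓡 k)) p := mkP (X p.1) (G.A p (X p.1))

/-- The metric of the fibre over `x`. -/
def fibre (x : M) (y : K) (v w : TangentSpace (𝓡 k) y) : ℝ := G.gK (x, y) v w

/-- The vector field `A_x(X)` on `K`. -/
def gauge (X : Π x : M, TangentSpace (𝓡 4) x) (x : M) (y : K) : TangentSpace (𝓡 k) y :=
  G.A (x, y) (X x)

/-- The derivative along `X ∈ T_x M` of a family of vectors of `T_y K` depending on `x`. -/
def baseDeriv {y : K} (W : M → TangentSpace (𝓡 k) y) (x : M) (X : TangentSpace (𝓡 4) x) :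
    TangentSpace (𝓡 k) y :=
  mvfderiv (𝓡 4) (F := EuclideanSpace ℝ (Fin k)) W x X

/-- The curvature `F_A(X, Y) = (d_M A)(X, Y) + [A(X), A(Y)]`, evaluated at `p`. -/
def curvature (X Y : Π x : M, TangentSpace (𝓡 4) x) (p : M × K) : TangentSpace (𝓡 k) p.2 :=
  (baseDeriv (fun x => G.gauge Y x p.2) p.1 (X p.1)
    - baseDeriv (fun x => G.gauge X x p.2) p.1 (Y p.1)
    - G.A p (mlieBracket (𝓡 4) X Y p.1))
  + mlieBracket (𝓡 k) (G.gauge X p.1) (G.gauge Y p.1) p.2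

end SubmersionMetric

/-- A spin structure on `(M, g_M)`. -/
abbrev HSpin (G : SubmersionMetric k M K) (α : Type*) :=
  SpinStructure (𝓡 4) (𝓡 4) (fun x : M => x) (fun x v w => G.gM x v w) etaM α

/-- A spin structure on the vertical bundle `TK → M × K` with the fibre metrics `g_K`. -/
abbrev VSpin (G : SubmersionMetric k M K) (β : Type*) :=
  SpinStructure ((𝓡 4).prod (𝓡 k)) (𝓡 k) (fun p : M × K => p.2) (fun p v w => G.gK p v w)
    (etaK k) β

/-- A spin structure on `(M × K, g_P)`. -/
abbrev PSpin (G : SubmersionMetric k M K) (δ : Type*) :=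
  SpinStructure ((𝓡 4).prod (𝓡 k)) ((𝓡 4).prod (𝓡 k)) (fun p : M × K => p) G.gP (etaP k) δ

/-- The lift of a vertical field to `T(M × K)`. -/
def vlift (V : Π p : M × K, TangentSpace (𝓡 k) p.2) (p : M × K) :
    TangentSpace ((𝓡 4).prod (𝓡 k)) p := mkP 0 (V p)

/-- A vector field on `M`, regarded as a vector field on `M × K` through `T(M × K) = TM ⊕ TK`. -/
def baseField (X : Π x : M, TangentSpace (𝓡 4) x) (p : M × K) :
    TangentSpace ((𝓡 4).prod (𝓡 k)) p := mkP (X p.1) 0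

/-- The adapted frame `{X_μ^H, v_j}` of `T(M × K)`. -/
def adaptedFrame (G : SubmersionMetric k M K) (X : Fin 4 → Π x : M, TangentSpace (𝓡 4) x)
    (v : Fin k → Π p : M × K, TangentSpace (𝓡 k) p.2) :
    Fin 4 ⊕ Fin k → Π p : M × K, TangentSpace ((𝓡 4).prod (𝓡 k)) p :=
  Sum.elim (fun μ => G.hlift (X μ)) (fun j => vlift (v j))

lemma contMDiffOn_mkP {U : Set (M × K)} (X : Π p : M × K, TangentSpace (𝓡 4) p.1)
    (V : Π p : M × K, TangentSpace (𝓡 k) p.2)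
    (hX : ContMDiffOn ((𝓡 4).prod (𝓡 k)) (𝓡 4).tangent ∞
      (fun p => (⟨p.1, X p⟩ : TangentBundle (𝓡 4) M)) U)
    (hV : ContMDiffOn ((𝓡 4).prod (𝓡 k)) (𝓡 k).tangent ∞
      (fun p => (⟨p.2, V p⟩ : TangentBundle (𝓡 k) K)) U) :
    ContMDiffOn ((𝓡 4).prod (𝓡 k)) ((𝓡 4).prod (𝓡 k)).tangent ∞
      (fun p => (⟨p, mkP (X p) (V p)⟩ : TangentBundle ((𝓡 4).prod (𝓡 k)) (M × K))) U :=
  (contMDiff_equivTangentBundleProd_symm (n := ∞) (I := 𝓡 4) (M := M) (I' := 𝓡 k)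
    (M' := K)).comp_contMDiffOn (hX.prodMk hV)

lemma adaptedFrame_sum (G : SubmersionMetric k M K)
    (X : Fin 4 → Π x : M, TangentSpace (𝓡 4) x)
    (v : Fin k → Π p : M × K, TangentSpace (𝓡 k) p.2) (c : Fin 4 ⊕ Fin k → ℝ) (p : M × K) :
    ∑ i, c i • adaptedFrame G X v i p =
      mkP (∑ μ, c (Sum.inl μ) • X μ p.1)
        (G.A p (∑ μ, c (Sum.inl μ) • X μ p.1) + ∑ j, c (Sum.inr j) • v j p) := by
  have h1 : ∀ (F : Fin 4 → TangentSpace (𝓡 4) p.1) (F' : Fin 4 → TangentSpace (𝓡 k) p.2),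
      ∑ μ, c (Sum.inl μ) • (mkP (F μ) (F' μ) : TangentSpace ((𝓡 4).prod (𝓡 k)) p) =
        mkP (∑ μ, c (Sum.inl μ) • F μ) (∑ μ, c (Sum.inl μ) • F' μ) := by
    intro F F'
    refine Prod.ext ?_ ?_
    · exact Prod.fst_sum
    · exact Prod.snd_sum
  have h2 : ∀ (F : Fin k → TangentSpace (𝓡 4) p.1) (F' : Fin k → TangentSpace (𝓡 k) p.2),
      ∑ j, c (Sum.inr j) • (mkP (F j) (F' j) : TangentSpace ((𝓡 4).prod (𝓡 k)) p) =
        mkP (∑ j, c (Sum.inr j) • F j) (∑ j, c (Sum.inr j) • F' j) := by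
    intro F F'
    refine Prod.ext ?_ ?_
    · exact Prod.fst_sum
    · exact Prod.snd_sum
  have h3 : ∀ (X Y : TangentSpace (𝓡 4) p.1) (V W : TangentSpace (𝓡 k) p.2),
      (mkP X V + mkP Y W : TangentSpace ((𝓡 4).prod (𝓡 k)) p) = mkP (X + Y) (V + W) :=
    fun _ _ _ _ => rfl
  rw [Fintype.sum_sum_type]
  simp only [adaptedFrame, Sum.elim_inl, Sum.elim_inr, SubmersionMetric.hlift, vlift]
  rw [h1, h2, h3]
  simp [map_sum]

lemma gP_hlift (G : SubmersionMetric k M K) (p : M × K) (X Y : TangentSpace (𝓡 4) p.1)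
    (V W : TangentSpace (𝓡 k) p.2) :
    G.gP p (mkP X (G.A p X + V)) (mkP Y (G.A p Y + W)) = G.gM p.1 X Y + G.gK p V W := by
  simp only [SubmersionMetric.gP, compM, compK, mkP, map_add, add_apply]
  ring

/-- The spin structure on `M × K` determined by those on `M` and on the vertical bundle: its frames
are the adapted frames, with the product lifts `Spin(3,1) × Spin(k) → Spin(3+k,1)`. -/
def prodSpin {G : SubmersionMetric k M K} {α β : Type*} (SM : HSpin G α) (SV : VSpin G β) :
    PSpin G (α × β) where
  dom ab := (Prod.fst ⁻¹' SM.dom ab.1) ∩ SV.dom ab.2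
  isOpen_dom ab := ((SM.isOpen_dom _).preimage continuous_fst).inter (SV.isOpen_dom _)
  cover p := by
    obtain ⟨a, ha⟩ := SM.cover p.1
    obtain ⟨b, hb⟩ := SV.cover p
    exact ⟨(a, b), ha, hb⟩
  frame ab := adaptedFrame G (SM.frame ab.1) (SV.frame ab.2)
  smooth_frame := by
    rintro ⟨a, b⟩ (μ | j)
    · have hX : ContMDiffOn ((𝓡 4).prod (𝓡 k)) (𝓡 4).tangent ∞
          (fun p : M × K => (⟨p.1, SM.frame a μ p.1⟩ : TangentBundle (𝓡 4) M))
          ((Prod.fst ⁻¹' SM.dom a) ∩ SV.dom b) :=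
        (SM.smooth_frame a μ).comp contMDiffOn_fst (fun p hp => hp.1)
      refine contMDiffOn_mkP (fun p => SM.frame a μ p.1) _ hX ?_
      exact G.smooth_A.comp_contMDiffOn (hX.prodMk contMDiffOn_snd)
    · refine contMDiffOn_mkP (fun p => 0) _ ?_ ((SV.smooth_frame b j).mono fun p hp => hp.2)
      exact (Bundle.contMDiff_zeroSection ℝ (TangentSpace (𝓡 4) : M → Type _)).comp_contMDiffOn
        contMDiffOn_fst
  orthonormal := by
    rintro ⟨a, b⟩ p ⟨hp1, hp2⟩ (i | i) (j | j)
    · have := gP_hlift G p (SM.frame a i p.1) (SM.frame a j p.1) 0 0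
      simp only [add_zero, map_zero] at this
      simpa [adaptedFrame, SubmersionMetric.hlift, etaP, this] using SM.orthonormal a p.1 hp1 i j
    · have := gP_hlift G p (SM.frame a i p.1) 0 0 (SV.frame b j p)
      simp only [add_zero, map_zero, zero_add] at this
      simpa [adaptedFrame, SubmersionMetric.hlift, vlift] using this
    · have := gP_hlift G p 0 (SM.frame a j p.1) (SV.frame b i p) 0
      simp only [add_zero, map_zero, zero_add] at this
      simpa [adaptedFrame, SubmersionMetric.hlift, vlift] using this
    · have := gP_hlift G p 0 0 (SV.frame b i p) (SV.frame b j p)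
      simp only [map_zero, zero_add] at this
      simpa [adaptedFrame, vlift, etaP, this] using SV.orthonormal b p hp2 i j
  spans := by
    rintro ⟨a, b⟩ p ⟨hp1, hp2⟩ w
    obtain ⟨c, hc⟩ := SM.spans a p.1 hp1 (compM w)
    obtain ⟨d, hd⟩ := SV.spans b p hp2 (compK w - G.A p (compM w))
    refine ⟨Sum.elim c d, ?_⟩
    rw [adaptedFrame_sum]
    simp only [Sum.elim_inl, Sum.elim_inr]
    rw [← hc, ← hd, add_sub_cancel]
    rfl
  lift ab ab' p := spinMul k (SM.lift ab.1 ab'.1 p.1) (SV.lift ab.2 ab'.2 p)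
  smooth_lift := by
    rintro ⟨a, b⟩ ⟨a', b'⟩
    obtain ⟨n, c, x, hc, hx⟩ := SM.smooth_lift a a'
    obtain ⟨m, d, y, hd, hy⟩ := SV.smooth_lift b b'
    refine ⟨n * m, fun i p => c (finProdFinEquiv.symm i).1 p.1 * d (finProdFinEquiv.symm i).2 p,
      fun i => spinMul k (x (finProdFinEquiv.symm i).1) (y (finProdFinEquiv.symm i).2), ?_, ?_⟩
    · intro i
      refine ContMDiffOn.mul ?_ ?_
      · exact (hc _).comp contMDiffOn_fst (fun p hp => ⟨hp.1.1, hp.2.1⟩)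
      · exact (hd _).mono (fun p hp => ⟨hp.1.2, hp.2.2⟩)
    · intro p hp
      dsimp only
      rw [hx p.1 ⟨hp.1.1, hp.2.1⟩, hy p ⟨hp.1.2, hp.2.2⟩, spinMul, map_sum, map_sum,
        Finset.sum_mul_sum, ← finProdFinEquiv.sum_comp, Fintype.sum_prod_type]
      refine Finset.sum_congr rfl fun i _ => Finset.sum_congr rfl fun j _ => ?_
      simp [spinMul, smul_smul, mul_comm]
  lift_mem := by
    rintro ⟨a, b⟩ ⟨a', b'⟩ p hp
    exact spinMul_mem (SM.lift_mem a a' p.1 ⟨hp.1.1, hp.2.1⟩) (SV.lift_mem b b' p ⟨hp.1.2, hp.2.2⟩)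
  lift_covers := by
    rintro ⟨a, b⟩ ⟨a', b'⟩ p hp c d hcd
    rw [adaptedFrame_sum, adaptedFrame_sum] at hcd
    have e1 : ∑ μ, c (Sum.inl μ) • SM.frame a' μ p.1 = ∑ μ, d (Sum.inl μ) • SM.frame a μ p.1 :=
      congrArg compM hcd
    have e2 := congrArg compK hcd
    simp only [compK, mkP] at e2
    rw [e1] at e2
    exact spinMul_ι (SM.lift_mem a a' p.1 ⟨hp.1.1, hp.2.1⟩)
      (SV.lift_mem b b' p ⟨hp.1.2, hp.2.2⟩)
      (SM.lift_covers a a' p.1 ⟨hp.1.1, hp.2.1⟩ _ _ e1)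
      (SV.lift_covers b b' p ⟨hp.1.2, hp.2.2⟩ _ _ (add_left_cancel e2))
  cocycle := by
    rintro ⟨a, b⟩ ⟨a', b'⟩ ⟨a'', b''⟩ p hp
    dsimp only
    rw [spinMul_mul (SM.lift_mem a' a'' p.1 ⟨hp.1.2.1, hp.2.1⟩)
      (SV.lift_mem b b' p ⟨hp.1.1.2, hp.1.2.2⟩),
      SM.cocycle a a' a'' p.1 ⟨⟨hp.1.1.1, hp.1.2.1⟩, hp.2.1⟩,
      SV.cocycle b b' b'' p ⟨⟨hp.1.1.2, hp.1.2.2⟩, hp.2.2⟩]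

/-- The spinor `φ^H ⊗ ψ` on `M × K`, where `φ^H` is the basic lift of the spinor `φ` on `M` and `ψ`
is a vertical spinor. -/
def basicTensor {G : SubmersionMetric k M K} {α β : Type*} {SM : HSpin G α} {SV : VSpin G β}
    {s t : Type*} [Fintype s] [DecidableEq s] [Fintype t] [DecidableEq t]
    {γ : GammaMatrices etaM s} {ρ : GammaMatrices (etaK k) t}
    (φ : Spinor SM γ) (ψ : Spinor SV ρ) : Spinor (prodSpin SM SV) (gammaP γ ρ) where
  rep ab p := tensor (φ.rep ab.1 p.1) (ψ.rep ab.2 p)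
  smooth := by
    rintro ⟨a, b⟩
    rw [contMDiffOn_pi_space]
    rintro ⟨i, j⟩
    have h1 : ContMDiffOn ((𝓡 4).prod (𝓡 k)) 𝓘(ℝ, ℂ) ∞ (fun p : M × K => φ.rep a p.1 i)
        ((prodSpin SM SV).dom (a, b)) :=
      (contMDiffOn_pi_space.1 (φ.smooth a) i).comp contMDiffOn_fst (fun p hp => hp.1)
    have h2 : ContMDiffOn ((𝓡 4).prod (𝓡 k)) 𝓘(ℝ, ℂ) ∞ (fun p : M × K => ψ.rep b p j)
        ((prodSpin SM SV).dom (a, b)) :=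
      (contMDiffOn_pi_space.1 (ψ.smooth b) j).mono (fun p hp => hp.2)
    have hm : ContDiff ℝ ∞ (fun z : ℂ × ℂ => z.1 * z.2) := contDiff_fst.mul contDiff_snd
    exact hm.contMDiff.comp_contMDiffOn (h1.prodMk_space h2)
  compat := by
    rintro ⟨a, b⟩ ⟨a', b'⟩ p hp
    have e := rep_spinMul γ ρ (x := SM.lift a a' p.1)
      (SV.lift_mem b b' p ⟨hp.1.2, hp.2.2⟩)
    change tensor (φ.rep a p.1) (ψ.rep b p) =
      (gammaP γ ρ).rep (spinMul k (SM.lift a a' p.1) (SV.lift b b' p)) *ᵥ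
        tensor (φ.rep a' p.1) (ψ.rep b' p)
    rw [e, kronecker_mulVec_tensor, φ.compat a a' p.1 ⟨hp.1.1, hp.2.1⟩,
      ψ.compat b b' p ⟨hp.1.2, hp.2.2⟩]

/-! The terms of the decomposition. `X` is a local orthonormal frame of `TM`, `v` a local
orthonormal frame of the vertical bundle, and `φ`, `ψ` represent the spinors in the induced
trivializations. -/

section Terms

variable (G : SubmersionMetric k M K)
variable (X : Fin 4 → Π x : M, TangentSpace (𝓡 4) x)
variable (v : Fin k → Π p : M × K, TangentSpace (𝓡 k) p.2)
variable {s t : Type*} [Fintype s] [DecidableEq s] [Fintype t] [DecidableEq t]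
variable (γ : GammaMatrices etaM s) (ρ : GammaMatrices (etaK k) t)
variable (φ : M → s → ℂ) (ψ : M × K → t → ℂ)

/-- The restriction of a vertical frame to the fibre over `x`. -/
def fibreFrame (v : Fin k → Π p : M × K, TangentSpace (𝓡 k) p.2) (x : M) :
    Fin k → Π y : K, TangentSpace (𝓡 k) y := fun j y => v j (x, y)

/-- `g_M^{μν} (X_μ · ∇^M_ν φ)^H ⊗ ψ`. -/
def baseTerm (p : M × K) : s × t → ℂ :=
  tensor (∑ μ, etaM μ •
    (γ μ *ᵥ spinDeriv (𝓡 4) (fun x v w => G.gM x v w) X γ (X μ) φ p.1)) (ψ p)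

/-- `[𝓛_e + ½ div(e)] ψ` on the fibre through `p`, for a vector field `e` on `K`. -/
def couplingOp (e : Π y : K, TangentSpace (𝓡 k) y) (p : M × K) : t → ℂ :=
  kosmann (𝓡 k) (G.fibre p.1) (fibreFrame v p.1) ρ e (fun y => ψ (p.1, y)) p.2
    + (1 / 2 * divergence (𝓡 k) (etaK k) (G.fibre p.1) (fibreFrame v p.1) e p.2) • ψ p

/-- `g_M^{μν} (X_μ · φ)^H ⊗ [𝓛_{A_ν} + ½ div(A_ν)] ψ`. -/
def gaugeTerm (p : M × K) : s × t → ℂ :=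
  ∑ μ, etaM μ • tensor (γ μ *ᵥ φ p.1) (couplingOp G v ρ ψ (G.gauge (X μ) p.1) p)

/-- `g_M^{μν} A_ν^a (X_μ · φ)^H ⊗ [𝓛_{e_a} + ½ div(e_a)] ψ`. -/
def gaugeTermExpanded {τ : Type*} [Fintype τ] (Ac : τ → Π x : M, TangentSpace (𝓡 4) x →L[ℝ] ℝ)
    (e : τ → Π y : K, TangentSpace (𝓡 k) y) (p : M × K) : s × t → ℂ :=
  ∑ μ, ∑ a, (etaM μ * Ac a p.1 (X μ p.1)) •
    tensor (γ μ *ᵥ φ p.1) (couplingOp G v ρ ψ (e a) p)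

/-- `(γ₅ · φ)^H ⊗ D^K ψ`. -/
def internalTerm (p : M × K) : s × t → ℂ :=
  tensor (gamma5 γ *ᵥ φ p.1)
    (diracOp (𝓡 k) (G.fibre p.1) (fibreFrame v p.1) ρ (fun y => ψ (p.1, y)) p.2)

/-- Clifford multiplication of a vertical spinor by a vertical vector `w`. -/
def vertClifford (p : M × K) (w : TangentSpace (𝓡 k) p.2) : t → ℂ :=
  ∑ j, G.gK p w (v j p) • (ρ j *ᵥ ψ p)

/-- `⅛ F^{μν} (X_μ · X_ν · γ₅ · φ)^H ⊗ (e · ψ)` for a two-form `F`, given by its values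
`F μ ν = F(X_μ, X_ν)` at `p`. -/
def pauliTerm (p : M × K) (F : Fin 4 → Fin 4 → TangentSpace (𝓡 k) p.2) : s × t → ℂ :=
  (1 / 8 : ℝ) • ∑ μ, ∑ ν, (etaM μ * etaM ν) •
    tensor (γ μ *ᵥ γ ν *ᵥ gamma5 γ *ᵥ φ p.1) (vertClifford G v ρ ψ p (F μ ν))

/-- The matrix of `g_K` at `p` in the coordinate system `c` on `K`. -/
def coordMatrix (c : OpenPartialHomeomorph K (EuclideanSpace ℝ (Fin k))) (p : M × K) :
    Matrix (Fin k) (Fin k) ℝ := fun i j =>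
  G.gK p ((mfderiv (𝓡 k) (𝓡 k) c p.2).inverse (EuclideanSpace.single i (1 : ℝ)))
    ((mfderiv (𝓡 k) (𝓡 k) c p.2).inverse (EuclideanSpace.single j (1 : ℝ)))

/-- `g_M^{μν} (X_μ · φ)^H ⊗ [∂_{X_ν} + ½ (∂_{X_ν} log √|g_K|)] ψ`, the determinant `|g_K|` being
computed in the coordinate system `c` on `K`. -/
def volumeTerm (c : OpenPartialHomeomorph K (EuclideanSpace ℝ (Fin k))) (p : M × K) : s × t → ℂ :=
  ∑ μ, etaM μ • tensor (γ μ *ᵥ φ p.1)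
    (mvfderiv ((𝓡 4).prod (𝓡 k)) ψ p (baseField (X μ) p) +
      (1 / 2 * mvfderiv ((𝓡 4).prod (𝓡 k))
        (fun q => Real.log (Real.sqrt |(coordMatrix G c q).det|)) p (baseField (X μ) p)) • ψ p)

/-- `g_M^{μν} (X_μ · φ)^H ⊗ (⅛ ∑_{ij} {g_P([X_ν, v_i], v_j) - g_P([X_ν, v_j], v_i)} v_i · v_j · ψ)`. -/
def bracketTerm (p : M × K) : s × t → ℂ :=
  ∑ μ, etaM μ • tensor (γ μ *ᵥ φ p.1)
    ((1 / 8 : ℝ) • ∑ i, ∑ j,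
      (G.gP p (mlieBracket ((𝓡 4).prod (𝓡 k)) (baseField (X μ)) (vlift (v i)) p) (vlift (v j) p)
        - G.gP p (mlieBracket ((𝓡 4).prod (𝓡 k)) (baseField (X μ)) (vlift (v j)) p)
          (vlift (v i) p)) • (ρ i *ᵥ ρ j *ᵥ ψ p))

/-- The exterior derivative of a one-form on `M`. -/
def extDeriv1 (θ : Π x : M, TangentSpace (𝓡 4) x →L[ℝ] ℝ) (X Y : Π x : M, TangentSpace (𝓡 4) x)
    (x : M) : ℝ :=
  mvfderiv (𝓡 4) (fun z => θ z (Y z)) x (X x) - mvfderiv (𝓡 4) (fun z => θ z (X z)) x (Y x)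
    - θ x (mlieBracket (𝓡 4) X Y x)

/-- The curvature `(d_M A^a)(X, Y) e_a + A^a(X) A^b(Y) [e_a, e_b]`. -/
def curvatureExpanded {τ : Type*} [Fintype τ] (Ac : τ → Π x : M, TangentSpace (𝓡 4) x →L[ℝ] ℝ)
    (e : τ → Π y : K, TangentSpace (𝓡 k) y) (X Y : Π x : M, TangentSpace (𝓡 4) x) (p : M × K) :
    TangentSpace (𝓡 k) p.2 :=
  ∑ a, extDeriv1 (Ac a) X Y p.1 • e a p.2 +
    ∑ a, ∑ b, (Ac a p.1 (X p.1) * Ac b p.1 (Y p.1)) • mlieBracket (𝓡 k) (e a) (e b) p.2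

/-- `A = ∑ a, A^a e_a` with smooth one-forms `A^a` on `M` and smooth vector fields `e_a` on `K`. -/
structure IsExpansion {τ : Type*} [Fintype τ]
    (Ac : τ → Π x : M, TangentSpace (𝓡 4) x →L[ℝ] ℝ)
    (e : τ → Π y : K, TangentSpace (𝓡 k) y) : Prop where
  smooth_form : ∀ a, ContMDiff (𝓡 4).tangent 𝓘(ℝ, ℝ) ∞
    (fun q : TangentBundle (𝓡 4) M => Ac a q.proj q.snd)
  smooth_field : ∀ a, ContMDiff (𝓡 k) (𝓡 k).tangent ∞
    (fun y => (⟨y, e a y⟩ : TangentBundle (𝓡 k) K))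
  eq_sum : ∀ p w, G.A p w = ∑ a, Ac a p.1 w • e a p.2

/-- In the region `O` of `M`, the metric `g_K`, the vertical frame `v` (with domain `W`) and the
representative `ψ` of the vertical spinor do not depend on the point of `M`. -/
structure ConstantOver (W : Set (M × K)) (O : Set M) : Prop where
  metric : ∀ x ∈ O, ∀ x' ∈ O, ∀ (y : K) (w w' : TangentSpace (𝓡 k) y),
    G.fibre x y w w' = G.fibre x' y w w'
  frame : ∀ x ∈ O, ∀ x' ∈ O, ∀ y : K, (x, y) ∈ W → (x', y) ∈ W →
    ∀ j, fibreFrame v x j y = fibreFrame v x' j y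
  spinor : ∀ x ∈ O, ∀ x' ∈ O, ∀ y : K, (x, y) ∈ W → (x', y) ∈ W → ψ (x, y) = ψ (x', y)

end Terms

end Submersion

end KaluzaKlein

end

open KaluzaKlein

/-! The claim is local: it is a computation of the spin connection of $g_P$ in the adapted frame
$u=\{X_\mu^{\mathcal H},v_j\}$. This frame is orthonormal near the point, so the derivative terms of
Koszul's formula vanish (`leviCivita_frame`) and each coefficient $g_P(\nabla_{u_r}u_s,u_t)$ is a
half sum of terms $\pm g_P([u_r,u_s],u_t)$.

The brackets come from `mlieBracket_mkP`. Lifts satisfy $[X^{\mathcal H},Y^{\mathcal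
H}]=[X,Y]^{\mathcal H}+F_A(X,Y)$, while $[X^{\mathcal H},v_i]=\partial_Xv_i+[A(X),v_i]$ and
$[v_i,v_j]$ are vertical. With $m_{\mu ij}=g_P([X_\mu^{\mathcal H},v_i],v_j)$ (`mixComp`), the
purely horizontal and purely vertical coefficients are those of $M$ and of the fibre. The mixed ones
are $\pm\frac12F_A$, the antisymmetric part of $m$, and $\pm$ the symmetric part of $m$, which is
the second fundamental form of the fibres.

The Clifford contraction is `sum_gamma_spinConnection`, which uses only that $\gamma_5$ anticommutes
with each $\gamma_\mu$ and squares to $1$. The curvature enters with $\frac14$ from the horizontal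
directions and $-\frac18$ from the vertical ones, hence the $\frac18$. The antisymmetric part of $m$
survives with coefficient $\frac18$. The symmetric part meets $\rho_i\rho_j$ and collapses to the
trace term $-\frac12\sum_im_{\mu ii}$ (`sum_symm_gamma`).

Finally $m$ is the sum of `baseComp`, from $\partial_Xv_i$, and `fibreBracketComp`, from
$[A(X),v_i]$ (`mixComp_eq`). The fibre part, with the derivative of $\psi$ along $A(X)$, is exactly
$\mathscr L_{A(X)}+\frac12\operatorname{div}A(X)$ (`couplingOp_eq`). The antisymmetric half of the
base part is the bracket term. Its trace is $-\partial_X\log\sqrt{|g_K|}$ (`mvfderiv_log_sqrt_det`),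
because $\det g_K$ is the inverse square of the determinant of the components of an orthonormal
frame.

Part (b) holds because, on one fibre, the coupling operator is linear in the vector field and $A(X)$
is a combination of the $e_a$ with constant coefficients. Part (c) holds because the base part and
the derivative of $\psi$ along $M$ vanish when nothing depends on $x$. -/

noncomputable section

namespace KaluzaKlein

open VectorField Set Filter Topology

/-! ### Derivatives of vector-valued functions, and the Lie bracket in a trivialization -/

section Calculus

variable {E : Type*} [NormedAddCommGroup E] [NormedSpace ℝ E]
variable {H : Type*} [TopologicalSpace H] {I : ModelWithCorners ℝ E H}
variable {N : Type*} [TopologicalSpace N] [ChartedSpace H N]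
variable {E' : Type*} [NormedAddCommGroup E'] [NormedSpace ℝ E']
variable {H' : Type*} [TopologicalSpace H'] {I' : ModelWithCorners ℝ E' H'}
variable {N' : Type*} [TopologicalSpace N'] [ChartedSpace H' N']
variable {F : Type*} [NormedAddCommGroup F] [NormedSpace ℝ F]
variable {F' : Type*} [NormedAddCommGroup F'] [NormedSpace ℝ F']

lemma mvfderiv_comp_mfderiv_apply {g : N' → F} {f : N → N'} (x : N)
    (hg : MDifferentiableAt I' 𝓘(ℝ, F) g (f x)) (hf : MDifferentiableAt I I' f x)
    (w : TangentSpace I x) :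
    mvfderiv I (fun y => g (f y)) x w = mvfderiv I' g (f x) (mfderiv I I' f x w) :=
  mfderiv_comp_apply x hg hf w

lemma mvfderiv_fderiv_comp_apply {g : F → F'} {f : N → F} (x : N)
    (hg : DifferentiableAt ℝ g (f x)) (hf : MDifferentiableAt I 𝓘(ℝ, F) f x)
    (w : TangentSpace I x) :
    mvfderiv I (fun y => g (f y)) x w = fderiv ℝ g (f x) (mvfderiv I f x w) := by
  rw [mvfderiv_comp_mfderiv_apply x hg.mdifferentiableAt hf]
  simp only [mvfderiv, mfderiv_eq_fderiv]
  rfl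

lemma mvfderiv_congr {g g' : N → F} {x : N} (h : g =ᶠ[𝓝 x] g') :
    mvfderiv I g x = mvfderiv I g' x := by
  ext w
  simp only [mvfderiv]
  have := h.mfderiv_eq (I := I) (I' := 𝓘(ℝ, F))
  exact congrArg (fun L : E →L[ℝ] F => L w) this

lemma mvfderiv_congr_apply {g g' : N → F} {x : N} (h : g =ᶠ[𝓝 x] g') (w : TangentSpace I x) :
    mvfderiv I g x w = mvfderiv I g' x w := by
  rw [mvfderiv_congr h]

/-- The fibre component of a tangent vector in the trivialization of the tangent bundle at `p`. -/
def trivRep (I : ModelWithCorners ℝ E H) [IsManifold I 1 N] (p : N) (z : TangentBundle I N) : E :=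
  (trivializationAt E (TangentSpace I) p z).2

section TrivRep

variable [IsManifold I 1 N]

/-- Links two descriptions of components: smoothness of sections is expressed through the
trivialization, the Lie bracket through pullback by the chart. -/
lemma trivRep_eq_mfderiv {p q : N} (hq : q ∈ (chartAt H p).source) (w : TangentSpace I q) :
    trivRep I p ⟨q, w⟩ = mfderiv I 𝓘(ℝ, E) (extChartAt I p) q w := by
  have h := congrFun ((trivializationAt E (TangentSpace I) p).continuousLinearMapAt_apply ℝ q) w
  rw [Bundle.Trivialization.linearMapAt_apply, if_pos (by exact hq)] at h
  exact h.symm.trans (congrArg (fun L : E →L[ℝ] E => L w)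
    (TangentBundle.continuousLinearMapAt_trivializationAt (I := I) hq))

/-- The tangent space at `p` is modelled on `E` through the preferred chart at `p`, which makes the
differential of that chart at `p` the identity. -/
lemma trivRep_self (p : N) (w : TangentSpace I p) : trivRep I p ⟨p, w⟩ = w := by
  rw [trivRep_eq_mfderiv (mem_chart_source H p), mfderiv_extChartAt_self]
  rfl

lemma mdifferentiableAt_trivRep {f : N' → N} {V : Π q : N', TangentSpace I (f q)} {q : N'}
    (hV : MDifferentiableAt I' I.tangent (fun q => (⟨f q, V q⟩ : TangentBundle I N)) q) :
    MDifferentiableAt I' 𝓘(ℝ, E) (fun q' => trivRep I (f q) ⟨f q', V q'⟩) q :=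
  ((mdifferentiableAt_totalSpace (IM := I') (IB := I) (F := E) (fun q => (⟨f q, V q⟩ : TangentBundle I N))).1 hV).2

end TrivRep

/-- The Lie bracket in terms of derivatives of the components of the fields in the trivialization
of the tangent bundle at the given point. -/
lemma mlieBracket_eq_mvfderiv_trivRep [IsManifold I 1 N] {V W : Π q : N, TangentSpace I q} {p : N}
    (hV : MDifferentiableAt I I.tangent (fun q => (⟨q, V q⟩ : TangentBundle I N)) p)
    (hW : MDifferentiableAt I I.tangent (fun q => (⟨q, W q⟩ : TangentBundle I N)) p) :
    mlieBracket I V W p = mvfderiv I (fun q => trivRep I p ⟨q, W q⟩) p (V p)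
      - mvfderiv I (fun q => trivRep I p ⟨q, V q⟩) p (W p) := by
  -- In the chart, the pulled back field is just the component function of `U`: the two
  -- differentials of the chart and of its inverse are mutually inverse on the target.
  have key : ∀ U : Π q : N, TangentSpace I q,
      ∀ z ∈ (extChartAt I p).target,
      mpullbackWithin 𝓘(ℝ, E) I (extChartAt I p).symm U (range I) z =
        writtenInExtChartAt I 𝓘(ℝ, E) p (fun q => trivRep I p ⟨q, U q⟩) z := by
    intro U z hz
    have hz' : (extChartAt I p).symm z ∈ (chartAt H p).source := by
      have := (extChartAt I p).map_target hz
      rwa [extChartAt_source] at this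
    have h1 := mfderivWithin_extChartAt_symm_comp_mfderiv_extChartAt (I := I) hz
    have h2 := mfderiv_extChartAt_comp_mfderivWithin_extChartAt_symm (I := I) hz
    simp only [mpullbackWithin_apply, writtenInExtChartAt, Function.comp_apply,
      extChartAt_model_space_eq_id, PartialEquiv.refl_coe, id]
    rw [trivRep_eq_mfderiv hz']
    rw [ContinuousLinearMap.inverse_eq h1 h2]
    rfl
  have hmem : ∀ᶠ z in 𝓝[range I] (extChartAt I p p), z ∈ (extChartAt I p).target :=
    extChartAt_target_mem_nhdsWithin p
  have hder : ∀ U : Π q : N, TangentSpace I q,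
      MDifferentiableAt I I.tangent (fun q => (⟨q, U q⟩ : TangentBundle I N)) p → ∀ w : E,
      fderivWithin ℝ (mpullbackWithin 𝓘(ℝ, E) I (extChartAt I p).symm U (range I)) (range I)
        (extChartAt I p p) w = mvfderiv I (fun q => trivRep I p ⟨q, U q⟩) p w := by
    intro U hU w
    have hd := mdifferentiableAt_trivRep (I' := I) (f := fun q => q) hU
    refine Eq.trans ?_ (congrArg (fun L : E →L[ℝ] E => L w) hd.mvfderiv).symm
    refine congrArg (fun L : E →L[ℝ] E => L w) ?_
    refine Filter.EventuallyEq.fderivWithin_eq ?_ (key U _ (mem_extChartAt_target p))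
    filter_upwards [hmem] with z hz using key U z hz
  have hval : ∀ U : Π q : N, TangentSpace I q,
      mpullbackWithin 𝓘(ℝ, E) I (extChartAt I p).symm U (range I) (extChartAt I p p) = U p := by
    intro U
    refine (key U _ (mem_extChartAt_target p)).trans ?_
    simp only [writtenInExtChartAt, Function.comp_apply, extChartAt_model_space_eq_id,
      PartialEquiv.refl_coe, id]
    rw [extChartAt_to_inv]
    exact trivRep_self p (U p)
  rw [← mlieBracketWithin_univ, mlieBracketWithin_apply, preimage_univ, univ_inter]
  -- The bracket computed in the chart is carried back by the differential of the chart at its own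
  -- base point, which is the identity.
  have hinv : ∀ w : E, (mfderiv I 𝓘(ℝ, E) (extChartAt I p) p).inverse w = w := by
    intro w
    rw [mfderiv_extChartAt_self]
    exact congrArg (fun L : E →L[ℝ] E => L w) ContinuousLinearMap.inverse_id
  refine (hinv _).trans ?_
  refine (congrFun (lieBracketWithin_eq (𝕜 := ℝ) (E := E)) (extChartAt I p p)).trans ?_
  refine congrArg₂ (fun a b : E => a - b) ?_ ?_
  · exact (congrArg (fun w : E => fderivWithin ℝ
      (mpullbackWithin 𝓘(ℝ, E) I (extChartAt I p).symm W (range I)) (range I)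
        (extChartAt I p p) w) (hval V)).trans (hder W hW (V p))
  · exact (congrArg (fun w : E => fderivWithin ℝ
      (mpullbackWithin 𝓘(ℝ, E) I (extChartAt I p).symm V (range I)) (range I)
        (extChartAt I p p) w) (hval W)).trans (hder V hV (W p))

end Calculus

end KaluzaKlein
end

noncomputable section

namespace KaluzaKlein

open VectorField Set Filter Topology

/-! ### Derivatives and tangent trivializations on a product manifold -/

section Product

variable {E : Type*} [NormedAddCommGroup E] [NormedSpace ℝ E]
variable {H : Type*} [TopologicalSpace H] {I : ModelWithCorners ℝ E H}
variable {N : Type*} [TopologicalSpace N] [ChartedSpace H N]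
variable {E' : Type*} [NormedAddCommGroup E'] [NormedSpace ℝ E']
variable {H' : Type*} [TopologicalSpace H'] {I' : ModelWithCorners ℝ E' H'}
variable {N' : Type*} [TopologicalSpace N'] [ChartedSpace H' N']
variable {F : Type*} [NormedAddCommGroup F] [NormedSpace ℝ F]
variable {F' : Type*} [NormedAddCommGroup F'] [NormedSpace ℝ F']

lemma mvfderiv_prod_apply {f : N × N' → F} {p : N × N'}
    (hf : MDifferentiableAt (I.prod I') 𝓘(ℝ, F) f p) (w : TangentSpace (I.prod I') p) :
    mvfderiv (I.prod I') f p w = mvfderiv I (fun x => f (x, p.2)) p.1 w.1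
      + mvfderiv I' (fun y => f (p.1, y)) p.2 w.2 :=
  mfderiv_prod_eq_add_apply hf

lemma mvfderiv_comp_fst {f : N → F} {p : N × N'} (hf : MDifferentiableAt I 𝓘(ℝ, F) f p.1)
    (w : TangentSpace (I.prod I') p) :
    mvfderiv (I.prod I') (fun q : N × N' => f q.1) p w = mvfderiv I f p.1 w.1 := by
  rw [mvfderiv_comp_mfderiv_apply (I' := I) p hf mdifferentiableAt_fst, mfderiv_fst]
  rfl

lemma mvfderiv_comp_snd {f : N' → F} {p : N × N'} (hf : MDifferentiableAt I' 𝓘(ℝ, F) f p.2)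
    (w : TangentSpace (I.prod I') p) :
    mvfderiv (I.prod I') (fun q : N × N' => f q.2) p w = mvfderiv I' f p.2 w.2 := by
  rw [mvfderiv_comp_mfderiv_apply (I' := I') p hf mdifferentiableAt_snd, mfderiv_snd]
  rfl

lemma mvfderiv_clm_comp (L : F →L[ℝ] F') {f : N → F} {p : N}
    (hf : MDifferentiableAt I 𝓘(ℝ, F) f p) (w : TangentSpace I p) :
    mvfderiv I (fun q => L (f q)) p w = L (mvfderiv I f p w) := by
  rw [mvfderiv_fderiv_comp_apply (g := L) p L.differentiableAt hf, L.fderiv]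

lemma mdifferentiableAt_pi_space {ι : Type*} [Fintype ι] {f : N → ι → F} {p : N}
    (hf : ∀ i, MDifferentiableAt I 𝓘(ℝ, F) (fun q => f q i) p) :
    MDifferentiableAt I 𝓘(ℝ, ι → F) f p := by
  rw [mdifferentiableAt_iff]
  refine ⟨continuousAt_pi.2 fun i => (hf i).continuousAt, differentiableWithinAt_pi.2 fun i => ?_⟩
  exact ((mdifferentiableAt_iff _ _).1 (hf i)).2

lemma mvfderiv_pi_apply {ι : Type*} [Fintype ι] {f : N → ι → F} {p : N}
    (hf : MDifferentiableAt I 𝓘(ℝ, ι → F) f p) (w : TangentSpace I p) (i : ι) :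
    mvfderiv I f p w i = mvfderiv I (fun q => f q i) p w :=
  (mvfderiv_clm_comp (ContinuousLinearMap.proj (R := ℝ) (φ := fun _ : ι => F) i) hf w).symm

variable [IsManifold I 1 N] [IsManifold I' 1 N']

/-- The extended chart of a product is the product of the charts. The trivializations are their
differentials, so each component can be read off by a linear projection. -/
lemma trivRep_prod {p q : N × N'} (hq : q ∈ (chartAt (ModelProd H H') p).source)
    (w : TangentSpace (I.prod I') q) :
    trivRep (I.prod I') p ⟨q, w⟩ =
      (trivRep I p.1 ⟨q.1, w.1⟩, trivRep I' p.2 ⟨q.2, w.2⟩) := by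
  have hq' : q ∈ (chartAt H p.1).source ×ˢ (chartAt H' p.2).source := by
    simpa only [prodChartedSpace_chartAt, OpenPartialHomeomorph.prod_source] using! hq
  have hd : MDifferentiableAt (I.prod I') 𝓘(ℝ, E × E') (extChartAt (I.prod I') p) q :=
    mdifferentiableAt_extChartAt hq
  have h : trivRep (I.prod I') p ⟨q, w⟩ = mvfderiv (I.prod I') (extChartAt (I.prod I') p) q w :=
    trivRep_eq_mfderiv hq w
  rw [h]
  refine Prod.ext ?_ ?_
  · refine (mvfderiv_clm_comp (ContinuousLinearMap.fst ℝ E E') hd w).symm.trans ?_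
    have e : (fun z => ContinuousLinearMap.fst ℝ E E' (extChartAt (I.prod I') p z))
        = fun z : N × N' => extChartAt I p.1 z.1 := by
      ext z; rw [extChartAt_prod]; rfl
    rw [e, mvfderiv_comp_fst (mdifferentiableAt_extChartAt hq'.1)]
    exact (trivRep_eq_mfderiv hq'.1 _).symm
  · refine (mvfderiv_clm_comp (ContinuousLinearMap.snd ℝ E E') hd w).symm.trans ?_
    have e : (fun z => ContinuousLinearMap.snd ℝ E E' (extChartAt (I.prod I') p z))
        = fun z : N × N' => extChartAt I' p.2 z.2 := by
      ext z; rw [extChartAt_prod]; rfl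
    rw [e, mvfderiv_comp_snd (mdifferentiableAt_extChartAt hq'.2)]
    exact (trivRep_eq_mfderiv hq'.2 _).symm

end Product

/-! ### Lie brackets on the product of fields with basic horizontal part -/

section Brackets

variable {k : ℕ}
variable {M : Type*} [TopologicalSpace M] [ChartedSpace (EuclideanSpace ℝ (Fin 4)) M]
  [IsManifold (𝓡 4) ∞ M]
variable {K : Type*} [TopologicalSpace K] [ChartedSpace (EuclideanSpace ℝ (Fin k)) K]
  [IsManifold (𝓡 k) ∞ K]

/-- The vertical family of vectors `V` is differentiable at `p`. -/
def VertDiffAt (V : Π p : M × K, TangentSpace (𝓡 k) p.2) (p : M × K) : Prop :=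
  MDifferentiableAt ((𝓡 4).prod (𝓡 k)) (𝓡 k).tangent
    (fun q : M × K => (⟨q.2, V q⟩ : TangentBundle (𝓡 k) K)) p

/-- The vector field `X` is differentiable at `x`. -/
def FieldDiffAt {n : ℕ} {N : Type*} [TopologicalSpace N]
    [ChartedSpace (EuclideanSpace ℝ (Fin n)) N] [IsManifold (𝓡 n) ∞ N]
    (X : Π x : N, TangentSpace (𝓡 n) x) (x : N) : Prop :=
  MDifferentiableAt (𝓡 n) (𝓡 n).tangent (fun z => (⟨z, X z⟩ : TangentBundle (𝓡 n) N)) x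

lemma VertDiffAt.slice {V : Π p : M × K, TangentSpace (𝓡 k) p.2} {p : M × K}
    (hV : VertDiffAt V p) : FieldDiffAt (fun y => V (p.1, y)) p.2 := by
  have h : MDifferentiableAt (𝓡 k) ((𝓡 4).prod (𝓡 k)) (fun y : K => (p.1, y)) p.2 :=
    mdifferentiableAt_const.prodMk mdifferentiableAt_id
  exact MDifferentiableAt.comp (I' := (𝓡 4).prod (𝓡 k)) (f := fun y : K => (p.1, y)) p.2 hV h

/-- With `y` held fixed all the vectors lie in one space $T_yK$, on which the trivialization at `y`
is the identity; this is what gives `baseDeriv` a meaning. -/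
lemma VertDiffAt.base {V : Π p : M × K, TangentSpace (𝓡 k) p.2} {p : M × K}
    (hV : VertDiffAt V p) :
    MDifferentiableAt (𝓡 4) 𝓘(ℝ, EuclideanSpace ℝ (Fin k)) (fun x : M => V (x, p.2)) p.1 := by
  have h : MDifferentiableAt (𝓡 4) ((𝓡 4).prod (𝓡 k)) (fun x : M => (x, p.2)) p.1 :=
    mdifferentiableAt_id.prodMk mdifferentiableAt_const
  have h2 := MDifferentiableAt.comp (I' := (𝓡 4).prod (𝓡 k)) (f := fun x : M => (x, p.2)) p.1
    (mdifferentiableAt_trivRep (I := 𝓡 k) (f := fun q : M × K => q.2) (q := p) hV) h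
  refine h2.congr_of_eventuallyEq (Eventually.of_forall fun x => ?_)
  exact (trivRep_self p.2 (V (x, p.2))).symm

lemma mdifferentiableAt_mkP {X : Π x : M, TangentSpace (𝓡 4) x}
    {V : Π p : M × K, TangentSpace (𝓡 k) p.2} {p : M × K}
    (hX : FieldDiffAt X p.1) (hV : VertDiffAt V p) :
    MDifferentiableAt ((𝓡 4).prod (𝓡 k)) ((𝓡 4).prod (𝓡 k)).tangent
      (fun q : M × K =>
        (⟨q, mkP (X q.1) (V q)⟩ : TangentBundle ((𝓡 4).prod (𝓡 k)) (M × K))) p := by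
  have h1 : MDifferentiableAt ((𝓡 4).prod (𝓡 k)) (𝓡 4).tangent
      (fun q : M × K => (⟨q.1, X q.1⟩ : TangentBundle (𝓡 4) M)) p :=
    MDifferentiableAt.comp (I' := 𝓡 4) p hX mdifferentiableAt_fst
  have h2 := (contMDiff_equivTangentBundleProd_symm (n := ∞) (I := 𝓡 4) (M := M) (I' := 𝓡 k)
    (M' := K)).mdifferentiable (by simp) (⟨p.1, X p.1⟩, ⟨p.2, V p⟩)
  exact MDifferentiableAt.comp p h2 (h1.prodMk hV)

open SubmersionMetric in
/-- The Lie bracket on `M × K` of fields whose components along `M` are basic. -/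
theorem mlieBracket_mkP {X Y : Π x : M, TangentSpace (𝓡 4) x}
    {V W : Π p : M × K, TangentSpace (𝓡 k) p.2} {p : M × K}
    (hX : FieldDiffAt X p.1) (hY : FieldDiffAt Y p.1) (hV : VertDiffAt V p)
    (hW : VertDiffAt W p) :
    mlieBracket ((𝓡 4).prod (𝓡 k)) (fun q => mkP (X q.1) (V q)) (fun q => mkP (Y q.1) (W q)) p =
      mkP (mlieBracket (𝓡 4) X Y p.1)
        (baseDeriv (fun x => W (x, p.2)) p.1 (X p.1) - baseDeriv (fun x => V (x, p.2)) p.1 (Y p.1)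
          + mlieBracket (𝓡 k) (fun y => V (p.1, y)) (fun y => W (p.1, y)) p.2) := by
  -- The components along `M` depend on `x` alone, while those along `K` depend on both variables;
  -- the partial derivatives of the latter give `baseDeriv` and the bracket on the fibre.
  have key : ∀ (X : Π x : M, TangentSpace (𝓡 4) x) (V : Π p : M × K, TangentSpace (𝓡 k) p.2),
      FieldDiffAt X p.1 → VertDiffAt V p → ∀ w : TangentSpace ((𝓡 4).prod (𝓡 k)) p,
      mvfderiv ((𝓡 4).prod (𝓡 k))
        (fun q => trivRep ((𝓡 4).prod (𝓡 k)) p ⟨q, mkP (X q.1) (V q)⟩) p w =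
      (mvfderiv (𝓡 4) (fun x => trivRep (𝓡 4) p.1 ⟨x, X x⟩) p.1 w.1,
        mvfderiv (𝓡 4) (F := EuclideanSpace ℝ (Fin k)) (fun x => V (x, p.2)) p.1 w.1 +
        mvfderiv (𝓡 k) (fun y => trivRep (𝓡 k) p.2 ⟨y, V (p.1, y)⟩) p.2 w.2) := by
    intro X V hX hV w
    have hd := mdifferentiableAt_trivRep (f := fun q : M × K => q) (mdifferentiableAt_mkP hX hV)
    have hX' := mdifferentiableAt_trivRep (f := fun x : M => x) hX
    have hV' := mdifferentiableAt_trivRep (f := fun q : M × K => q.2) hV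
    have hev : ∀ᶠ q in 𝓝 p, trivRep ((𝓡 4).prod (𝓡 k)) p ⟨q, mkP (X q.1) (V q)⟩ =
        (trivRep (𝓡 4) p.1 ⟨q.1, X q.1⟩, trivRep (𝓡 k) p.2 ⟨q.2, V q⟩) := by
      filter_upwards [chart_source_mem_nhds
        (ModelProd (EuclideanSpace ℝ (Fin 4)) (EuclideanSpace ℝ (Fin k))) p] with q hq
      exact trivRep_prod hq _
    refine Prod.ext ?_ ?_
    · refine (mvfderiv_clm_comp (ContinuousLinearMap.fst ℝ _ _) hd w).symm.trans ?_
      refine (mvfderiv_congr_apply (hev.mono fun q hq => congrArg Prod.fst hq) w).trans ?_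
      exact mvfderiv_comp_fst (I' := 𝓡 k) hX' w
    · refine (mvfderiv_clm_comp (ContinuousLinearMap.snd ℝ _ _) hd w).symm.trans ?_
      refine (mvfderiv_congr_apply (hev.mono fun q hq => congrArg Prod.snd hq) w).trans ?_
      refine (mvfderiv_prod_apply hV' w).trans ?_
      refine congrArg₂ (fun a b : EuclideanSpace ℝ (Fin k) => a + b) ?_ rfl
      refine congrArg (fun L : EuclideanSpace ℝ (Fin 4) →L[ℝ] EuclideanSpace ℝ (Fin k) => L w.1) ?_
      -- Moving along `M` leaves the foot point in `K` unchanged, so the trivialization acts as the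
      -- identity.
      exact mvfderiv_congr (Eventually.of_forall fun x => trivRep_self p.2 (V (x, p.2)))
  rw [mlieBracket_eq_mvfderiv_trivRep (mdifferentiableAt_mkP hX hV) (mdifferentiableAt_mkP hY hW),
    key X V hX hV, key Y W hY hW, mlieBracket_eq_mvfderiv_trivRep hX hY,
    mlieBracket_eq_mvfderiv_trivRep hV.slice hW.slice]
  refine Prod.ext rfl ?_
  change (_ + _ : EuclideanSpace ℝ (Fin k)) - (_ + _) = _ - _ + (_ - _)
  exact add_sub_add_comm _ _ _ _

end Brackets

end KaluzaKlein
end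

noncomputable section

namespace KaluzaKlein

open VectorField Set Filter Topology

/-! ### Koszul's formula in a frame with constant inner products -/

section Koszul

variable {E : Type*} [NormedAddCommGroup E] [NormedSpace ℝ E]
variable {H : Type*} [TopologicalSpace H] {I : ModelWithCorners ℝ E H}
variable {N : Type*} [TopologicalSpace N] [ChartedSpace H N]
variable {ι : Type*}

/-- The Levi-Civita connection in a frame with constant inner products. -/
lemma leviCivita_frame {g : Π p : N, TangentSpace I p → TangentSpace I p → ℝ}
    {u : ι → Π p : N, TangentSpace I p} {p : N}
    (h : ∀ i j, mvfderiv I (fun q => g q (u i q) (u j q)) p = 0) (i j l : ι) :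
    leviCivita I g (u i) (u j) (u l) p = 1 / 2 * (g p (mlieBracket I (u i) (u j) p) (u l p)
      - g p (mlieBracket I (u j) (u l) p) (u i p) + g p (mlieBracket I (u l) (u i) p) (u j p)) := by
  simp only [leviCivita, h, zero_apply]
  ring

lemma mvfderiv_eq_zero_of_eventually_const {F : Type*} [NormedAddCommGroup F] [NormedSpace ℝ F]
    {f : N → F} {p : N} {c : F} (h : ∀ᶠ q in 𝓝 p, f q = c) : mvfderiv I f p = 0 :=
  (mvfderiv_congr h).trans (mvfderiv_const c)

end Koszul

/-! ### The adapted frame: brackets, inner products, orthonormality -/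

section AdaptedFrame

variable {k : ℕ}
variable {M : Type*} [TopologicalSpace M] [ChartedSpace (EuclideanSpace ℝ (Fin 4)) M]
  [IsManifold (𝓡 4) ∞ M]
variable {K : Type*} [TopologicalSpace K] [ChartedSpace (EuclideanSpace ℝ (Fin k)) K]
  [IsManifold (𝓡 k) ∞ K]

/-- `X` and `v` are differentiable at `p`, and orthonormal frames of `TM` and of the vertical bundle
near `p`. -/
structure IsAdaptedAt (G : SubmersionMetric k M K) (X : Fin 4 → Π x : M, TangentSpace (𝓡 4) x)
    (v : Fin k → Π p : M × K, TangentSpace (𝓡 k) p.2) (p : M × K) : Prop where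
  diff_base : ∀ μ, FieldDiffAt (X μ) p.1
  diff_vert : ∀ j, VertDiffAt (v j) p
  ortho_base : ∀ᶠ x in 𝓝 p.1, ∀ μ ν, G.gM x (X μ x) (X ν x) = if μ = ν then etaM μ else 0
  ortho_vert : ∀ᶠ q in 𝓝 p, ∀ i j, G.gK q (v i q) (v j q) = if i = j then 1 else 0
  spans_vert : ∀ w : TangentSpace (𝓡 k) p.2, ∃ c : Fin k → ℝ, w = ∑ i, c i • v i p

variable {G : SubmersionMetric k M K} {X : Fin 4 → Π x : M, TangentSpace (𝓡 4) x}
variable {v : Fin k → Π p : M × K, TangentSpace (𝓡 k) p.2} {p : M × K}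

lemma vertDiffAt_gauge (G : SubmersionMetric k M K) {Y : Π x : M, TangentSpace (𝓡 4) x}
    {p : M × K} (hY : FieldDiffAt Y p.1) : VertDiffAt (fun q => G.A q (Y q.1)) p := by
  have h1 : MDifferentiableAt ((𝓡 4).prod (𝓡 k)) (𝓡 4).tangent
      (fun q : M × K => (⟨q.1, Y q.1⟩ : TangentBundle (𝓡 4) M)) p :=
    MDifferentiableAt.comp (I' := 𝓡 4) p hY mdifferentiableAt_fst
  have h2 := G.smooth_A.mdifferentiable (by simp) (⟨p.1, Y p.1⟩, p.2)
  exact MDifferentiableAt.comp p h2 (h1.prodMk mdifferentiableAt_snd)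

lemma vertDiffAt_zero (p : M × K) : VertDiffAt (fun q : M × K => (0 : TangentSpace (𝓡 k) q.2)) p :=
  MDifferentiableAt.comp (I' := 𝓡 k) (f := fun q : M × K => q.2) p
    ((Bundle.contMDiff_zeroSection ℝ (TangentSpace (𝓡 k) : K → Type _)).mdifferentiable
      (n := ∞) (by simp) p.2)
    mdifferentiableAt_snd

lemma fieldDiffAt_zero (x : M) : FieldDiffAt (fun z : M => (0 : TangentSpace (𝓡 4) z)) x :=
  (Bundle.contMDiff_zeroSection ℝ (TangentSpace (𝓡 4) : M → Type _)).mdifferentiable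
    (n := ∞) (by simp) x

open SubmersionMetric

/-- The vertical component of the bracket of a basic horizontal field with a vertical field. -/
def vertBracket (G : SubmersionMetric k M K) (Y : Π x : M, TangentSpace (𝓡 4) x)
    (V : Π p : M × K, TangentSpace (𝓡 k) p.2) (p : M × K) : TangentSpace (𝓡 k) p.2 :=
  baseDeriv (fun x => V (x, p.2)) p.1 (Y p.1)
    + mlieBracket (𝓡 k) (G.gauge Y p.1) (fun y => V (p.1, y)) p.2

/-- The curvature is the vertical defect of the lift from being bracket-preserving: the term
$A([Y,Z])$ subtracted in $d_MA$ is what the lift of $[Y,Z]$ needs. -/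
lemma mlieBracket_hlift_hlift {Y Z : Π x : M, TangentSpace (𝓡 4) x} (hY : FieldDiffAt Y p.1)
    (hZ : FieldDiffAt Z p.1) :
    mlieBracket ((𝓡 4).prod (𝓡 k)) (G.hlift Y) (G.hlift Z) p =
      mkP (mlieBracket (𝓡 4) Y Z p.1)
        (G.A p (mlieBracket (𝓡 4) Y Z p.1) + G.curvature Y Z p) := by
  refine (mlieBracket_mkP hY hZ (vertDiffAt_gauge G hY) (vertDiffAt_gauge G hZ)).trans ?_
  refine congrArg (mkP _) ?_
  simp only [SubmersionMetric.curvature, SubmersionMetric.gauge]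
  abel

/-- A vertical field projects to zero on `M`, hence so does its bracket with a projectable field.
Taking for `V` the gauge field or zero covers both horizontal lifts and the unlifted fields of the
bracket term. -/
lemma mlieBracket_mkP_vlift {Y : Π x : M, TangentSpace (𝓡 4) x}
    {V W : Π p : M × K, TangentSpace (𝓡 k) p.2} (hY : FieldDiffAt Y p.1) (hV : VertDiffAt V p)
    (hW : VertDiffAt W p) :
    mlieBracket ((𝓡 4).prod (𝓡 k)) (fun q => mkP (Y q.1) (V q)) (vlift W) p =
      mkP 0 (baseDeriv (fun x => W (x, p.2)) p.1 (Y p.1)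
        + mlieBracket (𝓡 k) (fun y => V (p.1, y)) (fun y => W (p.1, y)) p.2) := by
  refine (mlieBracket_mkP hY (fieldDiffAt_zero p.1) hV hW).trans ?_
  have h0 : mlieBracket (𝓡 4) Y (fun z => 0) p.1 = 0 :=
    congrFun (mlieBracket_zero_right (I := 𝓡 4) (W := Y)) p.1
  have h1 : baseDeriv (fun x => V (x, p.2)) p.1 (0 : TangentSpace (𝓡 4) p.1) = 0 := map_zero _
  rw [h0, h1, sub_zero]

lemma mlieBracket_hlift_vlift {Y : Π x : M, TangentSpace (𝓡 4) x}
    {V : Π p : M × K, TangentSpace (𝓡 k) p.2} (hY : FieldDiffAt Y p.1) (hV : VertDiffAt V p) :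
    mlieBracket ((𝓡 4).prod (𝓡 k)) (G.hlift Y) (vlift V) p = mkP 0 (vertBracket G Y V p) :=
  mlieBracket_mkP_vlift hY (vertDiffAt_gauge G hY) hV

lemma mlieBracket_vlift_hlift {Y : Π x : M, TangentSpace (𝓡 4) x}
    {V : Π p : M × K, TangentSpace (𝓡 k) p.2} (hY : FieldDiffAt Y p.1) (hV : VertDiffAt V p) :
    mlieBracket ((𝓡 4).prod (𝓡 k)) (vlift V) (G.hlift Y) p = mkP 0 (-vertBracket G Y V p) := by
  rw [mlieBracket_swap_apply, mlieBracket_hlift_vlift hY hV]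
  exact Prod.ext neg_zero rfl

lemma mlieBracket_vlift_vlift {V W : Π p : M × K, TangentSpace (𝓡 k) p.2} (hV : VertDiffAt V p)
    (hW : VertDiffAt W p) :
    mlieBracket ((𝓡 4).prod (𝓡 k)) (vlift V) (vlift W) p =
      mkP 0 (mlieBracket (𝓡 k) (fun y => V (p.1, y)) (fun y => W (p.1, y)) p.2) := by
  refine (mlieBracket_mkP_vlift (fieldDiffAt_zero p.1) hV hW).trans ?_
  have h1 : baseDeriv (fun x => W (x, p.2)) p.1 (0 : TangentSpace (𝓡 4) p.1) = 0 := map_zero _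
  rw [h1, zero_add]

lemma mlieBracket_baseField_vlift {Y : Π x : M, TangentSpace (𝓡 4) x}
    {V : Π p : M × K, TangentSpace (𝓡 k) p.2} (hY : FieldDiffAt Y p.1) (hV : VertDiffAt V p) :
    mlieBracket ((𝓡 4).prod (𝓡 k)) (baseField Y) (vlift V) p =
      mkP 0 (baseDeriv (fun x => V (x, p.2)) p.1 (Y p.1)) := by
  refine (mlieBracket_mkP_vlift hY (vertDiffAt_zero p) hV).trans ?_
  have h0 : mlieBracket (𝓡 k) (fun _ => 0) (fun y => V (p.1, y)) p.2 = 0 :=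
    congrFun (mlieBracket_zero_left (I := 𝓡 k) (W := fun y => V (p.1, y))) p.2
  rw [h0, add_zero]

section Inner

variable (G p)

lemma gP_vert_vert (V W : TangentSpace (𝓡 k) p.2) : G.gP p (mkP 0 V) (mkP 0 W) = G.gK p V W := by
  simpa using! gP_hlift G p 0 0 V W

lemma gP_vert_hor (Y : TangentSpace (𝓡 4) p.1) (V : TangentSpace (𝓡 k) p.2) :
    G.gP p (mkP 0 V) (mkP Y (G.A p Y)) = 0 := by
  simpa using! gP_hlift G p 0 Y V 0

/-- The vertical excess `V` makes room for the curvature part of a bracket of two lifts. -/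
lemma gP_hor_hor (Y Z : TangentSpace (𝓡 4) p.1) (V : TangentSpace (𝓡 k) p.2) :
    G.gP p (mkP Y (G.A p Y + V)) (mkP Z (G.A p Z)) = G.gM p.1 Y Z := by
  simpa using! gP_hlift G p Y Z V 0

lemma gP_hor_vert (Y : TangentSpace (𝓡 4) p.1) (V W : TangentSpace (𝓡 k) p.2) :
    G.gP p (mkP Y (G.A p Y + V)) (mkP 0 W) = G.gK p V W := by
  simpa using! gP_hlift G p Y 0 V W

end Inner

lemma IsAdaptedAt.mvfderiv_gM (h : IsAdaptedAt G X v p) (μ ν : Fin 4) :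
    mvfderiv (𝓡 4) (fun x => G.gM x (X μ x) (X ν x)) p.1 = 0 :=
  mvfderiv_eq_zero_of_eventually_const (h.ortho_base.mono fun _ hx => hx μ ν)

lemma tendsto_slice (p : M × K) : Tendsto (fun y : K => (p.1, y)) (𝓝 p.2) (𝓝 p) :=
  (Continuous.prodMk_right p.1).tendsto p.2

lemma tendsto_base (p : M × K) : Tendsto (fun x : M => (x, p.2)) (𝓝 p.1) (𝓝 p) :=
  (Continuous.prodMk_left p.2).tendsto p.1

lemma IsAdaptedAt.mvfderiv_fibre (h : IsAdaptedAt G X v p) (i j : Fin k) :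
    mvfderiv (𝓡 k) (fun y => G.fibre p.1 y (fibreFrame v p.1 i y) (fibreFrame v p.1 j y)) p.2 = 0 :=
  mvfderiv_eq_zero_of_eventually_const
    ((tendsto_slice p).eventually (h.ortho_vert.mono fun _ hx => hx i j))

lemma IsAdaptedAt.ortho_adapted (h : IsAdaptedAt G X v p) :
    ∀ᶠ q in 𝓝 p, ∀ r s, G.gP q (adaptedFrame G X v r q) (adaptedFrame G X v s q) =
      if r = s then etaP k r else 0 := by
  have hb : ∀ᶠ q : M × K in 𝓝 p, ∀ μ ν,
      G.gM q.1 (X μ q.1) (X ν q.1) = if μ = ν then etaM μ else 0 :=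
    (continuous_fst.tendsto p).eventually h.ortho_base
  filter_upwards [hb, h.ortho_vert] with q hq1 hq2
  rintro (μ | i) (ν | j)
  · have := gP_hor_hor G q (X μ q.1) (X ν q.1) 0
    rw [add_zero] at this
    simpa [etaP] using! this.trans (hq1 μ ν)
  · have := gP_hor_vert G q (X μ q.1) 0 (v j q)
    rw [add_zero] at this
    simpa using! this
  · simpa using! gP_vert_hor G q (X ν q.1) (v i q)
  · simpa [etaP, etaK] using! (gP_vert_vert G q (v i q) (v j q)).trans (hq2 i j)

lemma IsAdaptedAt.mvfderiv_gP (h : IsAdaptedAt G X v p) (r s : Fin 4 ⊕ Fin k) :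
    mvfderiv ((𝓡 4).prod (𝓡 k))
      (fun q => G.gP q (adaptedFrame G X v r q) (adaptedFrame G X v s q)) p = 0 :=
  mvfderiv_eq_zero_of_eventually_const (h.ortho_adapted.mono fun _ hx => hx r s)

end AdaptedFrame

end KaluzaKlein
end

noncomputable section

namespace KaluzaKlein

open VectorField Set Filter Topology

/-! ### Connection coefficients of the adapted frame -/

section Connection

variable {k : ℕ}
variable {M : Type*} [TopologicalSpace M] [ChartedSpace (EuclideanSpace ℝ (Fin 4)) M]
  [IsManifold (𝓡 4) ∞ M]
variable {K : Type*} [TopologicalSpace K] [ChartedSpace (EuclideanSpace ℝ (Fin k)) K]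
  [IsManifold (𝓡 k) ∞ K]
variable {G : SubmersionMetric k M K} {X : Fin 4 → Π x : M, TangentSpace (𝓡 4) x}
variable {v : Fin k → Π p : M × K, TangentSpace (𝓡 k) p.2} {p : M × K}

/-- The connection coefficients `g_P(∇_{u_r} u_s, u_t)` of the adapted frame `u`. -/
def connP (G : SubmersionMetric k M K) (X : Fin 4 → Π x : M, TangentSpace (𝓡 4) x)
    (v : Fin k → Π p : M × K, TangentSpace (𝓡 k) p.2) (p : M × K) (r s t : Fin 4 ⊕ Fin k) : ℝ :=
  leviCivita ((𝓡 4).prod (𝓡 k)) G.gP (adaptedFrame G X v r) (adaptedFrame G X v s)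
    (adaptedFrame G X v t) p

/-- The structure functions `g_P([u_r, u_s], u_t)` of the adapted frame `u`. -/
def structP (G : SubmersionMetric k M K) (X : Fin 4 → Π x : M, TangentSpace (𝓡 4) x)
    (v : Fin k → Π p : M × K, TangentSpace (𝓡 k) p.2) (p : M × K) (r s t : Fin 4 ⊕ Fin k) : ℝ :=
  G.gP p (mlieBracket ((𝓡 4).prod (𝓡 k)) (adaptedFrame G X v r) (adaptedFrame G X v s) p)
    (adaptedFrame G X v t p)

/-- The components `g_K(F_A(X_μ, X_ν), v_j)` of the curvature. -/
def curvComp (G : SubmersionMetric k M K) (X : Fin 4 → Π x : M, TangentSpace (𝓡 4) x)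
    (v : Fin k → Π p : M × K, TangentSpace (𝓡 k) p.2) (p : M × K) (μ ν : Fin 4) (j : Fin k) : ℝ :=
  G.gK p (G.curvature (X μ) (X ν) p) (v j p)

/-- The components `g_P([X_μ^H, v_i], v_j)`. -/
def mixComp (G : SubmersionMetric k M K) (X : Fin 4 → Π x : M, TangentSpace (𝓡 4) x)
    (v : Fin k → Π p : M × K, TangentSpace (𝓡 k) p.2) (p : M × K) (μ : Fin 4) (i j : Fin k) : ℝ :=
  G.gK p (vertBracket G (X μ) (v i) p) (v j p)

lemma IsAdaptedAt.connP_eq (h : IsAdaptedAt G X v p) (r s t : Fin 4 ⊕ Fin k) :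
    connP G X v p r s t = 1 / 2 * (structP G X v p r s t - structP G X v p s t r
      + structP G X v p t r s) :=
  leviCivita_frame h.mvfderiv_gP r s t

lemma gP_neg_left (G : SubmersionMetric k M K) (p : M × K)
    (w w' : TangentSpace ((𝓡 4).prod (𝓡 k)) p) : G.gP p (-w) w' = -G.gP p w w' := by
  have e1 : compM (-w) = -compM w := rfl
  have e2 : compK (-w) = -compK w := rfl
  simp only [SubmersionMetric.gP, e1, e2, map_neg, neg_apply]
  ring

open Sum

lemma structP_hhh (h : IsAdaptedAt G X v p) (μ ν σ : Fin 4) :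
    structP G X v p (inl μ) (inl ν) (inl σ) =
    G.gM p.1 (mlieBracket (𝓡 4) (X μ) (X ν) p.1) (X σ p.1) :=
  (congrArg (fun w => G.gP p w (G.hlift (X σ) p))
    (mlieBracket_hlift_hlift (h.diff_base μ) (h.diff_base ν))).trans (gP_hor_hor G p _ _ _)

lemma structP_hhv (h : IsAdaptedAt G X v p) (μ ν : Fin 4) (j : Fin k) :
    structP G X v p (inl μ) (inl ν) (inr j) =
    curvComp G X v p μ ν j :=
  (congrArg (fun w => G.gP p w (vlift (v j) p))
    (mlieBracket_hlift_hlift (h.diff_base μ) (h.diff_base ν))).trans (gP_hor_vert G p _ _ _)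

lemma structP_hvh (h : IsAdaptedAt G X v p) (μ σ : Fin 4) (i : Fin k) :
    structP G X v p (inl μ) (inr i) (inl σ) = 0 :=
  (congrArg (fun w => G.gP p w (G.hlift (X σ) p))
    (mlieBracket_hlift_vlift (h.diff_base μ) (h.diff_vert i))).trans (gP_vert_hor G p _ _)

lemma structP_hvv (h : IsAdaptedAt G X v p) (μ : Fin 4) (i j : Fin k) :
    structP G X v p (inl μ) (inr i) (inr j) =
    mixComp G X v p μ i j :=
  (congrArg (fun w => G.gP p w (vlift (v j) p))
    (mlieBracket_hlift_vlift (h.diff_base μ) (h.diff_vert i))).trans (gP_vert_vert G p _ _)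

lemma structP_vhh (h : IsAdaptedAt G X v p) (μ σ : Fin 4) (i : Fin k) :
    structP G X v p (inr i) (inl μ) (inl σ) = 0 :=
  (congrArg (fun w => G.gP p w (G.hlift (X σ) p))
    (mlieBracket_vlift_hlift (h.diff_base μ) (h.diff_vert i))).trans (gP_vert_hor G p _ _)

lemma structP_vhv (h : IsAdaptedAt G X v p) (μ : Fin 4) (i j : Fin k) :
    structP G X v p (inr i) (inl μ) (inr j) =
    -mixComp G X v p μ i j :=
  ((congrArg (fun w => G.gP p w (vlift (v j) p))
    (mlieBracket_vlift_hlift (h.diff_base μ) (h.diff_vert i))).trans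
      (gP_vert_vert G p _ _)).trans (by rw [map_neg]; rfl)

lemma structP_vvh (h : IsAdaptedAt G X v p) (σ : Fin 4) (i j : Fin k) :
    structP G X v p (inr i) (inr j) (inl σ) = 0 :=
  (congrArg (fun w => G.gP p w (G.hlift (X σ) p))
    (mlieBracket_vlift_vlift (h.diff_vert i) (h.diff_vert j))).trans (gP_vert_hor G p _ _)

lemma structP_vvv (h : IsAdaptedAt G X v p) (i j l : Fin k) :
    structP G X v p (inr i) (inr j) (inr l) =
    G.fibre p.1 p.2 (mlieBracket (𝓡 k) (fibreFrame v p.1 i) (fibreFrame v p.1 j) p.2)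
      (fibreFrame v p.1 l p.2) :=
  (congrArg (fun w => G.gP p w (vlift (v l) p))
    (mlieBracket_vlift_vlift (h.diff_vert i) (h.diff_vert j))).trans (gP_vert_vert G p _ _)

/-- Inherited from the antisymmetry of the bracket on $M\times K$, which avoids expanding the
curvature. -/
lemma curvComp_swap (h : IsAdaptedAt G X v p) (μ ν : Fin 4) (j : Fin k) :
    curvComp G X v p ν μ j = -curvComp G X v p μ ν j := by
  rw [← structP_hhv h, ← structP_hhv h, structP, mlieBracket_swap_apply]
  exact gP_neg_left G p _ _

/-- The lifted frame has the same horizontal structure functions as the frame on `M`, and in both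
places Koszul's formula reduces to them. -/
lemma connP_hhh (h : IsAdaptedAt G X v p) (μ ν σ : Fin 4) : connP G X v p (inl μ) (inl ν) (inl σ) =
    leviCivita (𝓡 4) (fun x a b => G.gM x a b) (X μ) (X ν) (X σ) p.1 := by
  rw [h.connP_eq, structP_hhh h, structP_hhh h, structP_hhh h]
  exact (leviCivita_frame (g := fun x a b => G.gM x a b) h.mvfderiv_gM μ ν σ).symm

lemma connP_vvv (h : IsAdaptedAt G X v p) (i j l : Fin k) : connP G X v p (inr i) (inr j) (inr l) =
    leviCivita (𝓡 k) (G.fibre p.1) (fibreFrame v p.1 i) (fibreFrame v p.1 j)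
      (fibreFrame v p.1 l) p.2 := by
  rw [h.connP_eq, structP_vvv h, structP_vvv h, structP_vvv h]
  exact (leviCivita_frame (g := G.fibre p.1) h.mvfderiv_fibre i j l).symm

/-- In this coefficient and the next two a single structure function type survives, the one with two
horizontal entries bracketed into a vertical direction; the signs come from its position in Koszul's
formula. -/
lemma connP_hhv (h : IsAdaptedAt G X v p) (μ ν : Fin 4) (j : Fin k) :
    connP G X v p (inl μ) (inl ν) (inr j) =
    1 / 2 * curvComp G X v p μ ν j := by
  rw [h.connP_eq, structP_hhv h, structP_hvh h, structP_vhh h]; ring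

lemma connP_hvh (h : IsAdaptedAt G X v p) (μ ν : Fin 4) (j : Fin k) :
    connP G X v p (inl μ) (inr j) (inl ν) =
    -(1 / 2) * curvComp G X v p μ ν j := by
  rw [h.connP_eq, structP_hvh h, structP_vhh h, structP_hhv h, curvComp_swap h]; ring

lemma connP_vhh (h : IsAdaptedAt G X v p) (μ ν : Fin 4) (j : Fin k) :
    connP G X v p (inr j) (inl μ) (inl ν) =
    -(1 / 2) * curvComp G X v p μ ν j := by
  rw [h.connP_eq, structP_vhh h, structP_hhv h, structP_hvh h]; ring

/-- The antisymmetric part of `mixComp` is the rotation of the vertical frame along a horizontal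
direction; the symmetric part appears only in the two lemmas below, as the second fundamental form
of the fibres. -/
lemma connP_hvv (h : IsAdaptedAt G X v p) (μ : Fin 4) (i j : Fin k) :
    connP G X v p (inl μ) (inr i) (inr j) =
    1 / 2 * (mixComp G X v p μ i j - mixComp G X v p μ j i) := by
  rw [h.connP_eq, structP_hvv h, structP_vvh h, structP_vhv h]; ring

lemma connP_vhv (h : IsAdaptedAt G X v p) (μ : Fin 4) (i j : Fin k) :
    connP G X v p (inr i) (inl μ) (inr j) =
    -(1 / 2) * (mixComp G X v p μ i j + mixComp G X v p μ j i) := by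
  rw [h.connP_eq, structP_vhv h, structP_hvv h, structP_vvh h]; ring

lemma connP_vvh (h : IsAdaptedAt G X v p) (μ : Fin 4) (i j : Fin k) :
    connP G X v p (inr i) (inr j) (inl μ) =
    1 / 2 * (mixComp G X v p μ i j + mixComp G X v p μ j i) := by
  rw [h.connP_eq, structP_vvh h, structP_vhv h, structP_hvv h]; ring

end Connection

/-! ### The Kosmann-Lichnerowicz derivative and divergence through brackets -/

section Coupling

variable {k : ℕ}
variable {M : Type*} [TopologicalSpace M] [ChartedSpace (EuclideanSpace ℝ (Fin 4)) M]
  [IsManifold (𝓡 4) ∞ M]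
variable {K : Type*} [TopologicalSpace K] [ChartedSpace (EuclideanSpace ℝ (Fin k)) K]
  [IsManifold (𝓡 k) ∞ K]
variable {G : SubmersionMetric k M K} {X : Fin 4 → Π x : M, TangentSpace (𝓡 4) x}
variable {v : Fin k → Π p : M × K, TangentSpace (𝓡 k) p.2} {p : M × K}
variable {t : Type*} [Fintype t] [DecidableEq t]

/-- The components `g_K([e, v_i], v_j)` on the fibre through `p`. -/
def fibreBracketComp (G : SubmersionMetric k M K)
    (v : Fin k → Π p : M × K, TangentSpace (𝓡 k) p.2) (e : Π y : K, TangentSpace (𝓡 k) y)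
    (p : M × K) (i j : Fin k) : ℝ :=
  G.gK p (mlieBracket (𝓡 k) e (fibreFrame v p.1 i) p.2) (v j p)

section

variable (G)

lemma fibre_neg (x : M) (y : K) (a b : TangentSpace (𝓡 k) y) :
    G.fibre x y (-a) b = -G.fibre x y a b := by
  simp only [SubmersionMetric.fibre, map_neg, neg_apply]

lemma fibre_zero (x : M) (y : K) (b : TangentSpace (𝓡 k) y) : G.fibre x y 0 b = 0 := by
  simp only [SubmersionMetric.fibre, map_zero, zero_apply]

end

/-- The antisymmetrized coefficients of the Kosmann-Lichnerowicz derivative depend on the field only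
through its brackets with the frame. -/
lemma leviCivita_kosmann (h : IsAdaptedAt G X v p) (e : Π y : K, TangentSpace (𝓡 k) y)
    (i j : Fin k) :
    leviCivita (𝓡 k) (G.fibre p.1) e (fibreFrame v p.1 i) (fibreFrame v p.1 j) p.2
      - 1 / 2 * (leviCivita (𝓡 k) (G.fibre p.1) (fibreFrame v p.1 i) e (fibreFrame v p.1 j) p.2
        - leviCivita (𝓡 k) (G.fibre p.1) (fibreFrame v p.1 j) e (fibreFrame v p.1 i) p.2) =
    1 / 2 * (fibreBracketComp G v e p i j - fibreBracketComp G v e p j i) := by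
  have hs : ∀ a b : Π y : K, TangentSpace (𝓡 k) y,
      (fun y => G.fibre p.1 y (a y) (b y)) = fun y => G.fibre p.1 y (b y) (a y) :=
    fun a b => funext fun y => G.gK_symm _ _ _
  have e1 : ∀ i j, fibreBracketComp G v e p i j =
    G.fibre p.1 p.2 (mlieBracket (𝓡 k) e (fibreFrame v p.1 i) p.2) (fibreFrame v p.1 j p.2) :=
    fun i j => rfl
  -- Derivatives of inner products of frame vectors vanish. Those of $g_K(e,v_i)$ and the term
  -- $g_K([v_i,v_j],e)$ cancel in the combination, leaving only brackets with `e`.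
  simp only [leviCivita, h.mvfderiv_fibre, zero_apply]
  rw [hs e (fibreFrame v p.1 i), hs e (fibreFrame v p.1 j), e1, e1,
    mlieBracket_swap_apply (V := fibreFrame v p.1 i) (W := e),
    mlieBracket_swap_apply (V := fibreFrame v p.1 j) (W := e),
    mlieBracket_swap_apply (V := fibreFrame v p.1 j) (W := fibreFrame v p.1 i)]
  simp only [fibre_neg]
  ring

/-- Torsion-freeness gives $\nabla_{v_i}e=\nabla_ev_i-[e,v_i]$, and $\nabla_ev_i$ is orthogonal to
the unit vector $v_i$. In Koszul's form the two derivatives of $g_K(e,v_i)$ cancel. -/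
lemma leviCivita_div (h : IsAdaptedAt G X v p) (e : Π y : K, TangentSpace (𝓡 k) y)
    (i : Fin k) :
    leviCivita (𝓡 k) (G.fibre p.1) (fibreFrame v p.1 i) e (fibreFrame v p.1 i) p.2 =
      -fibreBracketComp G v e p i i := by
  have hs : ∀ a b : Π y : K, TangentSpace (𝓡 k) y,
      (fun y => G.fibre p.1 y (a y) (b y)) = fun y => G.fibre p.1 y (b y) (a y) :=
    fun a b => funext fun y => G.gK_symm _ _ _
  have e1 : fibreBracketComp G v e p i i =
    G.fibre p.1 p.2 (mlieBracket (𝓡 k) e (fibreFrame v p.1 i) p.2) (fibreFrame v p.1 i p.2) := rfl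
  have e2 : mlieBracket (𝓡 k) (fibreFrame v p.1 i) (fibreFrame v p.1 i) p.2 = 0 :=
    congrFun mlieBracket_self p.2
  simp only [leviCivita, h.mvfderiv_fibre, zero_apply]
  rw [hs e (fibreFrame v p.1 i), e1, e2,
    mlieBracket_swap_apply (V := fibreFrame v p.1 i) (W := e)]
  simp only [fibre_neg, fibre_zero]
  ring

/-- `[𝓛_e + ½ div(e)] ψ` in terms of the brackets of `e` with the frame. -/
lemma couplingOp_eq (h : IsAdaptedAt G X v p) (ρ : GammaMatrices (etaK k) t) (ψ : M × K → t → ℂ)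
    (e : Π y : K, TangentSpace (𝓡 k) y) :
    couplingOp G v ρ ψ e p = mvfderiv (𝓡 k) (fun y => ψ (p.1, y)) p.2 (e p.2)
      + (1 / 8 : ℝ) • ∑ i, ∑ j, (fibreBracketComp G v e p i j - fibreBracketComp G v e p j i) •
          ((ρ i * ρ j) *ᵥ ψ p)
      - (1 / 2 * ∑ i, fibreBracketComp G v e p i i) • ψ p := by
  simp only [couplingOp, kosmann, spinDeriv, divergence, etaK, one_mul, leviCivita_div h e,
    Finset.sum_neg_distrib, mul_neg, neg_smul, ← sub_eq_add_neg]
  rw [add_sub_assoc]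
  congr 2
  simp only [Finset.smul_sum, ← Finset.sum_sub_distrib, smul_smul, ← sub_smul]
  refine Finset.sum_congr rfl fun i _ => Finset.sum_congr rfl fun j _ => ?_
  congr 1
  -- The connection weight $\frac14$ and the correction $\frac18$ combine to a quarter of the left
  -- side of this identity, hence to $\frac14\cdot\frac12=\frac18$ of the antisymmetrized brackets.
  have := leviCivita_kosmann h e i j
  linarith

end Coupling

end KaluzaKlein
end

noncomputable section

namespace KaluzaKlein

open VectorField Set Filter Topology

/-! ### The volume density of the fibres -/

section Volume

/-- The determinant as a continuous multilinear map of the rows. -/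
def detRowsCM (k : ℕ) : ContinuousMultilinearMap ℝ (fun _ : Fin k => Fin k → ℝ) ℝ where
  toMultilinearMap := (Matrix.detRowAlternating (R := ℝ) (n := Fin k)).toMultilinearMap
  cont := (continuous_id (X := Matrix (Fin k) (Fin k) ℝ)).matrix_det

lemma detRowsCM_apply {k : ℕ} (R : Fin k → Fin k → ℝ) : detRowsCM k R = Matrix.det R := rfl

/-- The derivative of the determinant in the direction of a combination of the rows. -/
lemma fderiv_detRowsCM {k : ℕ} (R : Fin k → Fin k → ℝ) (B : Fin k → Fin k → ℝ) :
    fderiv ℝ (detRowsCM k) R (fun i => ∑ j, B i j • R j) = (∑ i, B i i) * Matrix.det R := by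
  rw [((detRowsCM k).hasFDerivAt R).fderiv, ContinuousMultilinearMap.linearDeriv_apply,
    Finset.sum_mul]
  refine Finset.sum_congr rfl fun i _ => ?_
  have h : detRowsCM k (Function.update R i (∑ j, B i j • R j)) =
      ∑ j, B i j * detRowsCM k (Function.update R i (R j)) := by
    refine ((detRowsCM k).toMultilinearMap.map_update_sum Finset.univ i
      (fun j => B i j • R j) R).trans ?_
    exact Finset.sum_congr rfl fun j _ => (detRowsCM k).map_update_smul R i (B i j) (R j)
  -- Replacing row `i` by a different row `R j` produces a repeated row, so only the diagonal entry
  -- `B i i` contributes.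
  rw [h, Finset.sum_eq_single i]
  · rw [Function.update_eq_self]; rfl
  · intro j _ hj
    have : detRowsCM k (Function.update R i (R j)) = 0 :=
      (Matrix.detRowAlternating (R := ℝ) (n := Fin k)).map_update_self R hj.symm
    rw [this, mul_zero]
  · simp

variable {k : ℕ}
variable {M : Type*} [TopologicalSpace M] [ChartedSpace (EuclideanSpace ℝ (Fin 4)) M]
  [IsManifold (𝓡 4) ∞ M]
variable {K : Type*} [TopologicalSpace K] [ChartedSpace (EuclideanSpace ℝ (Fin k)) K]
  [IsManifold (𝓡 k) ∞ K]
variable {G : SubmersionMetric k M K} {X : Fin 4 → Π x : M, TangentSpace (𝓡 4) x}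
variable {v : Fin k → Π p : M × K, TangentSpace (𝓡 k) p.2} {p : M × K}
variable {c : OpenPartialHomeomorph K (EuclideanSpace ℝ (Fin k))}

/-- The components of a vertical family in the coordinate system `c`. -/
def coordRep (c : OpenPartialHomeomorph K (EuclideanSpace ℝ (Fin k)))
    (V : Π p : M × K, TangentSpace (𝓡 k) p.2) (q : M × K) : EuclideanSpace ℝ (Fin k) :=
  mfderiv (𝓡 k) (𝓡 k) c q.2 (V q)

/-- The tangent map of a smooth chart is smooth over its source, and its fibre component in the
model space is `coordRep`. -/
lemma mdifferentiableAt_coordRep (hc : c ∈ IsManifold.maximalAtlas (𝓡 k) ∞ K)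
    (hp : p.2 ∈ c.source) {V : Π p : M × K, TangentSpace (𝓡 k) p.2} (hV : VertDiffAt V p) :
    MDifferentiableAt ((𝓡 4).prod (𝓡 k)) 𝓘(ℝ, EuclideanSpace ℝ (Fin k)) (coordRep c V) p := by
  have h1 := (contMDiffOn_of_mem_maximalAtlas hc).contMDiffOn_tangentMapWithin (m := 1)
    (by norm_cast) c.open_source.uniqueMDiffOn
  have hopen : IsOpen ((fun z : TangentBundle (𝓡 k) K => z.proj) ⁻¹' c.source) :=
    c.open_source.preimage (FiberBundle.continuous_proj _ _)
  have h2 := (h1.contMDiffAt (hopen.mem_nhds (x := ⟨p.2, V p⟩) hp)).mdifferentiableAt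
    (by simp)
  have h3 : MDifferentiableAt ((𝓡 4).prod (𝓡 k)) (𝓡 k).tangent
      (fun q : M × K => tangentMapWithin (𝓡 k) (𝓡 k) c c.source ⟨q.2, V q⟩) p :=
    MDifferentiableAt.comp p h2 hV
  have h4 : MDifferentiableAt ((𝓡 4).prod (𝓡 k)) 𝓘(ℝ, EuclideanSpace ℝ (Fin k))
      (fun q : M × K => (tangentMapWithin (𝓡 k) (𝓡 k) c c.source ⟨q.2, V q⟩).2) p :=
    MDifferentiableAt.comp p ((contMDiff_snd_tangentBundle_modelSpace (n := 1) _
      (𝓡 k)).mdifferentiable one_ne_zero _) h3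
  refine h4.congr_of_eventuallyEq ?_
  have : ∀ᶠ q : M × K in 𝓝 p, q.2 ∈ c.source :=
    (continuous_snd.tendsto p).eventually (c.open_source.mem_nhds hp)
  filter_upwards [this] with q hq
  simp only [coordRep, tangentMapWithin]
  rw [mfderivWithin_of_isOpen c.open_source hq]

open SubmersionMetric

/-- The coordinates live on `K` only, so their differential at the fixed point `p.2` is a constant
linear map along `M` and commutes with the derivative. -/
lemma mvfderiv_coordRep (hc : c ∈ IsManifold.maximalAtlas (𝓡 k) ∞ K)
    (hp : p.2 ∈ c.source) {V : Π p : M × K, TangentSpace (𝓡 k) p.2} (hV : VertDiffAt V p)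
    (Y : Π x : M, TangentSpace (𝓡 4) x) :
    mvfderiv ((𝓡 4).prod (𝓡 k)) (coordRep c V) p (baseField Y p) =
      mfderiv (𝓡 k) (𝓡 k) c p.2 (baseDeriv (fun x => V (x, p.2)) p.1 (Y p.1)) := by
  refine (mvfderiv_prod_apply (mdifferentiableAt_coordRep hc hp hV) _).trans ?_
  have h0 : mvfderiv (𝓡 k) (fun y => coordRep c V (p.1, y)) p.2 (baseField Y p).2 = 0 := map_zero _
  rw [h0, add_zero]
  exact mvfderiv_clm_comp (F := EuclideanSpace ℝ (Fin k)) (F' := EuclideanSpace ℝ (Fin k))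
    (mfderiv (𝓡 k) (𝓡 k) c p.2) hV.base (Y p.1)

/-- The matrix of coordinate components of the vertical frame; the rows are the vectors. -/
def coordRows (c : OpenPartialHomeomorph K (EuclideanSpace ℝ (Fin k)))
    (v : Fin k → Π p : M × K, TangentSpace (𝓡 k) p.2) (q : M × K) : Fin k → Fin k → ℝ :=
  fun i j => coordRep c (v i) q j

lemma coordRows_mul_coordMatrix_mul {q : M × K} (hc : c ∈ IsManifold.maximalAtlas (𝓡 k) ∞ K)
    (hq : q.2 ∈ c.source)
    (ho : ∀ i j, G.gK q (v i q) (v j q) = if i = j then 1 else 0) :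
    (Matrix.of (coordRows c v q)) * coordMatrix G c q * (Matrix.of (coordRows c v q))ᵀ = 1 := by
  have hmd : c.MDifferentiable (𝓡 k) (𝓡 k) :=
    ⟨(contMDiffOn_of_mem_maximalAtlas hc).mdifferentiableOn (by simp),
      (contMDiffOn_symm_of_mem_maximalAtlas hc).mdifferentiableOn (by simp)⟩
  have hinv : (mfderiv (𝓡 k) (𝓡 k) c q.2).IsInvertible := ⟨hmd.mfderiv hq, rfl⟩
  set L := mfderiv (𝓡 k) (𝓡 k) c q.2 with hL
  -- The vectors `L.inverse (EuclideanSpace.single a 1)` are the coordinate fields of `c`; expanding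
  -- the frame in them turns orthonormality into the matrix identity.
  have hv : ∀ i, v i q = ∑ a, coordRows c v q i a • L.inverse (EuclideanSpace.single a (1 : ℝ)) := by
    intro i
    have h1 : L.inverse (L (v i q)) = v i q := hinv.inverse_apply_self _
    have h2 : ∀ z : EuclideanSpace ℝ (Fin k), z = ∑ a, z a • EuclideanSpace.single a (1 : ℝ) := by
      intro z
      ext b
      simp [Finset.sum_apply, Pi.single_apply]
    have h3 : ∀ z : EuclideanSpace ℝ (Fin k),
        L.inverse z = ∑ a, z a • L.inverse (EuclideanSpace.single a (1 : ℝ)) := by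
      intro z
      conv_lhs => rw [h2 z]
      exact (map_sum L.inverse _ _).trans (Finset.sum_congr rfl fun a _ => map_smul L.inverse _ _)
    exact h1.symm.trans (h3 _)
  ext i j
  rw [Matrix.one_apply, ← ho i j]
  conv_rhs => rw [hv i, hv j]
  simp only [Matrix.mul_apply, Matrix.transpose_apply, Matrix.of_apply, coordMatrix, map_sum,
    map_smul, sum_apply, smul_apply, smul_eq_mul, Finset.sum_mul, Finset.mul_sum]
  refine Finset.sum_congr rfl fun a _ => Finset.sum_congr rfl fun b _ => ?_
  rw [← hL]
  ring

/-- The identity $RgR^{T}=1$ gives $\det g=(\det R)^{-2}$. No absolute value is needed on the right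
since `Real.log` takes the same value at $x$ and $-x$. -/
lemma log_sqrt_det_coordMatrix {q : M × K} (hc : c ∈ IsManifold.maximalAtlas (𝓡 k) ∞ K)
    (hq : q.2 ∈ c.source)
    (ho : ∀ i j, G.gK q (v i q) (v j q) = if i = j then 1 else 0) :
    Matrix.det (coordRows c v q) ≠ 0 ∧
      Real.log (Real.sqrt |(coordMatrix G c q).det|) = -Real.log (Matrix.det (coordRows c v q)) := by
  have h := congrArg Matrix.det (coordRows_mul_coordMatrix_mul hc hq ho)
  rw [Matrix.det_mul, Matrix.det_mul, Matrix.det_transpose, Matrix.det_one] at h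
  change Matrix.det (coordRows c v q) * _ * Matrix.det (coordRows c v q) = 1 at h
  have h0 : Matrix.det (coordRows c v q) ≠ 0 := by
    intro h0
    rw [h0, mul_zero] at h
    exact zero_ne_one h
  refine ⟨h0, ?_⟩
  have hg : (coordMatrix G c q).det = (Matrix.det (coordRows c v q))⁻¹ ^ 2 := by
    field_simp
    linarith
  rw [hg, abs_of_nonneg (sq_nonneg _), Real.sqrt_sq_eq_abs, Real.log_abs, Real.log_inv]

lemma IsAdaptedAt.eq_sum_inner (h : IsAdaptedAt G X v p) (w : TangentSpace (𝓡 k) p.2) :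
    w = ∑ j, G.gK p w (v j p) • v j p := by
  obtain ⟨c, hc⟩ := h.spans_vert w
  have ho := h.ortho_vert.self_of_nhds
  have : ∀ j, G.gK p w (v j p) = c j := by
    intro j
    rw [hc]
    simp [map_sum, sum_apply, ho]
  simp only [this]
  exact hc

/-- The logarithmic derivative of the volume density of the fibres along the base. -/
theorem mvfderiv_log_sqrt_det (h : IsAdaptedAt G X v p)
    (hc : c ∈ IsManifold.maximalAtlas (𝓡 k) ∞ K) (hp : p.2 ∈ c.source)
    (Y : Π x : M, TangentSpace (𝓡 4) x) :
    mvfderiv ((𝓡 4).prod (𝓡 k)) (fun q => Real.log (Real.sqrt |(coordMatrix G c q).det|)) p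
        (baseField Y p) =
      -∑ i, G.gK p (baseDeriv (fun x => v i (x, p.2)) p.1 (Y p.1)) (v i p) := by
  have hs : ∀ᶠ q : M × K in 𝓝 p, q.2 ∈ c.source :=
    (continuous_snd.tendsto p).eventually (c.open_source.mem_nhds hp)
  have hev : ∀ᶠ q in 𝓝 p, Real.log (Real.sqrt |(coordMatrix G c q).det|) =
      -Real.log (detRowsCM k (coordRows c v q)) := by
    filter_upwards [hs, h.ortho_vert] with q hq1 hq2
    exact (log_sqrt_det_coordMatrix hc hq1 hq2).2
  have h0 : detRowsCM k (coordRows c v p) ≠ 0 :=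
    (log_sqrt_det_coordMatrix hc hp h.ortho_vert.self_of_nhds).1
  have hrow : ∀ i, MDifferentiableAt ((𝓡 4).prod (𝓡 k)) 𝓘(ℝ, Fin k → ℝ)
      (fun q => coordRows c v q i) p := fun i =>
    ((EuclideanSpace.equiv (Fin k) ℝ).toContinuousLinearMap.differentiableAt.comp_mdifferentiableAt
      (mdifferentiableAt_coordRep hc hp (h.diff_vert i)))
  have hd : MDifferentiableAt ((𝓡 4).prod (𝓡 k)) 𝓘(ℝ, Fin k → Fin k → ℝ) (coordRows c v) p :=
    mdifferentiableAt_pi_space hrow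
  -- The derivative of each row is again a combination of the rows, because $\partial_Yv_i$ expands
  -- in the frame; the coefficients $g_K(\partial_Yv_i,v_j)$ form the matrix whose trace is the
  -- answer.
  have hD : mvfderiv ((𝓡 4).prod (𝓡 k)) (coordRows c v) p (baseField Y p) =
      fun i => ∑ j, G.gK p (baseDeriv (fun x => v i (x, p.2)) p.1 (Y p.1)) (v j p) •
        coordRows c v p j := by
    funext i
    rw [mvfderiv_pi_apply hd]
    refine (mvfderiv_clm_comp (EuclideanSpace.equiv (Fin k) ℝ).toContinuousLinearMap
      (mdifferentiableAt_coordRep hc hp (h.diff_vert i)) (baseField Y p)).trans ?_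
    rw [mvfderiv_coordRep hc hp (h.diff_vert i)]
    have he := h.eq_sum_inner (baseDeriv (fun x => v i (x, p.2)) p.1 (Y p.1))
    refine (congrArg (fun w => (EuclideanSpace.equiv (Fin k) ℝ).toContinuousLinearMap
      (mfderiv (𝓡 k) (𝓡 k) c p.2 w)) he).trans ?_
    let T : EuclideanSpace ℝ (Fin k) →L[ℝ] (Fin k → ℝ) :=
      (EuclideanSpace.equiv (Fin k) ℝ).toContinuousLinearMap ∘L
        (show EuclideanSpace ℝ (Fin k) →L[ℝ] EuclideanSpace ℝ (Fin k) from
          mfderiv (𝓡 k) (𝓡 k) c p.2)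
    exact (map_sum T _ _).trans (Finset.sum_congr rfl fun j _ => map_smul T _ _)
  have hg : DifferentiableAt ℝ (fun R : Fin k → Fin k → ℝ => -Real.log (detRowsCM k R))
      (coordRows c v p) :=
    (((detRowsCM k).hasFDerivAt _).differentiableAt.log h0).neg
  rw [mvfderiv_congr_apply hev, mvfderiv_fderiv_comp_apply
    (g := fun R : Fin k → Fin k → ℝ => -Real.log (detRowsCM k R)) p hg hd, hD]
  rw [fderiv_fun_neg, fderiv.log ((detRowsCM k).hasFDerivAt _).differentiableAt h0]
  simp only [neg_apply, smul_apply]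
  rw [fderiv_detRowsCM, ← detRowsCM_apply, smul_eq_mul, mul_comm, mul_assoc, mul_inv_cancel₀ h0,
    mul_one]

end Volume

end KaluzaKlein
end

noncomputable section

namespace KaluzaKlein

/-! ### Clifford contraction of the connection coefficients -/

section Clifford

variable {k : ℕ}
variable {s : Type*} [Fintype s] [DecidableEq s] {t : Type*} [Fintype t] [DecidableEq t]

/-- The tensor product of spinors as a bilinear map. -/
def tensorHom (s t : Type*) [Fintype s] [Fintype t] :
    (s → ℂ) →ₗ[ℝ] (t → ℂ) →ₗ[ℝ] (s × t → ℂ) :=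
  LinearMap.mk₂ ℝ (fun φ ψ i => φ i.1 * ψ i.2)
    (fun _ _ _ => by ext; simp [add_mul]) (fun _ _ _ => by ext; simp [mul_assoc])
    (fun _ _ _ => by ext; simp [mul_add]) (fun _ _ _ => by ext; simp [mul_left_comm])

lemma tensor_eq_tensorHom (φ : s → ℂ) (ψ : t → ℂ) : tensor φ ψ = tensorHom s t φ ψ := rfl

variable (γ : GammaMatrices etaM s) (ρ : GammaMatrices (etaK k) t)

lemma gammaP_inl_mulVec (μ : Fin 4) (φ : s → ℂ) (ψ : t → ℂ) :
    gammaP γ ρ (Sum.inl μ) *ᵥ tensorHom s t φ ψ = tensorHom s t (γ μ *ᵥ φ) ψ := by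
  have h := kronecker_mulVec_tensor (γ μ) (1 : Matrix t t ℂ) φ ψ
  rw [Matrix.one_mulVec] at h
  exact h

lemma gammaP_inr_mulVec (j : Fin k) (φ : s → ℂ) (ψ : t → ℂ) :
    gammaP γ ρ (Sum.inr j) *ᵥ tensorHom s t φ ψ = tensorHom s t (gamma5 γ *ᵥ φ) (ρ j *ᵥ ψ) :=
  kronecker_mulVec_tensor (gamma5 γ) (ρ j) φ ψ

lemma gamma5_mulVec_gamma (μ : Fin 4) (φ : s → ℂ) :
    gamma5 γ *ᵥ γ μ *ᵥ φ = -(γ μ *ᵥ gamma5 γ *ᵥ φ) := by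
  rw [Matrix.mulVec_mulVec, Matrix.mulVec_mulVec, gamma5_anti, Matrix.neg_mulVec, neg_neg]

lemma gamma5_mulVec_gamma5 (φ : s → ℂ) : gamma5 γ *ᵥ gamma5 γ *ᵥ φ = φ := by
  rw [Matrix.mulVec_mulVec, gamma5_sq, Matrix.one_mulVec]

/-- The contraction of a symmetric array with products of gamma matrices. -/
lemma sum_symm_gamma (c : Fin k → Fin k → ℝ) (ψ : t → ℂ) :
    ∑ i, ∑ j, (c i j + c j i) • (ρ i *ᵥ ρ j *ᵥ ψ) = (-2 * ∑ i, c i i) • ψ := by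
  -- Exchanging the summation indices in one half moves the symmetrization from the coefficients to
  -- the gamma matrices, where the Clifford relation applies.
  have h1 : ∑ i, ∑ j, (c i j + c j i) • (ρ i *ᵥ ρ j *ᵥ ψ) =
      ∑ i, ∑ j, c i j • ((ρ i * ρ j + ρ j * ρ i) *ᵥ ψ) := by
    simp only [add_smul, Finset.sum_add_distrib, Matrix.add_mulVec, smul_add,
      Matrix.mulVec_mulVec]
    congr 1
    exact Finset.sum_comm
  have h2 : ∀ i j, c i j • ((ρ i * ρ j + ρ j * ρ i) *ᵥ ψ) = if i = j then (-2 * c i i) • ψ else 0 := by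
    intro i j
    rw [ρ.rel]
    split_ifs with h
    · subst h
      rw [Matrix.smul_mulVec, Matrix.one_mulVec]
      ext a
      simp [etaK]
      ring
    · simp
  rw [h1]
  simp only [h2, Finset.sum_ite_eq, Finset.mem_univ, if_true, Finset.mul_sum, Finset.sum_smul]

variable {Ω : Fin 4 ⊕ Fin k → Fin 4 ⊕ Fin k → Fin 4 ⊕ Fin k → ℝ}
variable {a : Fin 4 → Fin 4 → Fin 4 → ℝ} {b : Fin k → Fin k → Fin k → ℝ}
variable {F : Fin 4 → Fin 4 → Fin k → ℝ} {c : Fin 4 → Fin k → Fin k → ℝ}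

open Sum

/-- The horizontal part of the spin connection of a submersion metric. -/
lemma spinConnection_inl (h1 : ∀ μ ν σ, Ω (inl μ) (inl ν) (inl σ) = a μ ν σ)
    (h2 : ∀ μ ν j, Ω (inl μ) (inl ν) (inr j) = 1 / 2 * F μ ν j)
    (h3 : ∀ μ j ν, Ω (inl μ) (inr j) (inl ν) = -(1 / 2) * F μ ν j)
    (h4 : ∀ μ i j, Ω (inl μ) (inr i) (inr j) = 1 / 2 * (c μ i j - c μ j i))
    (φ : s → ℂ) (ψ : t → ℂ) (μ : Fin 4) :
    ∑ x, ∑ y, (etaP k x * etaP k y * Ω (inl μ) x y) •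
        ((gammaP γ ρ x * gammaP γ ρ y) *ᵥ tensorHom s t φ ψ) =
      tensorHom s t (∑ ν, ∑ σ, (etaM ν * etaM σ * a μ ν σ) • (γ ν *ᵥ γ σ *ᵥ φ)) ψ
      + ∑ ν, ∑ j, (etaM ν * F μ ν j) • tensorHom s t (γ ν *ᵥ gamma5 γ *ᵥ φ) (ρ j *ᵥ ψ)
      + tensorHom s t φ ((1 / 2 : ℝ) • ∑ i, ∑ j, (c μ i j - c μ j i) • (ρ i *ᵥ ρ j *ᵥ ψ)) := by
  simp only [Fintype.sum_sum_type, ← Matrix.mulVec_mulVec, gammaP_inl_mulVec, gammaP_inr_mulVec,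
    gamma5_mulVec_gamma, gamma5_mulVec_gamma5, h1, h2, h3, h4, etaP, elim_inl, elim_inr, etaK,
    one_mul, mul_one, Finset.sum_add_distrib, map_sum, map_smul, LinearMap.sum_apply,
    LinearMap.smul_apply, map_neg, LinearMap.neg_apply, smul_neg, smul_smul, Finset.smul_sum]
  -- The two mixed blocks are equal: the opposite sign of the coefficients is undone by moving
  -- $\gamma_5$ past $\gamma_\nu$, so the two halves of $F$ add up.
  rw [Finset.sum_comm (s := (Finset.univ : Finset (Fin k))) (t := (Finset.univ : Finset (Fin 4)))]
  rw [← add_assoc, add_assoc (∑ _, ∑ _, _)]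
  congr 2
  simp only [← Finset.sum_add_distrib]
  refine Finset.sum_congr rfl fun ν _ => Finset.sum_congr rfl fun j _ => ?_
  module

/-- The vertical part of the spin connection of a submersion metric. -/
lemma spinConnection_inr (h1 : ∀ l i j, Ω (inr l) (inr i) (inr j) = b l i j)
    (h2 : ∀ l ν σ, Ω (inr l) (inl ν) (inl σ) = -(1 / 2) * F ν σ l)
    (h3 : ∀ l ν j, Ω (inr l) (inl ν) (inr j) = -(1 / 2) * (c ν l j + c ν j l))
    (h4 : ∀ l j ν, Ω (inr l) (inr j) (inl ν) = 1 / 2 * (c ν l j + c ν j l))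
    (φ : s → ℂ) (ψ : t → ℂ) (l : Fin k) :
    ∑ x, ∑ y, (etaP k x * etaP k y * Ω (inr l) x y) •
        ((gammaP γ ρ x * gammaP γ ρ y) *ᵥ tensorHom s t φ ψ) =
      -((1 / 2 : ℝ) • ∑ ν, ∑ σ, (etaM ν * etaM σ * F ν σ l) • tensorHom s t (γ ν *ᵥ γ σ *ᵥ φ) ψ)
      - ∑ ν, ∑ j, (etaM ν * (c ν l j + c ν j l)) •
          tensorHom s t (γ ν *ᵥ gamma5 γ *ᵥ φ) (ρ j *ᵥ ψ)
      + tensorHom s t φ (∑ i, ∑ j, b l i j • (ρ i *ᵥ ρ j *ᵥ ψ)) := by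
  simp only [Fintype.sum_sum_type, ← Matrix.mulVec_mulVec, gammaP_inl_mulVec, gammaP_inr_mulVec,
    gamma5_mulVec_gamma, gamma5_mulVec_gamma5, h1, h2, h3, h4, etaP, elim_inl, elim_inr, etaK,
    one_mul, mul_one, Finset.sum_add_distrib, map_sum, map_smul, 
    map_neg, LinearMap.neg_apply, smul_neg, smul_smul, Finset.smul_sum]
  -- Again the mixed blocks reinforce each other, now doubling the second fundamental form.
  rw [Finset.sum_comm (s := (Finset.univ : Finset (Fin k))) (t := (Finset.univ : Finset (Fin 4)))]
  rw [← add_assoc, add_assoc (∑ _, ∑ _, _), sub_eq_add_neg]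
  congr 2
  · simp only [← Finset.sum_neg_distrib]
    refine Finset.sum_congr rfl fun ν _ => Finset.sum_congr rfl fun j _ => ?_
    rw [← neg_smul]
    congr 1
    ring
  · simp only [← Finset.sum_add_distrib, ← Finset.sum_neg_distrib]
    refine Finset.sum_congr rfl fun ν _ => Finset.sum_congr rfl fun j _ => ?_
    module

/-- The zeroth order part of the Dirac operator of a submersion metric. -/
theorem sum_gamma_spinConnection (h1 : ∀ μ ν σ, Ω (inl μ) (inl ν) (inl σ) = a μ ν σ)
    (h2 : ∀ μ ν j, Ω (inl μ) (inl ν) (inr j) = 1 / 2 * F μ ν j)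
    (h3 : ∀ μ j ν, Ω (inl μ) (inr j) (inl ν) = -(1 / 2) * F μ ν j)
    (h4 : ∀ μ i j, Ω (inl μ) (inr i) (inr j) = 1 / 2 * (c μ i j - c μ j i))
    (h5 : ∀ l i j, Ω (inr l) (inr i) (inr j) = b l i j)
    (h6 : ∀ l ν σ, Ω (inr l) (inl ν) (inl σ) = -(1 / 2) * F ν σ l)
    (h7 : ∀ l ν j, Ω (inr l) (inl ν) (inr j) = -(1 / 2) * (c ν l j + c ν j l))
    (h8 : ∀ l j ν, Ω (inr l) (inr j) (inl ν) = 1 / 2 * (c ν l j + c ν j l))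
    (φ : s → ℂ) (ψ : t → ℂ) :
    ∑ r, etaP k r • (gammaP γ ρ r *ᵥ ((1 / 4 : ℝ) • ∑ x, ∑ y, (etaP k x * etaP k y * Ω r x y) •
        ((gammaP γ ρ x * gammaP γ ρ y) *ᵥ tensorHom s t φ ψ))) =
      tensorHom s t (∑ μ, etaM μ • (γ μ *ᵥ ((1 / 4 : ℝ) •
        ∑ ν, ∑ σ, (etaM ν * etaM σ * a μ ν σ) • (γ ν *ᵥ γ σ *ᵥ φ)))) ψ
      + ∑ μ, etaM μ • tensorHom s t (γ μ *ᵥ φ)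
          ((1 / 8 : ℝ) • ∑ i, ∑ j, (c μ i j - c μ j i) • (ρ i *ᵥ ρ j *ᵥ ψ)
            - (1 / 2 * ∑ i, c μ i i) • ψ)
      + tensorHom s t (gamma5 γ *ᵥ φ)
          (∑ l, (ρ l *ᵥ ((1 / 4 : ℝ) • ∑ i, ∑ j, b l i j • (ρ i *ᵥ ρ j *ᵥ ψ))))
      + (1 / 8 : ℝ) • ∑ μ, ∑ ν, (etaM μ * etaM ν) •
          tensorHom s t (γ μ *ᵥ γ ν *ᵥ gamma5 γ *ᵥ φ) (∑ j, F μ ν j • (ρ j *ᵥ ψ)) := by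
  -- The trace is written back as a full double sum, in the shape produced by the vertical
  -- directions: $\gamma_5\gamma_\mu\gamma_5=-\gamma_\mu$ cancels their minus sign and leaves weight
  -- $\frac14$.
  have hc : ∀ μ : Fin 4, tensorHom s t (γ μ *ᵥ φ) ((1 / 2 * ∑ i, c μ i i) • ψ) =
      -((1 / 4 : ℝ) • ∑ l, ∑ j, (c μ l j + c μ j l) •
        tensorHom s t (γ μ *ᵥ φ) (ρ l *ᵥ ρ j *ᵥ ψ)) := by
    intro μ
    have := congrArg (tensorHom s t (γ μ *ᵥ φ)) (sum_symm_gamma ρ (c μ) ψ)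
    simp only [map_sum, map_smul] at this
    rw [this, map_smul, smul_smul, ← neg_smul]
    congr 1
    ring
  rw [Fintype.sum_sum_type]
  simp only [spinConnection_inl γ ρ h1 h2 h3 h4, spinConnection_inr γ ρ h5 h6 h7 h8, map_sub, hc]
  simp only [etaP, elim_inl, elim_inr, etaK, Matrix.mulVec_smul, Matrix.mulVec_add,
    Matrix.mulVec_sub, Matrix.mulVec_neg, Matrix.mulVec_sum, gammaP_inl_mulVec, gammaP_inr_mulVec,
    gamma5_mulVec_gamma, gamma5_mulVec_gamma5, map_sum, map_smul, map_neg, LinearMap.neg_apply,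
    LinearMap.sum_apply, LinearMap.smul_apply, smul_add, smul_sub, smul_neg, neg_neg, sub_neg_eq_add,
    Finset.sum_add_distrib, Finset.sum_neg_distrib, Finset.smul_sum,
    smul_smul]
  rw [← Finset.sum_comm_cycle (f := fun μ ν l =>
      (1 * (1 / 4 * (1 / 2 * (etaM μ * etaM ν * F μ ν l)))) •
        tensorHom s t (γ μ *ᵥ γ ν *ᵥ gamma5 γ *ᵥ φ) (ρ l *ᵥ ψ)),
    Finset.sum_comm (f := fun l μ => ∑ j, (1 * (1 / 4 * (etaM μ * (c μ l j + c μ j l)))) •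
        tensorHom s t (γ μ *ᵥ φ) (ρ l *ᵥ ρ j *ᵥ ψ))]
  -- Here $\frac18=\frac14-\frac18$: the first term comes from differentiating along
  -- $X_\mu^{\mathcal H}$, the second from differentiating along the $v_l$.
  have eF : ∑ μ, ∑ ν, ∑ j, (1 / 8 * (etaM μ * etaM ν * F μ ν j)) •
        tensorHom s t (γ μ *ᵥ γ ν *ᵥ gamma5 γ *ᵥ φ) (ρ j *ᵥ ψ) =
      ∑ μ, ∑ ν, ∑ j, (etaM μ * (1 / 4 * (etaM ν * F μ ν j))) •
        tensorHom s t (γ μ *ᵥ γ ν *ᵥ gamma5 γ *ᵥ φ) (ρ j *ᵥ ψ) -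
      ∑ μ, ∑ ν, ∑ j, (1 * (1 / 4 * (1 / 2 * (etaM μ * etaM ν * F μ ν j)))) •
        tensorHom s t (γ μ *ᵥ γ ν *ᵥ gamma5 γ *ᵥ φ) (ρ j *ᵥ ψ) := by
    simp only [← Finset.sum_sub_distrib]
    refine Finset.sum_congr rfl fun _ _ => Finset.sum_congr rfl fun _ _ =>
      Finset.sum_congr rfl fun _ _ => ?_
    module
  have eA : ∑ μ, ∑ i, ∑ j, (etaM μ * (1 / 8 * (c μ i j - c μ j i))) •
        tensorHom s t (γ μ *ᵥ φ) (ρ i *ᵥ ρ j *ᵥ ψ) =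
      ∑ μ, ∑ i, ∑ j, (etaM μ * (1 / 4 * (1 / 2 * (c μ i j - c μ j i)))) •
        tensorHom s t (γ μ *ᵥ φ) (ρ i *ᵥ ρ j *ᵥ ψ) := by
    refine Finset.sum_congr rfl fun _ _ => Finset.sum_congr rfl fun _ _ =>
      Finset.sum_congr rfl fun _ _ => ?_
    module
  have eS : ∑ μ, ∑ i, ∑ j, (etaM μ * (1 / 4 * (c μ i j + c μ j i))) •
        tensorHom s t (γ μ *ᵥ φ) (ρ i *ᵥ ρ j *ᵥ ψ) =
      ∑ μ, ∑ i, ∑ j, (1 * (1 / 4 * (etaM μ * (c μ i j + c μ j i)))) •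
        tensorHom s t (γ μ *ᵥ φ) (ρ i *ᵥ ρ j *ᵥ ψ) := by
    refine Finset.sum_congr rfl fun _ _ => Finset.sum_congr rfl fun _ _ =>
      Finset.sum_congr rfl fun _ _ => ?_
    module
  rw [eF, eA, eS]
  simp only [one_mul]
  abel

end Clifford

end KaluzaKlein
end

noncomputable section

namespace KaluzaKlein

open VectorField Set Filter Topology SubmersionMetric

/-! ### The decomposition of the Dirac operator -/

section Decomposition

variable {k : ℕ}
variable {M : Type*} [TopologicalSpace M] [ChartedSpace (EuclideanSpace ℝ (Fin 4)) M]
  [IsManifold (𝓡 4) ∞ M]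
variable {K : Type*} [TopologicalSpace K] [ChartedSpace (EuclideanSpace ℝ (Fin k)) K]
  [IsManifold (𝓡 k) ∞ K]
variable {G : SubmersionMetric k M K} {X : Fin 4 → Π x : M, TangentSpace (𝓡 4) x}
variable {v : Fin k → Π p : M × K, TangentSpace (𝓡 k) p.2} {p : M × K}
variable {s : Type*} [Fintype s] [DecidableEq s] {t : Type*} [Fintype t] [DecidableEq t]
variable {φ : M → s → ℂ} {ψ : M × K → t → ℂ}

/-- Leibniz rule for the bounded bilinear map `tensorHom`; the first factor is pulled back from `M`
and sees only the base component of the direction. -/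
lemma mvfderiv_tensor (hφ : MDifferentiableAt (𝓡 4) 𝓘(ℝ, s → ℂ) φ p.1)
    (hψ : MDifferentiableAt ((𝓡 4).prod (𝓡 k)) 𝓘(ℝ, t → ℂ) ψ p)
    (w : TangentSpace ((𝓡 4).prod (𝓡 k)) p) :
    mvfderiv ((𝓡 4).prod (𝓡 k)) (fun q => tensor (φ q.1) (ψ q)) p w =
      tensorHom s t (mvfderiv (𝓡 4) φ p.1 (compM w)) (ψ p) +
        tensorHom s t (φ p.1) (mvfderiv ((𝓡 4).prod (𝓡 k)) ψ p w) := by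
  have hφ' : MDifferentiableAt ((𝓡 4).prod (𝓡 k)) 𝓘(ℝ, s → ℂ) (fun q : M × K => φ q.1) p :=
    MDifferentiableAt.comp (I' := 𝓡 4) p hφ mdifferentiableAt_fst
  have hpair := hφ'.prodMk_space hψ
  have hB := (tensorHom s t).toContinuousBilinearMap.isBoundedBilinearMap
  have e1 := mvfderiv_fderiv_comp_apply (F := (s → ℂ) × (t → ℂ))
    (g := fun z : (s → ℂ) × (t → ℂ) => tensor z.1 z.2) (f := fun q : M × K => (φ q.1, ψ q)) p
    (hB.differentiableAt (φ p.1, ψ p)) hpair w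
  have e2 : fderiv ℝ (fun z : (s → ℂ) × (t → ℂ) => tensor z.1 z.2) (φ p.1, ψ p) =
      hB.deriv (φ p.1, ψ p) := hB.fderiv (φ p.1, ψ p)
  have e3 : (mvfderiv ((𝓡 4).prod (𝓡 k)) (fun q : M × K => (φ q.1, ψ q)) p w).1 =
      mvfderiv (𝓡 4) φ p.1 (compM w) :=
    (mvfderiv_clm_comp (ContinuousLinearMap.fst ℝ _ _) hpair w).symm.trans
      (mvfderiv_comp_fst (I' := 𝓡 k) hφ w)
  have e4 : (mvfderiv ((𝓡 4).prod (𝓡 k)) (fun q : M × K => (φ q.1, ψ q)) p w).2 =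
      mvfderiv ((𝓡 4).prod (𝓡 k)) ψ p w :=
    (mvfderiv_clm_comp (ContinuousLinearMap.snd ℝ _ _) hpair w).symm
  refine e1.trans ?_
  rw [e2, ← e3, ← e4, add_comm]
  rfl

lemma mvfderiv_mkP (hψ : MDifferentiableAt ((𝓡 4).prod (𝓡 k)) 𝓘(ℝ, t → ℂ) ψ p)
    (Y : TangentSpace (𝓡 4) p.1) (V : TangentSpace (𝓡 k) p.2) :
    mvfderiv ((𝓡 4).prod (𝓡 k)) ψ p (mkP Y V) =
      mvfderiv ((𝓡 4).prod (𝓡 k)) ψ p (mkP Y 0) +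
        mvfderiv (𝓡 k) (fun y => ψ (p.1, y)) p.2 V := by
  rw [mvfderiv_prod_apply hψ (mkP Y V), mvfderiv_prod_apply hψ (mkP Y 0)]
  have h0 : mvfderiv (𝓡 k) (fun y => ψ (p.1, y)) p.2 (mkP Y (0 : TangentSpace (𝓡 k) p.2)).2 = 0 :=
    map_zero _
  rw [h0, add_zero]
  rfl

lemma mvfderiv_vert (hψ : MDifferentiableAt ((𝓡 4).prod (𝓡 k)) 𝓘(ℝ, t → ℂ) ψ p)
    (V : TangentSpace (𝓡 k) p.2) :
    mvfderiv ((𝓡 4).prod (𝓡 k)) ψ p (mkP 0 V) =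
        mvfderiv (𝓡 k) (fun y => ψ (p.1, y)) p.2 V := by
  rw [mvfderiv_mkP hψ]
  have h0 : mvfderiv ((𝓡 4).prod (𝓡 k)) ψ p (mkP 0 0) = 0 := map_zero _
  rw [h0, zero_add]

variable (γ : GammaMatrices etaM s) (ρ : GammaMatrices (etaK k) t)

/-- The components `g_K(∂_{X_μ} v_i, v_j)` of the derivative of the vertical frame along the base. -/
def baseComp (G : SubmersionMetric k M K) (X : Fin 4 → Π x : M, TangentSpace (𝓡 4) x)
    (v : Fin k → Π p : M × K, TangentSpace (𝓡 k) p.2) (p : M × K) (μ : Fin 4) (i j : Fin k) : ℝ :=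
  G.gK p (baseDeriv (fun x => v i (x, p.2)) p.1 (X μ p.1)) (v j p)

/-- Separates variation with the base point from variation along the fibre: the former feeds the
volume and bracket terms, the latter the gauge coupling. -/
lemma mixComp_eq (μ : Fin 4) (i j : Fin k) : mixComp G X v p μ i j =
    baseComp G X v p μ i j + fibreBracketComp G v (G.gauge (X μ) p.1) p i j := by
  simp only [mixComp, vertBracket, map_add, add_apply]
  rfl

/-- The fields `X μ` are not lifted here, so the brackets contain no gauge part. -/
lemma bracketTerm_eq (h : IsAdaptedAt G X v p) :
    bracketTerm G X v γ ρ φ ψ p = ∑ μ, etaM μ • tensorHom s t (γ μ *ᵥ φ p.1)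
      ((1 / 8 : ℝ) • ∑ i, ∑ j, (baseComp G X v p μ i j - baseComp G X v p μ j i) •
        (ρ i *ᵥ ρ j *ᵥ ψ p)) := by
  have e : ∀ μ i j, G.gP p (mlieBracket ((𝓡 4).prod (𝓡 k)) (baseField (X μ)) (vlift (v i)) p)
      (vlift (v j) p) = baseComp G X v p μ i j := fun μ i j =>
    (congrArg (fun w => G.gP p w (vlift (v j) p))
      (mlieBracket_baseField_vlift (h.diff_base μ) (h.diff_vert i))).trans (gP_vert_vert G p _ _)
  simp only [bracketTerm, e]
  rfl

lemma volumeTerm_eq (h : IsAdaptedAt G X v p)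
    {c : OpenPartialHomeomorph K (EuclideanSpace ℝ (Fin k))}
    (hc : c ∈ IsManifold.maximalAtlas (𝓡 k) ∞ K) (hp : p.2 ∈ c.source) :
    volumeTerm G X γ φ ψ c p = ∑ μ, etaM μ • tensorHom s t (γ μ *ᵥ φ p.1)
      (mvfderiv ((𝓡 4).prod (𝓡 k)) ψ p (baseField (X μ) p)
        - (1 / 2 * ∑ i, baseComp G X v p μ i i) • ψ p) := by
  simp only [volumeTerm, mvfderiv_log_sqrt_det h hc hp, mul_neg, neg_smul, ← sub_eq_add_neg]
  rfl

lemma gaugeTerm_eq (h : IsAdaptedAt G X v p) :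
    gaugeTerm G X v γ ρ φ ψ p = ∑ μ, etaM μ • tensorHom s t (γ μ *ᵥ φ p.1)
      (mvfderiv (𝓡 k) (fun y => ψ (p.1, y)) p.2 (G.A p (X μ p.1))
        + (1 / 8 : ℝ) • ∑ i, ∑ j, (fibreBracketComp G v (G.gauge (X μ) p.1) p i j
          - fibreBracketComp G v (G.gauge (X μ) p.1) p j i) • (ρ i *ᵥ ρ j *ᵥ ψ p)
        - (1 / 2 * ∑ i, fibreBracketComp G v (G.gauge (X μ) p.1) p i i) • ψ p) := by
  simp only [gaugeTerm, couplingOp_eq h, ← Matrix.mulVec_mulVec]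
  rfl

/-- The Dirac operator of a submersion metric on a tensor product, with the derivatives along the
base collected in `mixComp`. -/
theorem diracOp_tensor (h : IsAdaptedAt G X v p)
    (hφ : MDifferentiableAt (𝓡 4) 𝓘(ℝ, s → ℂ) φ p.1)
    (hψ : MDifferentiableAt ((𝓡 4).prod (𝓡 k)) 𝓘(ℝ, t → ℂ) ψ p) :
    diracOp ((𝓡 4).prod (𝓡 k)) G.gP (adaptedFrame G X v) (gammaP γ ρ)
        (fun q => tensor (φ q.1) (ψ q)) p =
      baseTerm G X γ φ ψ p
      + ∑ μ, etaM μ • tensorHom s t (γ μ *ᵥ φ p.1)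
          (mvfderiv ((𝓡 4).prod (𝓡 k)) ψ p (baseField (X μ) p)
            + mvfderiv (𝓡 k) (fun y => ψ (p.1, y)) p.2 (G.A p (X μ p.1))
            + ((1 / 8 : ℝ) • ∑ i, ∑ j, (mixComp G X v p μ i j - mixComp G X v p μ j i) •
                (ρ i *ᵥ ρ j *ᵥ ψ p) - (1 / 2 * ∑ i, mixComp G X v p μ i i) • ψ p))
      + internalTerm G v γ ρ φ ψ p
      + pauliTerm G v γ ρ φ ψ p (fun μ ν => G.curvature (X μ) (X ν) p) := by
  have hΩ := sum_gamma_spinConnection γ ρ (connP_hhh h) (connP_hhv h)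
    (fun μ j ν => connP_hvh h μ ν j) (connP_hvv h) (connP_vvv h)
    (fun l ν σ => connP_vhh h ν σ l) (fun l ν j => connP_vhv h ν l j)
    (fun l j ν => connP_vvh h ν l j) (φ p.1) (ψ p)
  -- The derivative terms: the splitting $X^{\mathcal H}=X+A(X)$ divides the derivative of $\psi$
  -- between the volume term and the gauge term, and the vertical directions supply the symbol of
  -- the fibre Dirac operator.
  have hd : ∑ r, etaP k r • (gammaP γ ρ r *ᵥ mvfderiv ((𝓡 4).prod (𝓡 k))
        (fun q => tensor (φ q.1) (ψ q)) p (adaptedFrame G X v r p)) =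
      tensorHom s t (∑ μ, etaM μ • (γ μ *ᵥ mvfderiv (𝓡 4) φ p.1 (X μ p.1))) (ψ p)
      + ∑ μ, etaM μ • tensorHom s t (γ μ *ᵥ φ p.1)
          (mvfderiv ((𝓡 4).prod (𝓡 k)) ψ p (baseField (X μ) p)
            + mvfderiv (𝓡 k) (fun y => ψ (p.1, y)) p.2 (G.A p (X μ p.1)))
      + tensorHom s t (gamma5 γ *ᵥ φ p.1)
          (∑ l, ρ l *ᵥ mvfderiv (𝓡 k) (fun y => ψ (p.1, y)) p.2 (v l p)) := by
    have eh : ∀ μ, mvfderiv ((𝓡 4).prod (𝓡 k)) (fun q => tensor (φ q.1) (ψ q)) p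
        (adaptedFrame G X v (Sum.inl μ) p) =
        tensorHom s t (mvfderiv (𝓡 4) φ p.1 (X μ p.1)) (ψ p) + tensorHom s t (φ p.1)
          (mvfderiv ((𝓡 4).prod (𝓡 k)) ψ p (baseField (X μ) p)
            + mvfderiv (𝓡 k) (fun y => ψ (p.1, y)) p.2 (G.A p (X μ p.1))) := fun μ =>
      (mvfderiv_tensor hφ hψ _).trans (congrArg (fun z => _ + tensorHom s t (φ p.1) z)
        (mvfderiv_mkP hψ _ _))
    have ev : ∀ j, mvfderiv ((𝓡 4).prod (𝓡 k)) (fun q => tensor (φ q.1) (ψ q)) p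
        (adaptedFrame G X v (Sum.inr j) p) = tensorHom s t (φ p.1)
          (mvfderiv (𝓡 k) (fun y => ψ (p.1, y)) p.2 (v j p)) := by
      intro j
      refine (mvfderiv_tensor hφ hψ _).trans ?_
      have h0 : mvfderiv (𝓡 4) φ p.1 (compM (adaptedFrame G X v (Sum.inr j) p)) = 0 := map_zero _
      rw [h0, map_zero, LinearMap.zero_apply, zero_add]
      exact congrArg (tensorHom s t (φ p.1)) (mvfderiv_vert hψ _)
    rw [Fintype.sum_sum_type]
    simp only [eh, ev, Matrix.mulVec_add, gammaP_inl_mulVec, gammaP_inr_mulVec, smul_add,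
      Finset.sum_add_distrib, map_sum, map_smul, LinearMap.sum_apply, LinearMap.smul_apply,
      etaP, Sum.elim_inl, Sum.elim_inr, etaK, one_smul]
  have hsplit : diracOp ((𝓡 4).prod (𝓡 k)) G.gP (adaptedFrame G X v) (gammaP γ ρ)
        (fun q => tensor (φ q.1) (ψ q)) p =
      ∑ r, etaP k r • (gammaP γ ρ r *ᵥ mvfderiv ((𝓡 4).prod (𝓡 k))
        (fun q => tensor (φ q.1) (ψ q)) p (adaptedFrame G X v r p)) +
      ∑ r, etaP k r • (gammaP γ ρ r *ᵥ ((1 / 4 : ℝ) • ∑ x, ∑ y,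
        (etaP k x * etaP k y * connP G X v p r x y) •
          ((gammaP γ ρ x * gammaP γ ρ y) *ᵥ tensorHom s t (φ p.1) (ψ p)))) := by
    simp only [diracOp, spinDeriv, Matrix.mulVec_add, smul_add, Finset.sum_add_distrib]
    rfl
  have hbase : baseTerm G X γ φ ψ p =
      tensorHom s t (∑ μ, etaM μ • (γ μ *ᵥ mvfderiv (𝓡 4) φ p.1 (X μ p.1))) (ψ p)
      + tensorHom s t (∑ μ, etaM μ • (γ μ *ᵥ ((1 / 4 : ℝ) •
        ∑ ν, ∑ σ, (etaM ν * etaM σ * leviCivita (𝓡 4) (fun x a b => G.gM x a b) (X μ) (X ν) (X σ)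
          p.1) • (γ ν *ᵥ γ σ *ᵥ φ p.1)))) (ψ p) := by
    simp only [baseTerm, spinDeriv, Matrix.mulVec_add, smul_add, Finset.sum_add_distrib,
      ← Matrix.mulVec_mulVec, tensor_eq_tensorHom, map_add, LinearMap.add_apply]
  have hinternal : internalTerm G v γ ρ φ ψ p =
      tensorHom s t (gamma5 γ *ᵥ φ p.1)
          (∑ l, ρ l *ᵥ mvfderiv (𝓡 k) (fun y => ψ (p.1, y)) p.2 (v l p))
      + tensorHom s t (gamma5 γ *ᵥ φ p.1)
          (∑ l, (ρ l *ᵥ ((1 / 4 : ℝ) • ∑ i, ∑ j, leviCivita (𝓡 k) (G.fibre p.1)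
            (fibreFrame v p.1 l) (fibreFrame v p.1 i) (fibreFrame v p.1 j) p.2 •
              (ρ i *ᵥ ρ j *ᵥ ψ p)))) := by
    simp only [internalTerm, diracOp, spinDeriv, Matrix.mulVec_add, smul_add,
      Finset.sum_add_distrib, ← Matrix.mulVec_mulVec, tensor_eq_tensorHom, map_add, etaK, one_mul,
      one_smul]
    rfl
  have hpauli : pauliTerm G v γ ρ φ ψ p (fun μ ν => G.curvature (X μ) (X ν) p) =
      (1 / 8 : ℝ) • ∑ μ, ∑ ν, (etaM μ * etaM ν) •
        tensorHom s t (γ μ *ᵥ γ ν *ᵥ gamma5 γ *ᵥ φ p.1)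
          (∑ j, curvComp G X v p μ ν j • (ρ j *ᵥ ψ p)) := rfl
  rw [hsplit, hd, hΩ, hbase, hinternal, hpauli]
  simp only [map_add, smul_add, Finset.sum_add_distrib]
  abel

/-- The decomposition of the Dirac operator. -/
theorem diracOp_decomposition (h : IsAdaptedAt G X v p)
    (hφ : MDifferentiableAt (𝓡 4) 𝓘(ℝ, s → ℂ) φ p.1)
    (hψ : MDifferentiableAt ((𝓡 4).prod (𝓡 k)) 𝓘(ℝ, t → ℂ) ψ p)
    {c : OpenPartialHomeomorph K (EuclideanSpace ℝ (Fin k))}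
    (hc : c ∈ IsManifold.maximalAtlas (𝓡 k) ∞ K) (hp : p.2 ∈ c.source) :
    diracOp ((𝓡 4).prod (𝓡 k)) G.gP (adaptedFrame G X v) (gammaP γ ρ)
        (fun q => tensor (φ q.1) (ψ q)) p =
      baseTerm G X γ φ ψ p + gaugeTerm G X v γ ρ φ ψ p + internalTerm G v γ ρ φ ψ p
      + pauliTerm G v γ ρ φ ψ p (fun μ ν => G.curvature (X μ) (X ν) p)
      + volumeTerm G X γ φ ψ c p + bracketTerm G X v γ ρ φ ψ p := by
  have hmix : ∑ μ, etaM μ • tensorHom s t (γ μ *ᵥ φ p.1)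
          (mvfderiv ((𝓡 4).prod (𝓡 k)) ψ p (baseField (X μ) p)
            + mvfderiv (𝓡 k) (fun y => ψ (p.1, y)) p.2 (G.A p (X μ p.1))
            + ((1 / 8 : ℝ) • ∑ i, ∑ j, (mixComp G X v p μ i j - mixComp G X v p μ j i) •
                (ρ i *ᵥ ρ j *ᵥ ψ p) - (1 / 2 * ∑ i, mixComp G X v p μ i i) • ψ p)) =
      gaugeTerm G X v γ ρ φ ψ p + volumeTerm G X γ φ ψ c p + bracketTerm G X v γ ρ φ ψ p := by
    rw [gaugeTerm_eq γ ρ h, volumeTerm_eq γ h hc hp, bracketTerm_eq γ ρ h,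
      ← Finset.sum_add_distrib, ← Finset.sum_add_distrib]
    refine Finset.sum_congr rfl fun μ _ => ?_
    rw [← smul_add, ← smul_add, ← map_add, ← map_add]
    congr 2
    -- Both the antisymmetrization and the trace are linear in `mixComp`, so each splits into its
    -- base and fibre parts.
    simp only [mixComp_eq, Finset.sum_add_distrib, add_sub_add_comm, add_smul, mul_add, smul_add]
    abel
  rw [diracOp_tensor γ ρ h hφ hψ, hmix]
  abel

end Decomposition

end KaluzaKlein
end

noncomputable section

namespace KaluzaKlein

open VectorField Set Filter Topology SubmersionMetric

/-! ### Expansion of the gauge field in vector fields on the fibre -/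

section Expansion

variable {k : ℕ}
variable {M : Type*} [TopologicalSpace M] [ChartedSpace (EuclideanSpace ℝ (Fin 4)) M]
  [IsManifold (𝓡 4) ∞ M]
variable {K : Type*} [TopologicalSpace K] [ChartedSpace (EuclideanSpace ℝ (Fin k)) K]
  [IsManifold (𝓡 k) ∞ K]
variable {G : SubmersionMetric k M K} {X : Fin 4 → Π x : M, TangentSpace (𝓡 4) x}
variable {v : Fin k → Π p : M × K, TangentSpace (𝓡 k) p.2} {p : M × K}
variable {s : Type*} [Fintype s] [DecidableEq s] {t : Type*} [Fintype t] [DecidableEq t]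
variable {φ : M → s → ℂ} {ψ : M × K → t → ℂ}
variable {τ : Type*} {e : τ → Π y : K, TangentSpace (𝓡 k) y}

/-- Over a fixed point of `M` the coefficients $A^a(X)$ are constants. Differentiability of the
partial sums is proved alongside, since additivity of the bracket requires it in the induction. -/
lemma mlieBracket_sum_smul_left {y : K} (he : ∀ a, FieldDiffAt (e a) y) (c : τ → ℝ)
    (W : Π y : K, TangentSpace (𝓡 k) y) (T : Finset τ) :
    FieldDiffAt (fun y => ∑ a ∈ T, c a • e a y) y ∧
    mlieBracket (𝓡 k) (fun y => ∑ a ∈ T, c a • e a y) W y =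
      ∑ a ∈ T, c a • mlieBracket (𝓡 k) (e a) W y := by
  classical
  induction T using Finset.induction_on with
  | empty =>
    refine ⟨?_, ?_⟩
    · exact (Bundle.contMDiff_zeroSection ℝ (TangentSpace (𝓡 k) : K → Type _)).mdifferentiable
        (n := ∞) (by simp) y
    · exact congrFun (mlieBracket_zero_left (I := 𝓡 k) (W := W)) y
  | insert a T ha ih =>
    have h1 : FieldDiffAt (c a • e a) y := MDifferentiableAt.smul_const_section (he a)
    have hs : (fun y => ∑ b ∈ insert a T, c b • e b y) =
        c a • e a + fun y => ∑ b ∈ T, c b • e b y := by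
      funext y
      rw [Finset.sum_insert ha]
      rfl
    rw [hs, Finset.sum_insert ha]
    refine ⟨mdifferentiableAt_add_section h1 ih.1, ?_⟩
    rw [mlieBracket_add_left h1 ih.1, mlieBracket_const_smul_left (he a), ih.2]

lemma mlieBracket_sum_smul_right {y : K} (he : ∀ a, FieldDiffAt (e a) y) (c : τ → ℝ)
    (W : Π y : K, TangentSpace (𝓡 k) y) (T : Finset τ) :
    mlieBracket (𝓡 k) W (fun y => ∑ a ∈ T, c a • e a y) y =
      ∑ a ∈ T, c a • mlieBracket (𝓡 k) W (e a) y := by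
  rw [mlieBracket_swap_apply, (mlieBracket_sum_smul_left he c W T).2, ← Finset.sum_neg_distrib]
  refine Finset.sum_congr rfl fun a _ => ?_
  rw [mlieBracket_swap_apply (V := W) (W := e a), smul_neg]

variable [Fintype τ] {Ac : τ → Π x : M, TangentSpace (𝓡 4) x →L[ℝ] ℝ}

lemma fibreBracketComp_sum (he : ∀ a, FieldDiffAt (e a) p.2) (c : τ → ℝ) (i j : Fin k) :
    fibreBracketComp G v (fun y => ∑ a, c a • e a y) p i j =
      ∑ a, c a * fibreBracketComp G v (e a) p i j := by
  simp only [fibreBracketComp]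
  rw [(mlieBracket_sum_smul_left he c _ _).2]
  simp only [map_sum, map_smul, sum_apply, smul_apply, smul_eq_mul]

/-- By `couplingOp_eq` the operator sees the field only through its value at the point and its
brackets with the frame, and both are linear. -/
lemma couplingOp_sum (h : IsAdaptedAt G X v p) (ρ : GammaMatrices (etaK k) t)
    (he : ∀ a, FieldDiffAt (e a) p.2) (c : τ → ℝ) :
    couplingOp G v ρ ψ (fun y => ∑ a, c a • e a y) p = ∑ a, c a • couplingOp G v ρ ψ (e a) p := by
  have hd : mvfderiv (𝓡 k) (fun y => ψ (p.1, y)) p.2 (∑ a, c a • e a p.2) =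
      ∑ a, c a • mvfderiv (𝓡 k) (fun y => ψ (p.1, y)) p.2 (e a p.2) := by
    simp only [map_sum, map_smul]
  have hq : ∑ i, ∑ j, (∑ a, c a * fibreBracketComp G v (e a) p i j
      - ∑ a, c a * fibreBracketComp G v (e a) p j i) • ((ρ i * ρ j) *ᵥ ψ p) =
      ∑ a, c a • ∑ i, ∑ j, (fibreBracketComp G v (e a) p i j
        - fibreBracketComp G v (e a) p j i) • ((ρ i * ρ j) *ᵥ ψ p) := by
    simp only [← Finset.sum_sub_distrib, ← mul_sub, Finset.sum_smul, Finset.smul_sum, smul_smul]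
    rw [Finset.sum_comm_cycle]
  have ht : ∑ i, ∑ a, c a * fibreBracketComp G v (e a) p i i =
      ∑ a, c a * ∑ i, fibreBracketComp G v (e a) p i i := by
    rw [Finset.sum_comm]
    simp only [Finset.mul_sum]
  simp only [couplingOp_eq h, fibreBracketComp_sum he]
  rw [hd, hq, ht, Finset.smul_sum, Finset.mul_sum, Finset.sum_smul, ← Finset.sum_add_distrib,
    ← Finset.sum_sub_distrib]
  refine Finset.sum_congr rfl fun a _ => ?_
  module

lemma IsExpansion.fieldDiffAt (hA : IsExpansion G Ac e) (a : τ) (y : K) : FieldDiffAt (e a) y :=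
  (hA.smooth_field a).mdifferentiable (by simp) y

lemma IsExpansion.gauge_eq (hA : IsExpansion G Ac e) (Y : Π x : M, TangentSpace (𝓡 4) x) (x : M) :
    G.gauge Y x = fun y => ∑ a, Ac a x (Y x) • e a y :=
  funext fun y => hA.eq_sum (x, y) (Y x)

lemma gaugeTerm_eq_expanded (h : IsAdaptedAt G X v p) (hA : IsExpansion G Ac e)
    (γ : GammaMatrices etaM s) (ρ : GammaMatrices (etaK k) t) :
    gaugeTerm G X v γ ρ φ ψ p = gaugeTermExpanded G X v γ ρ φ ψ Ac e p := by
  simp only [gaugeTerm, gaugeTermExpanded, hA.gauge_eq, tensor_eq_tensorHom,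
    couplingOp_sum h ρ (fun a => hA.fieldDiffAt a p.2), map_sum, map_smul, Finset.smul_sum,
    smul_smul]

lemma IsExpansion.mdifferentiableAt_form (hA : IsExpansion G Ac e)
    {Y : Π x : M, TangentSpace (𝓡 4) x} {x : M} (hY : FieldDiffAt Y x) (a : τ) :
    MDifferentiableAt (𝓡 4) 𝓘(ℝ, ℝ) (fun z => Ac a z (Y z)) x :=
  MDifferentiableAt.comp (I' := (𝓡 4).tangent) x
    ((hA.smooth_form a).mdifferentiable (by simp) (⟨x, Y x⟩ : TangentBundle (𝓡 4) M)) hY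

lemma IsExpansion.baseDeriv_gauge (hA : IsExpansion G Ac e)
    {Y : Π x : M, TangentSpace (𝓡 4) x} (hY : FieldDiffAt Y p.1) (w : TangentSpace (𝓡 4) p.1) :
    baseDeriv (fun x => G.gauge Y x p.2) p.1 w =
      ∑ a, mvfderiv (𝓡 4) (fun z => Ac a z (Y z)) p.1 w • e a p.2 := by
  -- For fixed `y` the vectors `e a y` are constant, so the gauge field is a fixed linear map
  -- applied to the scalar functions $A^a(Y)$.
  let L : (τ → ℝ) →L[ℝ] EuclideanSpace ℝ (Fin k) :=
    ∑ a, (ContinuousLinearMap.proj (R := ℝ) (φ := fun _ : τ => ℝ) a).smulRight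
      (show EuclideanSpace ℝ (Fin k) from e a p.2)
  have hL : ∀ z, L z = ∑ a, z a • (show EuclideanSpace ℝ (Fin k) from e a p.2) := by
    intro z
    refine (sum_apply _ _ _).trans ?_
    rfl
  have hd : MDifferentiableAt (𝓡 4) 𝓘(ℝ, τ → ℝ) (fun z a => Ac a z (Y z)) p.1 :=
    mdifferentiableAt_pi_space fun a => hA.mdifferentiableAt_form hY a
  have e1 : (fun x => G.gauge Y x p.2) = fun x => L (fun a => Ac a x (Y x)) := by
    funext x
    rw [hL]
    exact congrFun (hA.gauge_eq Y x) p.2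
  have e2 : baseDeriv (fun x => G.gauge Y x p.2) p.1 w =
      mvfderiv (𝓡 4) (fun x => L (fun a => Ac a x (Y x))) p.1 w :=
    congrArg (fun f : M → EuclideanSpace ℝ (Fin k) => mvfderiv (𝓡 4) f p.1 w) e1
  rw [e2, mvfderiv_clm_comp L hd, hL]
  refine Finset.sum_congr rfl fun a _ => ?_
  rw [mvfderiv_pi_apply hd]
  rfl

/-- The `e a` do not depend on `x`, so the derivatives along `M` fall on the forms alone; together
with $A([Y,Z])$ they assemble into $dA^a$. The bracket is expanded bilinearly on the fibre. -/
lemma curvature_eq_expanded (hA : IsExpansion G Ac e) {Y Z : Π x : M, TangentSpace (𝓡 4) x}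
    (hY : FieldDiffAt Y p.1) (hZ : FieldDiffAt Z p.1) :
    G.curvature Y Z p = curvatureExpanded Ac e Y Z p := by
  have hb : mlieBracket (𝓡 k) (G.gauge Y p.1) (G.gauge Z p.1) p.2 =
      ∑ a, ∑ b, (Ac a p.1 (Y p.1) * Ac b p.1 (Z p.1)) • mlieBracket (𝓡 k) (e a) (e b) p.2 := by
    rw [hA.gauge_eq, hA.gauge_eq,
      (mlieBracket_sum_smul_left (fun a => hA.fieldDiffAt a p.2) _ _ _).2]
    refine Finset.sum_congr rfl fun a _ => ?_
    rw [mlieBracket_sum_smul_right (fun a => hA.fieldDiffAt a p.2), Finset.smul_sum]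
    simp only [smul_smul]
  rw [SubmersionMetric.curvature, curvatureExpanded, hb, hA.baseDeriv_gauge hY,
    hA.baseDeriv_gauge hZ, hA.eq_sum]
  simp only [extDeriv1, sub_smul, Finset.sum_sub_distrib]

lemma pauliTerm_eq_expanded (h : IsAdaptedAt G X v p) (hA : IsExpansion G Ac e)
    (γ : GammaMatrices etaM s) (ρ : GammaMatrices (etaK k) t) :
    pauliTerm G v γ ρ φ ψ p (fun μ ν => G.curvature (X μ) (X ν) p) =
      pauliTerm G v γ ρ φ ψ p (fun μ ν => curvatureExpanded Ac e (X μ) (X ν) p) := by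
  congr 1
  funext μ ν
  exact curvature_eq_expanded hA (h.diff_base μ) (h.diff_base ν)

end Expansion

/-! ### Vanishing of the last two terms over regions of constancy -/

section Constant

variable {k : ℕ}
variable {M : Type*} [TopologicalSpace M] [ChartedSpace (EuclideanSpace ℝ (Fin 4)) M]
  [IsManifold (𝓡 4) ∞ M]
variable {K : Type*} [TopologicalSpace K] [ChartedSpace (EuclideanSpace ℝ (Fin k)) K]
  [IsManifold (𝓡 k) ∞ K]
variable {G : SubmersionMetric k M K} {X : Fin 4 → Π x : M, TangentSpace (𝓡 4) x}
variable {v : Fin k → Π p : M × K, TangentSpace (𝓡 k) p.2} {p : M × K}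
variable {s : Type*} [Fintype s] [DecidableEq s] {t : Type*} [Fintype t] [DecidableEq t]
variable {φ : M → s → ℂ} {ψ : M × K → t → ℂ}
variable {W : Set (M × K)} {O : Set M}

lemma eventually_mem_constant (hW : IsOpen W) (hO : IsOpen O) (hpW : p ∈ W) (hpO : p.1 ∈ O) :
    ∀ᶠ x in 𝓝 p.1, x ∈ O ∧ (x, p.2) ∈ W :=
  Filter.Eventually.and (hO.mem_nhds hpO) ((tendsto_base p).eventually (hW.mem_nhds hpW))

/-- As `O` and `W` are open, $x\mapsto v_i(x,y)$ equals a fixed vector for all `x` near `p.1`, so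
its derivative is zero. -/
lemma ConstantOver.baseComp_eq_zero (hC : ConstantOver G v ψ W O) (hW : IsOpen W) (hO : IsOpen O)
    (hpW : p ∈ W) (hpO : p.1 ∈ O) (μ : Fin 4) (i j : Fin k) : baseComp G X v p μ i j = 0 := by
  have h0 : baseDeriv (fun x => v i (x, p.2)) p.1 (X μ p.1) = 0 := by
    have hz : mvfderiv (𝓡 4) (F := EuclideanSpace ℝ (Fin k)) (fun x => v i (x, p.2)) p.1 = 0 :=
      mvfderiv_eq_zero_of_eventually_const (c := v i (p.1, p.2))
        ((eventually_mem_constant hW hO hpW hpO).mono fun x hx =>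
          hC.frame x hx.1 p.1 hpO p.2 hx.2 hpW i)
    rw [baseDeriv, hz]
    rfl
  rw [baseComp, h0, map_zero, zero_apply]

lemma ConstantOver.mvfderiv_baseField (hC : ConstantOver G v ψ W O) (hW : IsOpen W)
    (hO : IsOpen O) (hpW : p ∈ W) (hpO : p.1 ∈ O)
    (hψ : MDifferentiableAt ((𝓡 4).prod (𝓡 k)) 𝓘(ℝ, t → ℂ) ψ p)
    (Y : Π x : M, TangentSpace (𝓡 4) x) :
    mvfderiv ((𝓡 4).prod (𝓡 k)) ψ p (baseField Y p) = 0 := by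
  refine (mvfderiv_prod_apply hψ _).trans ?_
  have h0 : mvfderiv (𝓡 k) (fun y => ψ (p.1, y)) p.2 (baseField Y p).2 = 0 := map_zero _
  have hz : mvfderiv (𝓡 4) (fun x => ψ (x, p.2)) p.1 = 0 :=
    mvfderiv_eq_zero_of_eventually_const (c := ψ (p.1, p.2))
      ((eventually_mem_constant hW hO hpW hpO).mono fun x hx =>
        hC.spinor x hx.1 p.1 hpO p.2 hx.2 hpW)
  rw [h0, hz, add_zero]
  rfl

/-- In the form `volumeTerm_eq` the density enters as the trace of `baseComp`, so it vanishes
together with the derivative of $\psi$ along `M`. -/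
lemma ConstantOver.volumeTerm_eq_zero (hC : ConstantOver G v ψ W O) (hW : IsOpen W)
    (hO : IsOpen O) (hpW : p ∈ W) (hpO : p.1 ∈ O) (h : IsAdaptedAt G X v p)
    (hψ : MDifferentiableAt ((𝓡 4).prod (𝓡 k)) 𝓘(ℝ, t → ℂ) ψ p) (γ : GammaMatrices etaM s)
    {c : OpenPartialHomeomorph K (EuclideanSpace ℝ (Fin k))}
    (hc : c ∈ IsManifold.maximalAtlas (𝓡 k) ∞ K) (hp : p.2 ∈ c.source) :
    volumeTerm G X γ φ ψ c p = 0 := by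
  rw [volumeTerm_eq γ h hc hp]
  simp only [hC.baseComp_eq_zero hW hO hpW hpO, hC.mvfderiv_baseField hW hO hpW hpO hψ,
    Finset.sum_const_zero, mul_zero, zero_smul, sub_zero, map_zero, smul_zero]

lemma ConstantOver.bracketTerm_eq_zero (hC : ConstantOver G v ψ W O) (hW : IsOpen W)
    (hO : IsOpen O) (hpW : p ∈ W) (hpO : p.1 ∈ O) (h : IsAdaptedAt G X v p)
    (γ : GammaMatrices etaM s) (ρ : GammaMatrices (etaK k) t) :
    bracketTerm G X v γ ρ φ ψ p = 0 := by
  rw [bracketTerm_eq γ ρ h]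
  simp only [hC.baseComp_eq_zero hW hO hpW hpO, sub_zero, zero_smul, Finset.sum_const_zero,
    map_zero, smul_zero]

/-- The frames of spin structures on `M` and on the vertical bundle are adapted. -/
lemma isAdaptedAt_spinFrame {α β : Type*} (SM : HSpin G α) (SV : VSpin G β) {a : α} {b : β}
    (ha : p.1 ∈ SM.dom a) (hb : p ∈ SV.dom b) : IsAdaptedAt G (SM.frame a) (SV.frame b) p where
  diff_base μ := ((SM.smooth_frame a μ).contMDiffAt
    ((SM.isOpen_dom a).mem_nhds ha)).mdifferentiableAt (by simp)
  diff_vert j := ((SV.smooth_frame b j).contMDiffAt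
    ((SV.isOpen_dom b).mem_nhds hb)).mdifferentiableAt (by simp)
  ortho_base := by
    filter_upwards [(SM.isOpen_dom a).mem_nhds ha] with x hx using SM.orthonormal a x hx
  ortho_vert := by
    filter_upwards [(SV.isOpen_dom b).mem_nhds hb] with q hq using SV.orthonormal b q hq
  spans_vert := SV.spans b p hb

end Constant

end KaluzaKlein
end

/-! ### The main theorem -/

theorem mainTheorem3 {k : ℕ}
    {M : Type*} [TopologicalSpace M] [ChartedSpace (EuclideanSpace ℝ (Fin 4)) M]
    [IsManifold (𝓡 4) ∞ M]
    {K : Type*} [TopologicalSpace K] [ChartedSpace (EuclideanSpace ℝ (Fin k)) K]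
    [IsManifold (𝓡 k) ∞ K]
    (G : SubmersionMetric k M K) {α β : Type*} (SM : HSpin G α) (SV : VSpin G β)
    (γ : GammaMatrices etaM (Fin 4)) (ρ : GammaMatrices (etaK k) (Fin (2 ^ (k / 2))))
    (φ : Spinor SM γ) (ψ : Spinor SV ρ) (a : α) (b : β) (p : M × K)
    (ha : p.1 ∈ SM.dom a) (hb : p ∈ SV.dom b) :
    let X := SM.frame a
    let v := SV.frame b
    let φa := φ.rep a
    let ψb := ψ.rep b
    let DPsi := diracOp ((𝓡 4).prod (𝓡 k)) G.gP ((prodSpin SM SV).frame (a, b)) (gammaP γ ρ)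
      ((basicTensor φ ψ).rep (a, b)) p
    (∀ c ∈ IsManifold.maximalAtlas (𝓡 k) ∞ K, p.2 ∈ c.source →
      DPsi = baseTerm G X γ φa ψb p
        + gaugeTerm G X v γ ρ φa ψb p
        + internalTerm G v γ ρ φa ψb p
        + pauliTerm G v γ ρ φa ψb p (fun μ ν => G.curvature (X μ) (X ν) p)
        + volumeTerm G X γ φa ψb c p
        + bracketTerm G X v γ ρ φa ψb p) ∧
    (∀ (τ : Type) [Fintype τ] (Ac : τ → Π x : M, TangentSpace (𝓡 4) x →L[ℝ] ℝ)
      (e : τ → Π y : K, TangentSpace (𝓡 k) y), IsExpansion G Ac e →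
      ∀ c ∈ IsManifold.maximalAtlas (𝓡 k) ∞ K, p.2 ∈ c.source →
      DPsi = baseTerm G X γ φa ψb p
        + gaugeTermExpanded G X v γ ρ φa ψb Ac e p
        + internalTerm G v γ ρ φa ψb p
        + pauliTerm G v γ ρ φa ψb p (fun μ ν => curvatureExpanded Ac e (X μ) (X ν) p)
        + volumeTerm G X γ φa ψb c p
        + bracketTerm G X v γ ρ φa ψb p) ∧
    (∀ O : Set M, IsOpen O → p.1 ∈ O → ConstantOver G v ψb (SV.dom b) O →
      DPsi = baseTerm G X γ φa ψb p
        + gaugeTerm G X v γ ρ φa ψb p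
        + internalTerm G v γ ρ φa ψb p
        + pauliTerm G v γ ρ φa ψb p (fun μ ν => G.curvature (X μ) (X ν) p) ∧
      ∀ (τ : Type) [Fintype τ] (Ac : τ → Π x : M, TangentSpace (𝓡 4) x →L[ℝ] ℝ)
        (e : τ → Π y : K, TangentSpace (𝓡 k) y), IsExpansion G Ac e →
        DPsi = baseTerm G X γ φa ψb p
          + gaugeTermExpanded G X v γ ρ φa ψb Ac e p
          + internalTerm G v γ ρ φa ψb p
          + pauliTerm G v γ ρ φa ψb p
            (fun μ ν => curvatureExpanded Ac e (X μ) (X ν) p)) := by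
  intro X v φa ψb DPsi
  have h := isAdaptedAt_spinFrame SM SV ha hb
  have hφ : MDifferentiableAt (𝓡 4) 𝓘(ℝ, Fin 4 → ℂ) φa p.1 :=
    ((φ.smooth a).contMDiffAt ((SM.isOpen_dom a).mem_nhds ha)).mdifferentiableAt (by simp)
  have hψ : MDifferentiableAt ((𝓡 4).prod (𝓡 k)) 𝓘(ℝ, Fin (2 ^ (k / 2)) → ℂ) ψb p :=
    ((ψ.smooth b).contMDiffAt ((SV.isOpen_dom b).mem_nhds hb)).mdifferentiableAt (by simp)
  have hD : ∀ c ∈ IsManifold.maximalAtlas (𝓡 k) ∞ K, p.2 ∈ c.source →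
      DPsi = baseTerm G X γ φa ψb p
        + gaugeTerm G X v γ ρ φa ψb p
        + internalTerm G v γ ρ φa ψb p
        + pauliTerm G v γ ρ φa ψb p (fun μ ν => G.curvature (X μ) (X ν) p)
        + volumeTerm G X γ φa ψb c p
        + bracketTerm G X v γ ρ φa ψb p :=
    -- By definition the frame of `prodSpin` is the adapted frame and the representative of
    -- `basicTensor` is the tensor product, so the local decomposition applies verbatim.
    fun c hc hp => diracOp_decomposition γ ρ h hφ hψ hc hp
  refine ⟨hD, ?_, ?_⟩
  · intro τ _ Ac e he c hc hp
    rw [← gaugeTerm_eq_expanded h he, ← pauliTerm_eq_expanded h he]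
    exact hD c hc hp
  · intro O hO hpO hC
    -- The conclusion mentions no coordinates on `K`, but the volume term has to be removed in some
    -- chart; the preferred chart at `p.2` serves.
    have hc := IsManifold.chart_mem_maximalAtlas (I := 𝓡 k) (n := ∞) p.2
    have hp := mem_chart_source (EuclideanSpace ℝ (Fin k)) p.2
    have hDc := hD _ hc hp
    rw [hC.volumeTerm_eq_zero (SV.isOpen_dom b) hO hb hpO h hψ γ hc hp,
      hC.bracketTerm_eq_zero (SV.isOpen_dom b) hO hb hpO h γ ρ, add_zero, add_zero] at hDc
    refine ⟨hDc, fun τ _ Ac e he => ?_⟩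
    rw [← gaugeTerm_eq_expanded h he, ← pauliTerm_eq_expanded h he]
    exact hDc
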